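/- Let $n\ge 2$ be an integer, $\gamma\in(0,1)$, $m\in\{0,1,2,\dots\}$, let $\mu_0\le\mu_1\le\dots$ be the eigenvalues of $-\Delta_{\mathbb S^{n-1}}$ repeated according to multiplicity, and put $$A_m=\tfrac12+\tfrac\gamma2+\tfrac12\sqrt{(\tfrac n2-1)^2+\mu_m},\qquad B_m=\tfrac12-\tfrac\gamma2+\tfrac12\sqrt{(\tfrac n2-1)^2+\mu_m},$$ $$\Theta_m(z)=2^{2\gamma}\frac{\Gamma(A_m+\frac{zi}{2})\,\Gamma(A_m-\frac{zi}{2})}{\Gamma(B_m+\frac{zi}{2})\,\Gamma(B_m-\frac{zi}{2})}\quad(z\in\mathbb C),\qquad \Lambda_{n,\gamma}=2^{2\gamma}\left(\frac{\Gamma(\frac{n+2\gamma}{4})}{\Gamma(\frac{n-2\gamma}{4})}\right)^2 .$$ Let $P_\gamma^{(m)}$ be the Fourier multiplier on $\mathbb R$ with the (even) symbol $\Theta_m(\xi)$, that is $\widehat{P_\gamma^{(m)}\varphi}=\Theta_m\hat\varphi$ for $\varphi\in C_c^\infty(\mathbb R)$. For locally integrable $w,h$, the equation $P_\gamma^{(m)}w-\kappa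 w=h$ is understood in the sense of distributions: for all $\varphi\in C_c^\infty(\mathbb R)$, $w\,P_\gamma^{(m)}\varphi$ is integrable and $\int_{\mathbb R}w\,(P_\gamma^{(m)}\varphi-\kappa\varphi)\,dt=\int_{\mathbb R}h\,\varphi\,dt$. Let $0\le\kappa<\Lambda_{n,\gamma}$. Then $1/(\Theta_m(z)-\kappa)$ is meromorphic on $\mathbb C$, and its poles are exactly the points $\pm\tau_j\pm i\sigma_j$, $j=0,1,2,\dots$, for pairwise distinct pairs $(\sigma_j,\tau_j)$ with $\sigma_0\le\sigma_1\le\sigma_2\le\cdots\to\infty$, $0<\sigma_0<\sigma_j$ for $j\ge1$, $\tau_j\ge0$, $\tau_0=0$, and, for all large $j$, $\tau_j=0$ and $\sigma_j$ strictly increasing. Moreover, there are real constants $c_0$ and $c_j,c_j'$ ($j\ge1$), depending only on $n,\gamma,\kappa,m$, such that for $t\neq0$ the series $$\mathcal G_m(t)=c_0e^{-\sigma_0|t|}+\sum_{j=1}^\infty e^{-\sigma_j|t|}\left[c_j\cos(\tau_j|t|)+c_j'\sin(\tau_j|t|)\right]$$ converges, equals the Green's function $$\lim_{R\to\infty}\frac1{2\pi}\int_{-R}^R\frac{e^{i\xi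 t}}{\Theta_m(\xi)-\kappa}\,d\xi ,$$ and defines an even function that is $C^\infty$ on $\mathbb R\setminus\{0\}$, and such that the following holds for every locally integrable $h:\mathbb R\to\mathbb R$ and all real $\delta,\delta_0>-\sigma_0$ with $$h(t)=O(e^{-\delta t})\ \text{ as } t\to+\infty,\qquad h(t)=O(e^{\delta_0t})\ \text{ as } t\to-\infty .$$ (a) The integral $w_p(t)=\int_{\mathbb R}\mathcal G_m(t-t')h(t')\,dt'$ converges absolutely for almost every $t$, and for every $t$ near which $h$ is bounded, and $w_p$ is a solution of $P_\gamma^{(m)}w_p-\kappa w_p=h$. (b) If $\delta>\sigma_J$ for some $J\in\{0,1,2,\dots\}$, then $e^{\sigma_jt}h(t)$ is integrable for $0\le j\le J$, and, with $$C_0=\int_{\mathbb R}e^{\sigma_0t'}h(t')\,dt',\quad C_j^1=\int_{\mathbb R}e^{\sigma_jt'}\cos(\tau_jt')h(t')\,dt',\quad C_j^2=\int_{\mathbb R}e^{\sigma_jt'}\sin(\tau_jt')h(t')\,dt',$$ one has, as $t\to+\infty$, $$w_p(t)=c_0C_0e^{-\sigma_0t}+\sum_{j=1}^Jc_j\left(C_j^1\cos(\tau_jt)+C_j^2\sin(\tau_jt)\right)e^{-\sigma_jt}+R_J(t),$$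 where $R_J(t)=O(e^{-\min\{\delta,\sigma_{J+1}\}t})$ if $\delta\ne\sigma_{J+1}$, and $R_J(t)=O(t\,e^{-\delta t})$ if $\delta=\sigma_{J+1}$. Furthermore, as $t\to-\infty$, $w_p(t)=O(e^{-\min\{\delta_0,\sigma_0\}|t|})$ if $\delta_0\neq\sigma_0$, and $w_p(t)=O(|t|e^{-\delta_0|t|})$ if $\delta_0=\sigma_0$. -/

import Mathlib

open Real Set Filter Topology MeasureTheory Asymptotics
open scoped ContDiff

noncomputable section

namespace FractionalHardy

/-- Dimension of the space of spherical harmonics of degree `ℓ` on the unit sphere of `ℝⁿ`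
(for `n ≥ 2`). -/
def harmonicDim (n ℓ : ℕ) : ℕ :=
  (n + ℓ - 1).choose (n - 1) - (n + ℓ - 3).choose (n - 1)

/-- Degree of the `m`-th spherical harmonic (`m = 0, 1, 2, …`), when a basis of spherical harmonics
is listed by nondecreasing degree. -/
def harmonicDegree (n m : ℕ) : ℕ :=
  sInf {ℓ : ℕ | m < ∑ i ∈ Finset.range (ℓ + 1), harmonicDim n i}

/-- The `m`-th eigenvalue of (minus) the Laplace–Beltrami operator on the unit sphere of `ℝⁿ`,
repeated according to multiplicity: `ℓ (ℓ + n - 2)`, where `ℓ` is the degree. -/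
def sphereEigenvalue (n m : ℕ) : ℝ :=
  (harmonicDegree n m : ℝ) * ((harmonicDegree n m : ℝ) + (n : ℝ) - 2)

/-- The Hardy constant `Λ_{n,γ}`. -/
def hardyConst (n : ℕ) (γ : ℝ) : ℝ :=
  (2 : ℝ) ^ (2 * γ) *
    (Real.Gamma (((n : ℝ) + 2 * γ) / 4) / Real.Gamma (((n : ℝ) - 2 * γ) / 4)) ^ 2

/-- The constant `A_m`. -/
def coeffA (n : ℕ) (γ : ℝ) (m : ℕ) : ℝ :=
  1 / 2 + γ / 2 + 1 / 2 * √(((n : ℝ) / 2 - 1) ^ 2 + sphereEigenvalue n m)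

/-- The constant `B_m`. -/
def coeffB (n : ℕ) (γ : ℝ) (m : ℕ) : ℝ :=
  1 / 2 - γ / 2 + 1 / 2 * √(((n : ℝ) / 2 - 1) ^ 2 + sphereEigenvalue n m)

/-- The symbol `Θ_m(z)` of the projected conformal fractional Laplacian `P_γ^{(m)}` on the
cylinder, as a function of a complex variable. -/
def symbol (n : ℕ) (γ : ℝ) (m : ℕ) (z : ℂ) : ℂ :=
  (((2 : ℝ) ^ (2 * γ) : ℝ) : ℂ) *
    (Complex.Gamma ((coeffA n γ m : ℂ) + z * Complex.I / 2) *
      Complex.Gamma ((coeffA n γ m : ℂ) - z * Complex.I / 2)) /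
    (Complex.Gamma ((coeffB n γ m : ℂ) + z * Complex.I / 2) *
      Complex.Gamma ((coeffB n γ m : ℂ) - z * Complex.I / 2))

/-- One-dimensional Fourier transform with the normalisation `(2π)^{-1/2} ∫ e^{-iξt} v(t) dt`. -/
def fourierHat (v : ℝ → ℂ) (ξ : ℝ) : ℂ :=
  ((1 / √(2 * π) : ℝ) : ℂ) * ∫ t : ℝ, Complex.exp (-Complex.I * ξ * t) * v t

/-- The operator `P_γ^{(m)}` on test functions: the Fourier multiplier with symbol `Θ_m`. -/
def projOp (n : ℕ) (γ : ℝ) (m : ℕ) (φ : ℝ → ℂ) (t : ℝ) : ℂ :=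
  ((1 / √(2 * π) : ℝ) : ℂ) *
    ∫ ξ : ℝ, Complex.exp (Complex.I * ξ * t) * (symbol n γ m (ξ : ℂ) * fourierHat φ ξ)

/-- `w` solves `P_γ^{(m)} w - κ w = h` on `ℝ` in the sense of distributions. Since the symbol is
even, `P_γ^{(m)}` is its own transpose, and it is moved onto the test function `φ`. The function
`P_γ^{(m)} φ` decays exponentially, so that `w` may grow exponentially; the convergence of the
pairing is part of the definition. -/
def IsSolution (n : ℕ) (γ : ℝ) (m : ℕ) (κ : ℝ) (w h : ℝ → ℝ) : Prop :=
  LocallyIntegrable w ∧ LocallyIntegrable h ∧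
    ∀ φ : ℝ → ℂ, ContDiff ℝ ∞ φ → HasCompactSupport φ →
      Integrable (fun t : ℝ => (w t : ℂ) * projOp n γ m φ t) ∧
      ∫ t : ℝ, (w t : ℂ) * (projOp n γ m φ t - (κ : ℂ) * φ t) = ∫ t : ℝ, (h t : ℂ) * φ t

/-- `1 / (Θ_m - κ)` is meromorphic on `ℂ`, and `(σ_j, τ_j)`, `j = 0, 1, 2, …`, enumerate its poles:
these are exactly the points `±τ_j ± i σ_j`. The pairs are pairwise distinct, listed by
nondecreasing `σ_j`; `σ_0` is positive and smaller than all others, `τ_0 = 0`, for large `j` one has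
`τ_j = 0` and `σ_j` increases strictly, and there is no accumulation point.
The value of the function at a single point is irrelevant for its order there. -/
structure IsPoleSequence (n : ℕ) (γ : ℝ) (m : ℕ) (κ : ℝ) (σ τ : ℕ → ℝ) : Prop where
  meromorphic : ∀ z : ℂ, MeromorphicAt (fun z : ℂ => (symbol n γ m z - (κ : ℂ))⁻¹) z
  poles : ∀ z : ℂ, meromorphicOrderAt (fun z : ℂ => (symbol n γ m z - (κ : ℂ))⁻¹) z < 0 ↔
    ∃ j : ℕ, |z.re| = τ j ∧ |z.im| = σ j
  injective : Function.Injective (fun j : ℕ => (σ j, τ j))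
  monotone : Monotone σ
  sigma_zero_pos : 0 < σ 0
  sigma_zero_lt : ∀ j : ℕ, 1 ≤ j → σ 0 < σ j
  tau_nonneg : ∀ j : ℕ, 0 ≤ τ j
  tau_zero : τ 0 = 0
  eventually_real : ∃ N : ℕ, (∀ j : ℕ, N ≤ j → τ j = 0) ∧ StrictMonoOn σ (Ici N)
  tendsto : Tendsto σ atTop atTop

/-- The `j`-th term `e^{-σ_j|t|} (c_j cos(τ_j|t|) + c'_j sin(τ_j|t|))`. -/
def greenTerm (σ τ c c' : ℕ → ℝ) (j : ℕ) (t : ℝ) : ℝ :=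
  Real.exp (-σ j * |t|) * (c j * Real.cos (τ j * |t|) + c' j * Real.sin (τ j * |t|))

/-- `𝓖(t) = c_0 e^{-σ_0|t|} + ∑_{j ≥ 1} e^{-σ_j|t|} (c_j cos(τ_j|t|) + c'_j sin(τ_j|t|))`. -/
def green (σ τ c c' : ℕ → ℝ) (t : ℝ) : ℝ :=
  c 0 * Real.exp (-σ 0 * |t|) + ∑' j : ℕ, greenTerm σ τ c c' (j + 1) t

/-- The convolution `∫ 𝓖(t - s) h(s) ds`. -/
def particular (G h : ℝ → ℝ) (t : ℝ) : ℝ := ∫ s : ℝ, G (t - s) * h s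

/-- The moment `∫ e^{σs} cos(τs) h(s) ds`. -/
def momentCos (σ τ : ℝ) (h : ℝ → ℝ) : ℝ := ∫ s : ℝ, Real.exp (σ * s) * Real.cos (τ * s) * h s

/-- The moment `∫ e^{σs} sin(τs) h(s) ds`. -/
def momentSin (σ τ : ℝ) (h : ℝ → ℝ) : ℝ := ∫ s : ℝ, Real.exp (σ * s) * Real.sin (τ * s) * h s

/-- The expansion `c_0 C_0 e^{-σ_0 t} + ∑_{1 ≤ j ≤ J} c_j (C_j^1 cos(τ_j t) + C_j^2 sin(τ_j t))
e^{-σ_j t}`, where `C_0 = ∫ e^{σ_0 s} h(s) ds` and `C_j^1`, `C_j^2` are the moments of `h`. -/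
def expansion (σ τ c : ℕ → ℝ) (h : ℝ → ℝ) (J : ℕ) (t : ℝ) : ℝ :=
  c 0 * (∫ s : ℝ, Real.exp (σ 0 * s) * h s) * Real.exp (-σ 0 * t) +
    ∑ j ∈ Finset.Icc 1 J,
      c j * (momentCos (σ j) (τ j) h * Real.cos (τ j * t) +
        momentSin (σ j) (τ j) h * Real.sin (τ j * t)) * Real.exp (-σ j * t)

end FractionalHardy

end

open FractionalHardy

open FractionalHardy

/-! All poles of `1 / (Θ_m - κ)` turn out to be simple and purely imaginary, so that `τ_j = 0` and
`c'_j = 0` for every `j`, and the weights `c_j` are positive. The Green's function is then a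
positive combination of the functions `e^{-σ_j|t|}`.

By Euler's limit formula for `Γ`, the symbol at real `ξ` is, up to the factor `2^{2γ}`, the limit of
`N^{2γ} ∏ ((B+k)² + x) / ((A+k)² + x)` with `x = ξ²/4`. Since `B < A < B + 1`, zeros and poles
interlace in `x`. After subtracting `κ` there is still exactly one zero per gap, and the reciprocal
is a constant plus a sum of simple fractions with nonnegative residues
(`exists_partialFraction_inv_sub`). The residues, suitably normalised, have total mass at most the
value at `x = 0`, which stays bounded because `κ < Λ ≤ Θ_m(0)` (`hardyConst_le`). Compactness gives
the same form in the limit (`exists_stieltjes_inv_sub`). The limit could lose strict inequalities;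
they are recovered by continuing to complex `z` and using that `1 / (Θ_m - κ)` vanishes at the poles
of `Θ_m` (`exists_partialFractions_gammaQuot`).

Each fraction `2σ / (σ² + ξ²)` is the Fourier transform of `e^{-σ|t|}`, and the weights satisfy `∑
c_j / σ_j < ∞`. Hence the Green's function is integrable even against `e^{α|t|}` with `α < σ_0`, and
it is the principal-value inverse transform (`ExpSeries.tendsto_integral_green`). Removing its first
`M` exponentials leaves a tail `O(e^{-σ_M t})`; splitting the convolution accordingly gives the
expansion at `+∞` (`ExpSeries.exists_bound_remainder`), and reflection gives the bound at `-∞`.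

That the convolution is a solution follows by Fubini from `𝓖 * (P - κ)φ = φ`, once `Pφ` is known to
decay exponentially. For this, `Γ(z+1) = zΓ(z)` writes `Θ_m` as `B² + ξ²/4` times the reciprocal of
a Gamma quotient of the same kind (`gammaQuot_eq_mul`). So `Pφ` is an exponentially decaying kernel
convolved with a combination of `φ` and `φ''`. -/

/-! ### Interlacing rational functions -/

/-- Induction on the number of factors. The residues stay nonnegative because the new zero `a N` and
the new pole `s N` both lie to the right of all earlier poles, with `s N < a N`. -/
theorem exists_nonneg_partialFraction_of_interlacing (s a : ℕ → ℝ) (N : ℕ)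
    (hsa : ∀ j < N, s j < a j) (has : ∀ i j, i < j → j < N → a i < s j) :
    ∃ r : ℕ → ℝ, (∀ j, 0 ≤ r j) ∧ ∀ x, (∀ j < N, s j ≠ x) →
      ∏ k ∈ Finset.range N, ((a k - x) / (s k - x)) =
        1 + ∑ j ∈ Finset.range N, r j / (s j - x) := by
  induction N with
  | zero => exact ⟨fun _ => 0, fun _ => le_rfl, fun x _ => by simp⟩
  | succ N ih =>
    obtain ⟨r, hr, h⟩ := ih (fun j hj => hsa j (by omega)) (fun i j hi hj => has i j hi (by omega))
    set S := s N with hS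
    have hlt : ∀ j < N, s j < S := fun j hj => (hsa j (by omega)).trans (has j N hj (by omega))
    have hd : 0 < a N - S := sub_pos.2 (hsa N (by omega))
    have hprod : 0 ≤ 1 + ∑ j ∈ Finset.range N, r j / (s j - S) := by
      rw [← h S (fun j hj => (hlt j hj).ne)]
      refine Finset.prod_nonneg fun k hk => ?_
      have hk := Finset.mem_range.1 hk
      exact div_nonneg_of_nonpos (sub_nonpos.2 (has k N hk (by omega)).le)
        (sub_nonpos.2 (hlt k hk).le)
    -- Multiplying by `(a N - x) / (S - x)` scales an old residue by the value of this factor at `s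
    -- j`; the residue at the new pole is `a N - S` times the old product at `S`.
    refine ⟨fun j => if j < N then r j * ((a N - s j) / (S - s j)) else
      (a N - S) * (1 + ∑ j ∈ Finset.range N, r j / (s j - S)), fun j => ?_, fun x hx => ?_⟩
    · dsimp only
      split_ifs with hj
      · have h1 := hlt j hj
        exact mul_nonneg (hr j) (div_nonneg (by linarith) (by linarith))
      · exact mul_nonneg hd.le hprod
    · have hxS : S - x ≠ 0 := sub_ne_zero.2 (hx N (by omega))
      rw [Finset.prod_range_succ, h x (fun j hj => hx j (by omega)), Finset.sum_range_succ]
      have e : ∑ j ∈ Finset.range N, (if j < N then r j * ((a N - s j) / (S - s j)) else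
          (a N - S) * (1 + ∑ j ∈ Finset.range N, r j / (s j - S))) / (s j - x) =
          ∑ j ∈ Finset.range N, (r j / (s j - x) * ((a N - x) / (S - x)) -
            (a N - S) / (S - x) * (r j / (s j - S))) := by
        refine Finset.sum_congr rfl fun j hj => ?_
        have hj := Finset.mem_range.1 hj
        have h1 : s j - x ≠ 0 := sub_ne_zero.2 (hx j (by omega))
        have h2 : S - s j ≠ 0 := (sub_pos.2 (hlt j hj)).ne'
        have h3 : s j - S ≠ 0 := (sub_neg.2 (hlt j hj)).ne
        rw [if_pos hj]
        field_simp
        ring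
      rw [e, Finset.sum_sub_distrib, ← Finset.sum_mul, ← Finset.mul_sum]
      simp only [lt_irrefl, if_false, ← hS]
      field_simp
      ring

/-- The left end of the `j`-th gap between consecutive poles `a k`. -/
def gapLeft (a : ℕ → ℝ) : ℕ → ℝ
  | 0 => 0
  | j + 1 => a j

theorem lt_of_interlacing {a b : ℕ → ℝ} (hba : ∀ k, b k < a k) (hab : ∀ k, a k < b (k + 1)) :
    StrictMono a ∧ StrictMono b ∧ (∀ i j, i < j → a i < b j) := by
  have ha : StrictMono a := strictMono_nat_of_lt_succ fun k => (hab k).trans (hba _)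
  have hb : StrictMono b := strictMono_nat_of_lt_succ fun k => (hba k).trans (hab _)
  exact ⟨ha, hb, fun i j hij => (hab i).trans_le (hb.monotone hij)⟩

/-- Intermediate value theorem in each gap: at `b j` only the `κ`-product survives, at the left end
`a (j-1)` only the `Q`-product, and the signs are opposite. In the first gap the left end is `0`,
where the sign is the hypothesis `h0`. For `κ = 0` the root is `b j` exactly, which is recorded
because explicit exponents are needed in that case. -/
theorem exists_root_of_interlacing {a b : ℕ → ℝ} (hba : ∀ k, b k < a k)
    (hab : ∀ k, a k < b (k + 1)) (hb0 : 0 < b 0) {Q κ : ℝ} (hκ : 0 ≤ κ) (hQ : κ < Q) (N : ℕ)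
    (h0 : κ * ∏ k ∈ Finset.range N, a k < Q * ∏ k ∈ Finset.range N, b k) (j : ℕ) (hj : j < N) :
    ∃ s, gapLeft a j < s ∧ s ≤ b j ∧ (κ = 0 → s = b j) ∧
      Q * ∏ k ∈ Finset.range N, (b k - s) - κ * ∏ k ∈ Finset.range N, (a k - s) = 0 := by
  obtain ⟨hma, hmb, hlt⟩ := lt_of_interlacing hba hab
  have hz : ∏ k ∈ Finset.range N, (b k - b j) = 0 :=
    Finset.prod_eq_zero (Finset.mem_range.2 hj) (sub_self _)
  have hgap : gapLeft a j < b j := by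
    cases j with
    | zero => exact hb0
    | succ j => exact hab j
  rcases hκ.eq_or_lt with rfl | hκ
  · exact ⟨b j, hgap, le_rfl, fun _ => rfl, by rw [hz]; ring⟩
  set R : ℝ → ℝ := fun x => Q * ∏ k ∈ Finset.range N, (b k - x) -
    κ * ∏ k ∈ Finset.range N, (a k - x) with hR
  have hcont : Continuous R := by fun_prop
  have hRb : R (b j) = -(κ * ∏ k ∈ Finset.range N, (a k - b j)) := by
    simp only [hR, hz]; ring
  have hneg : R (gapLeft a j) * R (b j) < 0 := by
    rw [hRb]
    cases j with
    | zero =>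
      have h1 : 0 < R (gapLeft a 0) := by simpa [hR, gapLeft] using h0
      have h2 : 0 < ∏ k ∈ Finset.range N, (a k - b 0) :=
        Finset.prod_pos fun k _ => sub_pos.2 ((hba 0).trans_le (hma.monotone (Nat.zero_le k)))
      have := mul_pos h1 (mul_pos hκ h2)
      linarith
    | succ j =>
      have hz' : ∏ k ∈ Finset.range N, (a k - a j) = 0 :=
        Finset.prod_eq_zero (Finset.mem_range.2 (by omega)) (sub_self _)
      have h1 : R (gapLeft a (j + 1)) = Q * ∏ k ∈ Finset.range N, (b k - a j) := by
        simp only [hR, gapLeft, hz']; ring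
      -- The two products are compared factor by factor: `b k - a j` and `a k - b (j+1)` are both
      -- positive for `k > j` and both negative for `k ≤ j`.
      have h2 : 0 < ∏ k ∈ Finset.range N, ((b k - a j) * (a k - b (j + 1))) := by
        refine Finset.prod_pos fun k _ => ?_
        rcases lt_or_ge j k with hk | hk
        · exact mul_pos (sub_pos.2 (hlt j k hk))
            (sub_pos.2 ((hba _).trans_le (hma.monotone hk)))
        · exact mul_pos_of_neg_of_neg
            (sub_neg.2 ((hba k).trans_le (hma.monotone hk))) (sub_neg.2 (hlt k (j + 1) (by omega)))
      rw [Finset.prod_mul_distrib] at h2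
      rw [h1]
      have := mul_pos (mul_pos (hκ.trans hQ) hκ) h2
      linarith
  have hmem : (0 : ℝ) ∈ uIcc (R (gapLeft a j)) (R (b j)) := by
    rw [mem_uIcc]
    rcases mul_neg_iff.1 hneg with h | h
    · exact Or.inr ⟨h.2.le, h.1.le⟩
    · exact Or.inl ⟨h.1.le, h.2.le⟩
  obtain ⟨s, hs, hs0⟩ := intermediate_value_uIcc hcont.continuousOn hmem
  rw [uIcc_of_le hgap.le] at hs
  refine ⟨s, hs.1.lt_of_ne ?_, hs.2, fun h => absurd h hκ.ne', hs0⟩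
  rintro rfl
  rw [hs0] at hneg
  simp at hneg

/-- Both sides are polynomials in `x` with the same coefficient of `x^N`, and they agree at the `N`
distinct points `s j`. In terms of the monic polynomials `M u`, the difference has degree below `N`
and `N` roots. -/
theorem prod_sub_prod_eq_of_roots {a b s : ℕ → ℝ} {Q κ : ℝ} {N : ℕ}
    (hs : Set.InjOn s (Finset.range N))
    (h : ∀ j < N, Q * ∏ k ∈ Finset.range N, (b k - s j) -
      κ * ∏ k ∈ Finset.range N, (a k - s j) = 0) (x : ℝ) :
    Q * ∏ k ∈ Finset.range N, (b k - x) - κ * ∏ k ∈ Finset.range N, (a k - x) =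
      (Q - κ) * ∏ k ∈ Finset.range N, (s k - x) := by
  classical
  open Polynomial in
  let M : (ℕ → ℝ) → ℝ[X] := fun u => ∏ k ∈ Finset.range N, (X - C (u k))
  have hmon : ∀ u, (M u).Monic := fun u => monic_prod_of_monic _ _ fun k _ => monic_X_sub_C _
  have hdeg : ∀ u, (M u).degree = N := fun u => by
    simp [M, degree_prod]
  have hev : ∀ u y, ∏ k ∈ Finset.range N, (u k - y) = (-1) ^ N * (M u).eval y := fun u y => by
    simp only [M, eval_prod, eval_sub, eval_X, eval_C]
    rw [← Finset.card_range N, ← Finset.prod_const, Finset.card_range, ← Finset.prod_mul_distrib]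
    exact Finset.prod_congr rfl fun k _ => by ring
  have hlt : ∀ u, (M u - M s).degree < N := fun u => by
    rw [← hdeg u]
    exact degree_sub_lt_left (by rw [hdeg, hdeg]) (hmon u).ne_zero
      (by rw [(hmon u).leadingCoeff, (hmon s).leadingCoeff])
  have hMs : ∀ j < N, (M s).eval (s j) = 0 := fun j hj => by
    simp only [M, eval_prod, eval_sub, eval_X, eval_C]
    exact Finset.prod_eq_zero (Finset.mem_range.2 hj) (sub_self _)
  have key : C Q * (M b - M s) - C κ * (M a - M s) = 0 := by
    refine eq_zero_of_degree_lt_of_eval_index_eq_zero (Finset.range N) hs ?_ fun j hj => ?_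
    · rw [Finset.card_range]
      refine (degree_sub_le _ _).trans_lt (max_lt ?_ ?_)
      · rw [← smul_eq_C_mul]; exact (degree_smul_le _ _).trans_lt (hlt b)
      · rw [← smul_eq_C_mul]; exact (degree_smul_le _ _).trans_lt (hlt a)
    · have hj := Finset.mem_range.1 hj
      have h1 := h j hj
      rw [hev, hev] at h1
      have h2 : (-1 : ℝ) ^ N ≠ 0 := by simp
      simp only [eval_sub, eval_mul, eval_C, hMs j hj]
      apply mul_left_cancel₀ h2
      linarith
  have := congrArg (eval x) key
  simp only [eval_sub, eval_mul, eval_C, eval_zero] at this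
  rw [hev, hev, hev]
  linear_combination (-1 : ℝ) ^ N * this

theorem exists_partialFraction_inv_sub {a b : ℕ → ℝ} (hba : ∀ k, b k < a k)
    (hab : ∀ k, a k < b (k + 1)) (hb0 : 0 < b 0) {Q κ : ℝ} (hκ : 0 ≤ κ) (hQ : κ < Q) (N : ℕ)
    (h0 : κ * ∏ k ∈ Finset.range N, a k < Q * ∏ k ∈ Finset.range N, b k) :
    ∃ s r : ℕ → ℝ, (∀ j, gapLeft a j < s j) ∧ (∀ j, s j ≤ b j) ∧ (κ = 0 → s = b) ∧
      (∀ j, 0 ≤ r j) ∧ ∀ x, 0 ≤ x →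
        (Q * ∏ k ∈ Finset.range N, ((b k + x) / (a k + x)) - κ)⁻¹ =
          (Q - κ)⁻¹ + ∑ j ∈ Finset.range N, r j / (s j + x) := by
  obtain ⟨hma, hmb, hlt⟩ := lt_of_interlacing hba hab
  have hex : ∀ j, ∃ s, gapLeft a j < s ∧ s ≤ b j ∧ (κ = 0 → s = b j) ∧ (j < N →
      Q * ∏ k ∈ Finset.range N, (b k - s) - κ * ∏ k ∈ Finset.range N, (a k - s) = 0) := by
    intro j
    by_cases hj : j < N
    · obtain ⟨s, h1, h2, h3, h4⟩ := exists_root_of_interlacing hba hab hb0 hκ hQ N h0 j hj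
      exact ⟨s, h1, h2, h3, fun _ => h4⟩
    · refine ⟨b j, ?_, le_rfl, fun _ => rfl, fun h => absurd h hj⟩
      cases j with
      | zero => exact hb0
      | succ j => exact hab j
  choose s hs1 hs2 hs3 hs4 using hex
  have hsa : ∀ j, s j < a j := fun j => (hs2 j).trans_lt (hba j)
  have has : ∀ i j, i < j → a i < s j := by
    intro i j hij
    obtain ⟨j, rfl⟩ : ∃ l, j = l + 1 := ⟨j - 1, by omega⟩
    exact (hma.monotone (show i ≤ j by omega)).trans_lt (hs1 (j + 1))
  have hsm : StrictMono s := strictMono_nat_of_lt_succ fun k => (hsa k).trans (has k _ (by omega))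
  have hs0 : ∀ j, 0 < s j := fun j => (hs1 0).trans_le (hsm.monotone (Nat.zero_le j))
  obtain ⟨r, hr, hpf⟩ := exists_nonneg_partialFraction_of_interlacing s a N
    (fun j _ => hsa j) (fun i j hij _ => has i j hij)
  have hQκ : 0 < Q - κ := sub_pos.2 hQ
  refine ⟨s, fun j => (Q - κ)⁻¹ * r j, hs1, hs2, fun h => funext fun j => hs3 j h,
    fun j => mul_nonneg (inv_nonneg.2 hQκ.le) (hr j), fun x hx => ?_⟩
  have e1 := prod_sub_prod_eq_of_roots hsm.injective.injOn hs4 (-x)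
  have e2 := hpf (-x) (fun j _ => by have := hs0 j; linarith)
  simp only [sub_neg_eq_add] at e1 e2
  have hA : ∏ k ∈ Finset.range N, (a k + x) ≠ 0 :=
    (Finset.prod_pos fun k _ => by have := hs0 k; have := hsa k; linarith).ne'
  have hS : ∏ k ∈ Finset.range N, (s k + x) ≠ 0 :=
    (Finset.prod_pos fun k _ => by have := hs0 k; linarith).ne'
  rw [Finset.prod_div_distrib] at e2
  have e3 : Q * ∏ k ∈ Finset.range N, ((b k + x) / (a k + x)) - κ =
      (Q - κ) * ((∏ k ∈ Finset.range N, (s k + x)) / ∏ k ∈ Finset.range N, (a k + x)) := by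
    rw [Finset.prod_div_distrib]
    field_simp
    linarith
  rw [e3, mul_inv, inv_div, e2, mul_add, mul_one, Finset.mul_sum]
  simp only [mul_div_assoc]

/-! ### Passage to the limit -/

/-- `F x / F 0` is at least any finite product of the factors `u k x ≥ 1`, which tend to `a k / b k`
as `x → ∞`. The products of `a k / b k` are unbounded, since `Q N → ∞` while `Q N * ∏ b k / a k`
converges to `F 0`. -/
theorem tendsto_atTop_of_interlacing_prod {a b : ℕ → ℝ} (hba : ∀ k, b k < a k)
    (hb : ∀ k, 0 < b k) {Q : ℕ → ℝ} (hQ : Tendsto Q atTop atTop) {F : ℝ → ℝ} (h0 : 0 < F 0)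
    (hF : ∀ x, 0 ≤ x → Tendsto (fun N => Q N * ∏ k ∈ Finset.range (N + 1),
      ((b k + x) / (a k + x))) atTop (𝓝 (F x))) :
    Tendsto F atTop atTop := by
  have ha : ∀ k, 0 < a k := fun k => (hb k).trans (hba k)
  set u : ℕ → ℝ → ℝ := fun k x => (b k + x) * a k / ((a k + x) * b k) with hu
  have hu1 : ∀ k x, 0 ≤ x → 1 ≤ u k x := fun k x hx => by
    rw [hu, le_div_iff₀ (mul_pos (by linarith [ha k]) (hb k))]
    nlinarith [hba k, ha k, hb k]
  have hlow : ∀ K x, 0 ≤ x → F 0 * ∏ k ∈ Finset.range (K + 1), u k x ≤ F x := by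
    intro K x hx
    refine le_of_tendsto_of_tendsto ((hF 0 le_rfl).mul_const _) (hF x hx) ?_
    filter_upwards [eventually_ge_atTop K, hQ.eventually_ge_atTop 0] with N hN hQN
    have h1 : ∏ k ∈ Finset.range (K + 1), u k x ≤ ∏ k ∈ Finset.range (N + 1), u k x :=
      monotone_nat_of_le_succ (f := fun n => ∏ k ∈ Finset.range n, u k x) (fun n => by
        rw [Finset.prod_range_succ]
        exact le_mul_of_one_le_right (Finset.prod_nonneg fun k _ =>
          zero_le_one.trans (hu1 k x hx)) (hu1 n x hx)) (Nat.succ_le_succ hN)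
    have h2 : 0 ≤ Q N * ∏ k ∈ Finset.range (N + 1), ((b k + 0) / (a k + 0)) :=
      mul_nonneg hQN (Finset.prod_nonneg fun k _ => by
        have := ha k; have := hb k; positivity)
    refine (mul_le_mul_of_nonneg_left h1 h2).trans_eq ?_
    rw [mul_assoc, ← Finset.prod_mul_distrib]
    congr 1
    refine Finset.prod_congr rfl fun k _ => ?_
    have := ha k; have := hb k
    have : a k + x ≠ 0 := by positivity
    simp only [hu, add_zero]
    field_simp
  have hprod : Tendsto (fun K => F 0 * ∏ k ∈ Finset.range (K + 1), (a k / b k)) atTop atTop := by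
    refine Tendsto.const_mul_atTop h0 ?_
    refine tendsto_atTop_mono' _ ?_ (hQ.const_mul_atTop (inv_pos.2 (show 0 < F 0 + 1 by linarith)))
    have := (hF 0 le_rfl).eventually (gt_mem_nhds (show F 0 < F 0 + 1 by linarith))
    filter_upwards [this] with K hK
    have hP : 0 < ∏ k ∈ Finset.range (K + 1), (a k / b k) :=
      Finset.prod_pos fun k _ => div_pos (ha k) (hb k)
    have e : ∏ k ∈ Finset.range (K + 1), ((b k + 0) / (a k + 0)) =
        (∏ k ∈ Finset.range (K + 1), (a k / b k))⁻¹ := by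
      rw [← Finset.prod_inv_distrib]
      exact Finset.prod_congr rfl fun k _ => by rw [inv_div, add_zero, add_zero]
    rw [e, ← div_eq_mul_inv, div_lt_iff₀ hP] at hK
    rw [inv_mul_le_iff₀ (by linarith)]
    exact hK.le
  refine tendsto_atTop.2 fun M => ?_
  obtain ⟨K, hK⟩ := (hprod.eventually_gt_atTop M).exists
  have hlim : Tendsto (fun x => F 0 * ∏ k ∈ Finset.range (K + 1), u k x) atTop
      (𝓝 (F 0 * ∏ k ∈ Finset.range (K + 1), (a k / b k))) := by
    refine Tendsto.const_mul _ (tendsto_finsetProd _ fun k _ => ?_)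
    have e : ∀ᶠ x : ℝ in atTop, (1 - (a k - b k) / (a k + x)) * (a k / b k) = u k x := by
      filter_upwards [eventually_ge_atTop 0] with x hx
      have := ha k; have := hb k
      have : a k + x ≠ 0 := by positivity
      simp only [hu]
      field_simp
      ring
    refine Tendsto.congr' e ?_
    have : Tendsto (fun x : ℝ => (a k - b k) / (a k + x)) atTop (𝓝 0) :=
      tendsto_const_nhds.div_atTop (tendsto_atTop_add_const_left _ _ tendsto_id)
    simpa using (this.const_sub 1).mul_const (a k / b k)
  filter_upwards [hlim.eventually (lt_mem_nhds hK), eventually_ge_atTop 0] with x hx hx0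
  exact hx.le.trans (hlow K x hx0)

theorem exists_tendsto_of_mem_Icc {φ : Ultrafilter ℕ} {u : ℕ → ℝ} {c d : ℝ}
    (h : ∀ᶠ N in (φ : Filter ℕ), u N ∈ Icc c d) :
    ∃ l ∈ Icc c d, Tendsto u φ (𝓝 l) := by
  have := isCompact_Icc (a := c) (b := d)
  obtain ⟨l, hl, hle⟩ := this.ultrafilter_le_nhds (φ.map u) (le_principal_iff.2 h)
  exact ⟨l, hl, hle⟩

/-- Limit of the partial fractions along an ultrafilter, which makes all poles and weights converge
at once. The inequalities for the limits are only weak here: weights may vanish and the first pole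
may be `0`. -/
theorem exists_stieltjes_inv_sub {a b : ℕ → ℝ} (hba : ∀ k, b k < a k)
    (hab : ∀ k, a k < b (k + 1)) (hb0 : 0 < b 0) (hsum : Summable fun k => (b k)⁻¹)
    {Q : ℕ → ℝ} (hQ : Tendsto Q atTop atTop) {κ : ℝ} (hκ : 0 ≤ κ) {F : ℝ → ℝ}
    (hF : ∀ x, 0 ≤ x → Tendsto (fun N => Q N * ∏ k ∈ Finset.range (N + 1),
      ((b k + x) / (a k + x))) atTop (𝓝 (F x))) (h0 : κ < F 0) :
    ∃ s p : ℕ → ℝ, (∀ j, gapLeft a j ≤ s j) ∧ (∀ j, s j ≤ b j) ∧ (κ = 0 → s = b) ∧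
      (∀ j, 0 ≤ p j) ∧ Summable p ∧
      ∀ x, 0 < x → κ < F x ∧ (F x - κ)⁻¹ = ∑' j, p j * s j / (s j + x) := by
  obtain ⟨hma, hmb, hlt⟩ := lt_of_interlacing hba hab
  have hb : ∀ k, 0 < b k := fun k => hb0.trans_le (hmb.monotone (Nat.zero_le k))
  have ha : ∀ k, 0 < a k := fun k => (hb k).trans (hba k)
  have hgap0 : ∀ j, 0 ≤ gapLeft a j := fun j => by
    cases j with
    | zero => exact le_rfl
    | succ j => exact (ha j).le
  have hFinf := tendsto_atTop_of_interlacing_prod hba hb hQ (hκ.trans_lt h0) hF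
  have hFmono : ∀ x, 0 ≤ x → F 0 ≤ F x := by
    intro x hx
    refine le_of_tendsto_of_tendsto (hF 0 le_rfl) (hF x hx) ?_
    filter_upwards [hQ.eventually_ge_atTop 0] with N hQN
    refine mul_le_mul_of_nonneg_left (Finset.prod_le_prod (fun k _ => ?_) fun k _ => ?_) hQN
    · have := ha k; have := hb k; positivity
    · rw [div_le_div_iff₀ (by linarith [ha k]) (by linarith [ha k])]
      nlinarith [hba k]
  have hFκ : ∀ x, 0 ≤ x → κ < F x := fun x hx => h0.trans_le (hFmono x hx)
  set FN : ℕ → ℝ → ℝ := fun N x => Q N * ∏ k ∈ Finset.range (N + 1), ((b k + x) / (a k + x))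
    with hFN
  have hgood : ∀ᶠ N in atTop, κ < Q N ∧ κ < FN N 0 :=
    (hQ.eventually_gt_atTop κ).and ((hF 0 le_rfl).eventually (lt_mem_nhds h0))
  have hex : ∀ N, ∃ s r : ℕ → ℝ, (κ < Q N ∧ κ < FN N 0) →
      (∀ j, gapLeft a j < s j) ∧ (∀ j, s j ≤ b j) ∧ (κ = 0 → s = b) ∧
      (∀ j, 0 ≤ r j) ∧ ∀ x, 0 ≤ x → (FN N x - κ)⁻¹ =
          (Q N - κ)⁻¹ + ∑ j ∈ Finset.range (N + 1), r j / (s j + x) := by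
    intro N
    by_cases h : κ < Q N ∧ κ < FN N 0
    · obtain ⟨s, r, hsr⟩ := exists_partialFraction_inv_sub hba hab hb0 hκ h.1 (N + 1) (by
        have h2 := h.2
        simp only [hFN, add_zero] at h2
        have hA : 0 < ∏ k ∈ Finset.range (N + 1), a k := Finset.prod_pos fun k _ => ha k
        rw [Finset.prod_div_distrib, ← mul_div_assoc, lt_div_iff₀ hA] at h2
        exact h2)
      exact ⟨s, r, fun _ => hsr⟩
    · exact ⟨0, 0, fun h' => absurd h' h⟩
  choose s r hsr using hex
  let φ : Ultrafilter ℕ := hyperfilter ℕ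
  have hφ : (φ : Filter ℕ) ≤ atTop := Nat.hyperfilter_le_atTop
  -- With residues divided by the poles, the weights sum to the value at `x = 0` minus the constant
  -- term `(Q N - κ)⁻¹ ≥ 0`, so they are uniformly bounded.
  set p : ℕ → ℕ → ℝ := fun N j => if j < N + 1 then r N j / s N j else 0 with hp
  have hD : ∀ x, 0 ≤ x → Tendsto (fun N => (FN N x - κ)⁻¹) φ (𝓝 (F x - κ)⁻¹) := fun x hx =>
    (((hF x hx).sub_const κ).inv₀ (sub_pos.2 (hFκ x hx)).ne').mono_left hφ
  set C := (F 0 - κ)⁻¹ + 1 with hC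
  have hCev : ∀ᶠ N in (φ : Filter ℕ), (FN N 0 - κ)⁻¹ ≤ C :=
    ((hD 0 le_rfl).eventually (gt_mem_nhds (lt_add_one _))).mono fun N h => h.le
  have hgood' := hgood.filter_mono hφ
  have hp0 : ∀ᶠ N in (φ : Filter ℕ), ∀ j, 0 ≤ p N j := by
    filter_upwards [hgood'] with N hN j
    obtain ⟨h1, h2, h3, h4, h5⟩ := hsr N hN
    simp only [hp]
    split_ifs
    · exact div_nonneg (h4 j) ((hgap0 j).trans (h1 j).le)
    · exact le_rfl
  have hpsum : ∀ᶠ N in (φ : Filter ℕ), ∀ K, ∑ j ∈ Finset.range K, p N j ≤ C := by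
    filter_upwards [hgood', hp0, hCev] with N hN hpN hCN K
    obtain ⟨h1, h2, h3, h4, h5⟩ := hsr N hN
    have hs1 : ∑ j ∈ Finset.range (N + 1), p N j ≤ C := by
      refine le_trans ?_ hCN
      rw [h5 0 le_rfl]
      have : 0 ≤ (Q N - κ)⁻¹ := inv_nonneg.2 (sub_pos.2 hN.1).le
      have e : ∑ j ∈ Finset.range (N + 1), p N j =
          ∑ j ∈ Finset.range (N + 1), r N j / (s N j + 0) :=
        Finset.sum_congr rfl fun j hj => by
          simp only [hp, if_pos (Finset.mem_range.1 hj), add_zero]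
      linarith
    refine le_trans ?_ hs1
    rw [Finset.sum_subset (f := p N) (Finset.range_mono (le_max_left (N + 1) K))
      (fun j _ hj => if_neg (by simpa using hj))]
    exact Finset.sum_le_sum_of_subset_of_nonneg (Finset.range_mono (le_max_right _ _))
      (fun j _ _ => hpN j)
  have hple : ∀ᶠ N in (φ : Filter ℕ), ∀ j, p N j ∈ Icc 0 C := by
    filter_upwards [hp0, hpsum] with N h1 h2 j
    refine ⟨h1 j, le_trans ?_ (h2 (j + 1))⟩
    exact Finset.single_le_sum (f := p N) (fun i _ => h1 i) (Finset.self_mem_range_succ j)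
  have hsI : ∀ᶠ N in (φ : Filter ℕ), ∀ j, s N j ∈ Icc (gapLeft a j) (b j) := by
    filter_upwards [hgood'] with N hN j
    exact ⟨((hsr N hN).1 j).le, (hsr N hN).2.1 j⟩
  choose p' hp'I hp' using fun j => exists_tendsto_of_mem_Icc (hple.mono fun N h => h j)
  choose s' hs'I hs' using fun j => exists_tendsto_of_mem_Icc (hsI.mono fun N h => h j)
  have hp'sum : Summable p' := by
    refine summable_of_sum_range_le (c := C) (fun j => (hp'I j).1) fun K => ?_
    exact le_of_tendsto (tendsto_finsetSum _ fun j _ => hp' j) (hpsum.mono fun N h => h K)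
  -- Taking the difference of the values at `0` and at `x` improves the terms to `p x / (s + x)`.
  -- These are dominated by `C x / (gapLeft a j + x)`, which is summable because `∑ 1 / b j`
  -- converges.
  have hdiff : ∀ x, 0 < x → (F 0 - κ)⁻¹ - (F x - κ)⁻¹ = ∑' j, p' j * (x / (s' j + x)) := by
    intro x hx
    have hbd : Summable fun j => C * (x / (gapLeft a j + x)) := by
      refine Summable.mul_left _ ?_
      rw [← summable_nat_add_iff 1]
      refine Summable.of_nonneg_of_le (fun j => ?_) (fun j => ?_) (hsum.mul_left x)
      · have := ha j
        simp only [gapLeft]; positivity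
      · simp only [gapLeft]
        rw [← div_eq_mul_inv]
        exact div_le_div_of_nonneg_left hx.le (hb j) (by linarith [hba j])
    have hC0 : 0 ≤ C := add_nonneg (inv_nonneg.2 (sub_pos.2 h0).le) zero_le_one
    have hlim := tendsto_tsum_of_dominated_convergence (𝓕 := (φ : Filter ℕ))
      (f := fun N j => p N j * (x / (s N j + x))) (g := fun j => p' j * (x / (s' j + x))) hbd
      (fun j => (hp' j).mul (tendsto_const_nhds.div ((hs' j).add_const x)
        (by have := (hgap0 j).trans (hs'I j).1; positivity))) (by
        filter_upwards [hple, hsI] with N h1 h2 j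
        have h3 := (hgap0 j).trans (h2 j).1
        have h4 := hgap0 j
        rw [Real.norm_of_nonneg (mul_nonneg (h1 j).1 (by positivity))]
        refine mul_le_mul (h1 j).2 ?_ (by positivity) hC0
        exact div_le_div_of_nonneg_left hx.le (by positivity) (by linarith [(h2 j).1]))
    refine tendsto_nhds_unique (((hD 0 le_rfl).sub (hD x hx.le)).congr' ?_) hlim
    filter_upwards [hgood'] with N hN
    obtain ⟨h1, h2, h3, h4, h5⟩ := hsr N hN
    rw [h5 0 le_rfl, h5 x hx.le, add_sub_add_left_eq_sub, ← Finset.sum_sub_distrib]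
    rw [tsum_eq_sum (s := Finset.range (N + 1)) (fun j hj => by
      simp only [hp]; rw [if_neg (by simpa using hj), zero_mul])]
    refine Finset.sum_congr rfl fun j hj => ?_
    have h6 : 0 < s N j := (hgap0 j).trans_lt (h1 j)
    have : s N j + x ≠ 0 := by positivity
    simp only [hp, if_pos (Finset.mem_range.1 hj), add_zero]
    field_simp
    ring
  have hs'0 : ∀ j, 0 ≤ s' j := fun j => (hgap0 j).trans (hs'I j).1
  have hsplit : ∀ x, 0 < x → Summable (fun j => p' j * s' j / (s' j + x)) ∧
      ∑' j, p' j * (x / (s' j + x)) = ∑' j, p' j - ∑' j, p' j * s' j / (s' j + x) := by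
    intro x hx
    have h1 : Summable (fun j => p' j * s' j / (s' j + x)) := by
      refine Summable.of_nonneg_of_le (fun j => ?_) (fun j => ?_) hp'sum
      · have := hs'0 j; have := (hp'I j).1; positivity
      · have := hs'0 j; have := (hp'I j).1
        rw [div_le_iff₀ (by positivity)]
        nlinarith
    refine ⟨h1, ?_⟩
    rw [← hp'sum.tsum_sub h1]
    refine tsum_congr fun j => ?_
    have := hs'0 j
    have : s' j + x ≠ 0 := by positivity
    field_simp
    ring
  have hzero : Tendsto (fun x => ∑' j, p' j * s' j / (s' j + x)) atTop (𝓝 0) := by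
    have := tendsto_tsum_of_dominated_convergence (𝓕 := (atTop : Filter ℝ))
      (f := fun x j => p' j * s' j / (s' j + x)) (g := fun _ => 0) hp'sum
      (fun j => tendsto_const_nhds.div_atTop (tendsto_atTop_add_const_left _ _ tendsto_id)) (by
        filter_upwards [eventually_gt_atTop 0] with x hx j
        have := hs'0 j; have := (hp'I j).1
        rw [Real.norm_of_nonneg (by positivity), div_le_iff₀ (by positivity)]
        nlinarith)
    simpa using this
  -- Letting `x → ∞` identifies the missing constant: `F x → ∞`, so no constant term is left in the
  -- limit representation.
  have hconst : (F 0 - κ)⁻¹ = ∑' j, p' j := by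
    have h1 : Tendsto (fun x => (F 0 - κ)⁻¹ - (F x - κ)⁻¹) atTop (𝓝 ((F 0 - κ)⁻¹ - 0)) :=
      ((tendsto_inv_atTop_zero.comp (tendsto_atTop_add_const_right _ (-κ) hFinf))).const_sub _
    have h2 : Tendsto (fun x => ∑' j, p' j - ∑' j, p' j * s' j / (s' j + x)) atTop
        (𝓝 (∑' j, p' j - 0)) := hzero.const_sub _
    have := tendsto_nhds_unique (h1.congr' (by
      filter_upwards [eventually_gt_atTop 0] with x hx
      rw [hdiff x hx, (hsplit x hx).2])) h2
    simpa using this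
  refine ⟨s', p', fun j => (hs'I j).1, fun j => (hs'I j).2, fun h => ?_, fun j => (hp'I j).1,
    hp'sum, fun x hx => ⟨hFκ x hx.le, ?_⟩⟩
  · funext j
    refine tendsto_nhds_unique (hs' j) (tendsto_const_nhds.congr' ?_)
    filter_upwards [hgood'] with N hN
    rw [(hsr N hN).2.2.1 h]
  · have h1 := hdiff x hx
    rw [(hsplit x hx).2, hconst] at h1
    linarith

/-! ### The Gamma quotient -/

/-- The quotient `Γ(A + iz/2) Γ(A - iz/2) / (Γ(B + iz/2) Γ(B - iz/2))`. -/
noncomputable def gammaQuot (A B : ℝ) (z : ℂ) : ℂ :=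
  Complex.Gamma ((A : ℂ) + z * Complex.I / 2) * Complex.Gamma ((A : ℂ) - z * Complex.I / 2) /
    (Complex.Gamma ((B : ℂ) + z * Complex.I / 2) * Complex.Gamma ((B : ℂ) - z * Complex.I / 2))

theorem symbol_eq_gammaQuot (n : ℕ) (γ : ℝ) (m : ℕ) (z : ℂ) :
    symbol n γ m z =
      (((2 : ℝ) ^ (2 * γ) : ℝ) : ℂ) * gammaQuot (coeffA n γ m) (coeffB n γ m) z :=
  mul_div_assoc _ _ _

theorem Gamma_add_mul_I_ne_zero {B : ℝ} (hB : 0 < B) (ξ : ℝ) :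
    Complex.Gamma ((B : ℂ) + ξ * Complex.I / 2) ≠ 0 ∧
      Complex.Gamma ((B : ℂ) - ξ * Complex.I / 2) ≠ 0 := by
  constructor <;> refine Complex.Gamma_ne_zero_of_re_pos ?_ <;> simpa using hB

theorem GammaSeq_mul_GammaSeq (A ξ : ℝ) {N : ℕ} (hN : N ≠ 0) :
    Complex.GammaSeq ((A : ℂ) + ξ * Complex.I / 2) N *
      Complex.GammaSeq ((A : ℂ) - ξ * Complex.I / 2) N =
    (((N : ℝ) ^ (2 * A) * (N.factorial : ℝ) ^ 2 /
      ∏ k ∈ Finset.range (N + 1), ((A + k) ^ 2 + ξ ^ 2 / 4) : ℝ) : ℂ) := by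
  have hN' : (N : ℂ) ≠ 0 := Nat.cast_ne_zero.2 hN
  have e1 : (((N : ℝ) ^ (2 * A) : ℝ) : ℂ) = (N : ℂ) ^ ((A : ℂ) + ξ * Complex.I / 2) *
      (N : ℂ) ^ ((A : ℂ) - ξ * Complex.I / 2) := by
    rw [← Complex.cpow_add _ _ hN', Complex.ofReal_cpow (Nat.cast_nonneg N)]
    push_cast
    congr 1
    ring
  have e2 : ((∏ k ∈ Finset.range (N + 1), ((A + k) ^ 2 + ξ ^ 2 / 4) : ℝ) : ℂ) =
      (∏ k ∈ Finset.range (N + 1), ((A : ℂ) + ξ * Complex.I / 2 + k)) *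
      ∏ k ∈ Finset.range (N + 1), ((A : ℂ) - ξ * Complex.I / 2 + k) := by
    rw [← Finset.prod_mul_distrib]
    push_cast
    refine Finset.prod_congr rfl fun k _ => ?_
    linear_combination (ξ : ℂ) ^ 2 / 4 * Complex.I_sq
  rw [Complex.ofReal_div, e2, Complex.ofReal_mul, e1, Complex.GammaSeq, Complex.GammaSeq,
    div_mul_div_comm]
  push_cast
  ring

theorem tendsto_gammaQuot {A B : ℝ} (hB : 0 < B) (ξ : ℝ) :
    Tendsto (fun N : ℕ => (((N : ℝ) ^ (2 * (A - B)) * ∏ k ∈ Finset.range (N + 1),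
      (((B + k) ^ 2 + ξ ^ 2 / 4) / ((A + k) ^ 2 + ξ ^ 2 / 4)) : ℝ) : ℂ)) atTop
      (𝓝 (gammaQuot A B ξ)) := by
  have hne := Gamma_add_mul_I_ne_zero hB ξ
  refine Tendsto.congr' ?_ (((Complex.GammaSeq_tendsto_Gamma ((A : ℂ) + ξ * Complex.I / 2)).mul
    (Complex.GammaSeq_tendsto_Gamma ((A : ℂ) - ξ * Complex.I / 2))).div
    ((Complex.GammaSeq_tendsto_Gamma ((B : ℂ) + ξ * Complex.I / 2)).mul
    (Complex.GammaSeq_tendsto_Gamma ((B : ℂ) - ξ * Complex.I / 2))) (mul_ne_zero hne.1 hne.2))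
  filter_upwards [eventually_ne_atTop 0] with N hN
  simp only [Pi.div_apply]
  rw [GammaSeq_mul_GammaSeq A ξ hN, GammaSeq_mul_GammaSeq B ξ hN, ← Complex.ofReal_div]
  congr 1
  have hN' : (0 : ℝ) < N := Nat.cast_pos.2 (Nat.pos_of_ne_zero hN)
  have hPB : ∏ k ∈ Finset.range (N + 1), ((B + k) ^ 2 + ξ ^ 2 / 4) ≠ 0 :=
    (Finset.prod_pos fun k _ => by positivity).ne'
  have hf : (N.factorial : ℝ) ≠ 0 := Nat.cast_ne_zero.2 N.factorial_ne_zero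
  have hr : (N : ℝ) ^ (2 * B) ≠ 0 := (rpow_pos_of_pos hN' _).ne'
  rw [Finset.prod_div_distrib, show 2 * (A - B) = 2 * A - 2 * B by ring, rpow_sub hN']
  generalize ∏ k ∈ Finset.range (N + 1), ((A + k) ^ 2 + ξ ^ 2 / 4) = PA
  generalize ∏ k ∈ Finset.range (N + 1), ((B + k) ^ 2 + ξ ^ 2 / 4) = PB at hPB ⊢
  field_simp

theorem gammaQuot_ofReal {A B : ℝ} (hB : 0 < B) (ξ : ℝ) :
    gammaQuot A B ξ = ((gammaQuot A B ξ).re : ℂ) := by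
  have h := tendsto_gammaQuot (A := A) hB ξ
  have h2 := ((Complex.continuous_ofReal.comp Complex.continuous_re).tendsto _).comp h
  exact tendsto_nhds_unique h h2

theorem tendsto_gammaQuot_re {A B : ℝ} (hB : 0 < B) (ξ : ℝ) :
    Tendsto (fun N : ℕ => (N : ℝ) ^ (2 * (A - B)) * ∏ k ∈ Finset.range (N + 1),
      (((B + k) ^ 2 + ξ ^ 2 / 4) / ((A + k) ^ 2 + ξ ^ 2 / 4))) atTop
      (𝓝 (gammaQuot A B ξ).re) :=
  (Complex.continuous_re.tendsto _).comp (tendsto_gammaQuot hB ξ)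

theorem gammaQuot_zero (A B : ℝ) :
    gammaQuot A B 0 = (((Real.Gamma A / Real.Gamma B) ^ 2 : ℝ) : ℂ) := by
  simp only [gammaQuot, zero_mul, zero_div, add_zero, sub_zero, Complex.Gamma_ofReal]
  push_cast
  ring

/-- In the Euler product at `ξ = 0`, the factor `(B + k) / (A + k)` increases with `B` when `A - B ≥
0` is kept fixed. -/
theorem Gamma_div_Gamma_sq_le {A B A' B' : ℝ} (hB : 0 < B) (hBB : B ≤ B') (hBA : B ≤ A)
    (hA : A - B = A' - B') :
    (Real.Gamma A / Real.Gamma B) ^ 2 ≤ (Real.Gamma A' / Real.Gamma B') ^ 2 := by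
  have h1 := tendsto_gammaQuot_re (A := A) hB 0
  have h2 := tendsto_gammaQuot_re (A := A') (hB.trans_le hBB) 0
  rw [Complex.ofReal_zero, gammaQuot_zero, Complex.ofReal_re] at h1 h2
  refine le_of_tendsto_of_tendsto' h1 h2 fun N => ?_
  rw [← hA]
  refine mul_le_mul_of_nonneg_left (Finset.prod_le_prod (fun k _ => by positivity) fun k _ => ?_)
    (by positivity)
  have hk : (0 : ℝ) ≤ k := Nat.cast_nonneg k
  have hA0 : 0 < A := hB.trans_le hBA
  simp only [ne_eq, OfNat.ofNat_ne_zero, not_false_eq_true, zero_pow, zero_div, add_zero,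
    ← div_pow]
  refine pow_le_pow_left₀ (by positivity) ?_ 2
  rw [div_le_div_iff₀ (by linarith) (by linarith)]
  nlinarith

theorem summable_inv_add_nat_sq {B : ℝ} (hB : 0 < B) :
    Summable fun k : ℕ => ((B + k) ^ 2)⁻¹ := by
  rw [← summable_nat_add_iff 1]
  have := (summable_nat_add_iff 1).2 (Real.summable_nat_pow_inv.2 (one_lt_two))
  refine Summable.of_nonneg_of_le (fun k => by positivity) (fun k => ?_) this
  refine inv_anti₀ (by positivity) (pow_le_pow_left₀ (by positivity) (by linarith) 2)

/-- Partial fractions of `1 / (gammaQuot A B - κ)` on the real line. -/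
theorem exists_stieltjes_gammaQuot {A B κ : ℝ} (hB : 0 < B) (hBA : B < A) (hAB : A < B + 1)
    (hκ : 0 ≤ κ) (hκ' : κ < (Real.Gamma A / Real.Gamma B) ^ 2) :
    ∃ σ p : ℕ → ℝ, 0 ≤ σ 0 ∧ (∀ j : ℕ, 2 * (A + j) ≤ σ (j + 1)) ∧ (∀ j : ℕ, σ j ≤ 2 * (B + j)) ∧
      (κ = 0 → ∀ j : ℕ, σ j = 2 * (B + j)) ∧ (∀ j, 0 ≤ p j) ∧ Summable p ∧
      ∀ ξ : ℝ, ξ ≠ 0 → κ < (gammaQuot A B ξ).re ∧ (gammaQuot A B ξ - κ)⁻¹ =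
        ((∑' j, p j * σ j ^ 2 / (σ j ^ 2 + ξ ^ 2) : ℝ) : ℂ) := by
  have hA : 0 < A := hB.trans hBA
  -- The variable is `x = ξ²/4`, so a pole `s` in `x` corresponds to `ξ = ± i σ` with `σ = 2√s`. The
  -- interlacing `(B+k)² < (A+k)² < (B+k+1)²` is where `B < A < B + 1` enters.
  obtain ⟨s, p, h1, h2, h3, h4, h5, h6⟩ := exists_stieltjes_inv_sub
    (a := fun k : ℕ => (A + k) ^ 2) (b := fun k : ℕ => (B + k) ^ 2)
    (fun k => by
      have hk : (0 : ℝ) ≤ k := Nat.cast_nonneg k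
      exact pow_lt_pow_left₀ (by linarith) (by linarith) two_ne_zero)
    (fun k => by
      have hk : (0 : ℝ) ≤ k := Nat.cast_nonneg k
      push_cast
      exact pow_lt_pow_left₀ (by linarith) (by linarith) two_ne_zero)
    (by positivity) (summable_inv_add_nat_sq hB)
    ((tendsto_rpow_atTop (show 0 < 2 * (A - B) by linarith)).comp tendsto_natCast_atTop_atTop) hκ
    (F := fun x => (gammaQuot A B ((2 * √x : ℝ) : ℂ)).re)
    (fun x hx => by
      have h := tendsto_gammaQuot_re (A := A) hB (2 * √x)
      rw [mul_pow, Real.sq_sqrt hx, show (2 : ℝ) ^ 2 * x / 4 = x by ring] at h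
      exact h)
    (by
      rw [Real.sqrt_zero, mul_zero, Complex.ofReal_zero, gammaQuot_zero, Complex.ofReal_re]
      exact hκ')
  have hs : ∀ j, 0 ≤ s j := fun j => by
    refine le_trans ?_ (h1 j)
    cases j with
    | zero => exact le_rfl
    | succ j => exact sq_nonneg _
  have hσ : ∀ j, (2 * √(s j)) ^ 2 = 4 * s j := fun j => by
    rw [mul_pow, Real.sq_sqrt (hs j)]; norm_num
  refine ⟨fun j => 2 * √(s j), p, by positivity, fun j => ?_, fun j => ?_, fun h j => ?_, h4, h5,
    fun ξ hξ => ?_⟩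
  · have := Real.sqrt_le_sqrt (h1 (j + 1))
    simp only [gapLeft] at this
    rw [Real.sqrt_sq (by positivity)] at this
    linarith
  · have := Real.sqrt_le_sqrt (h2 j)
    rw [Real.sqrt_sq (by positivity)] at this
    linarith
  · dsimp only
    rw [h3 h, Real.sqrt_sq (by positivity)]
  · have hx : 0 < (ξ / 2) ^ 2 := by positivity
    obtain ⟨h7, h8⟩ := h6 _ hx
    have hcase : gammaQuot A B ((2 * √((ξ / 2) ^ 2) : ℝ) : ℂ) = gammaQuot A B ξ := by
      rw [Real.sqrt_sq_eq_abs, abs_div, abs_two, mul_div_cancel₀ _ (two_ne_zero)]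
      rcases abs_choice ξ with h | h <;> rw [h]
      simp only [gammaQuot, Complex.ofReal_neg, neg_mul, neg_div, sub_neg_eq_add,
        ← sub_eq_add_neg]
      rw [mul_comm (Complex.Gamma ((A : ℂ) - ξ * Complex.I / 2)),
        mul_comm (Complex.Gamma ((B : ℂ) - ξ * Complex.I / 2))]
    rw [hcase] at h7 h8
    refine ⟨h7, ?_⟩
    rw [gammaQuot_ofReal hB, ← Complex.ofReal_sub, ← Complex.ofReal_inv, h8]
    congr 1
    refine tsum_congr fun j => ?_
    rw [hσ]
    have : s j + (ξ / 2) ^ 2 ≠ 0 := by have := hs j; positivity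
    have : 4 * s j + ξ ^ 2 ≠ 0 := by have := hs j; positivity
    field_simp
    ring

/-! ### Sums of simple poles on the imaginary axis -/

/-- The sum `∑ p_j σ_j² / (σ_j² + z²)`. -/
noncomputable def poleSum (σ p : ℕ → ℝ) (z : ℂ) : ℂ :=
  ∑' j, ((p j * σ j ^ 2 : ℝ) : ℂ) / ((σ j : ℂ) ^ 2 + z ^ 2)

section PoleSum

variable {σ p : ℕ → ℝ}

/-- Local splitting into a finite sum and an analytic tail. On a ball of radius `R`, the terms with
`σ j ≥ 2R` have denominator at least `3/4 * σ j ^ 2`, so they are bounded by `4/3 * p j`. The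
parameter `L` lets a prescribed term be kept in the finite part. -/
theorem exists_poleSum_eq (hσ : Tendsto σ atTop atTop) (hp0 : ∀ j, 0 ≤ p j) (hp : Summable p)
    (z₀ : ℂ) (L : ℕ) :
    ∃ K ≥ L, ∃ h : ℂ → ℂ, AnalyticAt ℂ h z₀ ∧ ∀ᶠ z in 𝓝 z₀,
      (Summable fun j => ((p j * σ j ^ 2 : ℝ) : ℂ) / ((σ j : ℂ) ^ 2 + z ^ 2)) ∧
      poleSum σ p z = ∑ j ∈ Finset.range K, ((p j * σ j ^ 2 : ℝ) : ℂ) / ((σ j : ℂ) ^ 2 + z ^ 2) +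
        h z := by
  set R := ‖z₀‖ + 1 with hR
  have hR0 : 0 < R := by positivity
  obtain ⟨K, hK⟩ := (hσ.eventually_ge_atTop (2 * R)).exists_forall_of_atTop
  set M := max K L with hM
  have hball : Metric.ball (0 : ℂ) R ∈ 𝓝 z₀ :=
    Metric.isOpen_ball.mem_nhds (by simp [hR])
  have hlow : ∀ z ∈ Metric.ball (0 : ℂ) R, ∀ j, 3 / 4 * σ (j + M) ^ 2 ≤
      ‖((σ (j + M) : ℝ) : ℂ) ^ 2 + z ^ 2‖ ∧ 0 < σ (j + M) ^ 2 := by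
    intro z hz j
    have h1 : 2 * R ≤ σ (j + M) := hK _ ((le_max_left K L).trans (Nat.le_add_left _ _))
    have h2 : ‖z‖ < R := by simpa using hz
    have h3 : ‖z‖ ^ 2 ≤ R ^ 2 := pow_le_pow_left₀ (norm_nonneg _) h2.le 2
    have h4 := norm_sub_le_norm_add (((σ (j + M) : ℝ) : ℂ) ^ 2) (z ^ 2)
    rw [norm_pow, norm_pow, Complex.norm_real, Real.norm_eq_abs, sq_abs] at h4
    constructor <;> nlinarith
  have hbd : ∀ z ∈ Metric.ball (0 : ℂ) R, ∀ j,
      ‖((p (j + M) * σ (j + M) ^ 2 : ℝ) : ℂ) / ((σ (j + M) : ℂ) ^ 2 + z ^ 2)‖ ≤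
        4 / 3 * p (j + M) := by
    intro z hz j
    obtain ⟨h1, h2⟩ := hlow z hz j
    have := hp0 (j + M)
    rw [norm_div, Complex.norm_real, Real.norm_of_nonneg (by positivity),
      div_le_iff₀ (by linarith)]
    nlinarith
  have hs : Summable fun j => 4 / 3 * p (j + M) := ((summable_nat_add_iff M).2 hp).mul_left _
  refine ⟨M, le_max_right _ _, fun z => ∑' j,
    ((p (j + M) * σ (j + M) ^ 2 : ℝ) : ℂ) / ((σ (j + M) : ℂ) ^ 2 + z ^ 2), ?_, ?_⟩
  · refine (Complex.differentiableOn_tsum_of_summable_norm hs (fun j z hz => ?_)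
      Metric.isOpen_ball fun j z hz => hbd z hz j).analyticAt hball
    have : ((σ (j + M) : ℝ) : ℂ) ^ 2 + z ^ 2 ≠ 0 := by
      obtain ⟨h1, h2⟩ := hlow z hz j
      exact norm_pos_iff.1 (by linarith)
    have hd : DifferentiableAt ℂ (fun w : ℂ => ((σ (j + M) : ℝ) : ℂ) ^ 2 + w ^ 2) z := by fun_prop
    exact ((differentiableAt_const _).div hd this).differentiableWithinAt
  · filter_upwards [hball] with z hz
    have hsum : Summable fun j => ((p j * σ j ^ 2 : ℝ) : ℂ) / ((σ j : ℂ) ^ 2 + z ^ 2) := by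
      rw [← summable_nat_add_iff M]
      exact Summable.of_norm_bounded hs (hbd z hz)
    exact ⟨hsum, (hsum.sum_add_tsum_nat_add M).symm⟩

theorem summable_poleSum (hσ : Tendsto σ atTop atTop) (hp0 : ∀ j, 0 ≤ p j) (hp : Summable p)
    (z : ℂ) : Summable fun j => ((p j * σ j ^ 2 : ℝ) : ℂ) / ((σ j : ℂ) ^ 2 + z ^ 2) := by
  obtain ⟨K, -, h, -, hev⟩ := exists_poleSum_eq hσ hp0 hp z 0
  exact hev.self_of_nhds.1

theorem meromorphicAt_poleSum (hσ : Tendsto σ atTop atTop) (hp0 : ∀ j, 0 ≤ p j) (hp : Summable p)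
    (z : ℂ) : MeromorphicAt (poleSum σ p) z := by
  obtain ⟨K, -, h, hh, hev⟩ := exists_poleSum_eq hσ hp0 hp z 0
  have : MeromorphicAt (fun z => ∑ j ∈ Finset.range K,
      ((p j * σ j ^ 2 : ℝ) : ℂ) / ((σ j : ℂ) ^ 2 + z ^ 2) + h z) z := by
    refine MeromorphicAt.fun_add (MeromorphicAt.fun_sum fun j _ => ?_) hh.meromorphicAt
    have h1 : AnalyticAt ℂ (fun w : ℂ => (σ j : ℂ) ^ 2 + w ^ 2) z := by fun_prop
    exact (MeromorphicAt.const _ _).fun_div h1.meromorphicAt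
  exact this.congr ((hev.filter_mono nhdsWithin_le_nhds).mono fun z hz => hz.2.symm)

theorem analyticAt_poleSum (hσ : Tendsto σ atTop atTop) (hp0 : ∀ j, 0 ≤ p j) (hp : Summable p)
    {z : ℂ} (hz : ∀ j, p j * σ j ^ 2 ≠ 0 → (σ j : ℂ) ^ 2 + z ^ 2 ≠ 0) :
    AnalyticAt ℂ (poleSum σ p) z := by
  obtain ⟨K, -, h, hh, hev⟩ := exists_poleSum_eq hσ hp0 hp z 0
  have : AnalyticAt ℂ (fun z => ∑ j ∈ Finset.range K,
      ((p j * σ j ^ 2 : ℝ) : ℂ) / ((σ j : ℂ) ^ 2 + z ^ 2) + h z) z := by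
    refine AnalyticAt.fun_add (Finset.analyticAt_fun_sum _ fun j _ => ?_) hh
    by_cases hj : p j * σ j ^ 2 = 0
    · simp only [hj, Complex.ofReal_zero, zero_div]
      exact analyticAt_const
    · exact AnalyticAt.fun_div analyticAt_const (by fun_prop) (hz j hj)
  exact this.congr (hev.mono fun z hz => hz.2.symm)

/-- The `i`-th term blows up, while all others are analytic at `z` because the numbers `σ j ^ 2` are
distinct. A nonzero coefficient forces `z ≠ 0`, so `σ i ^ 2 + w ^ 2` vanishes only at `w = z` near
`z`. -/
theorem tendsto_poleSum_cobounded (hσ : Tendsto σ atTop atTop) (hp0 : ∀ j, 0 ≤ p j)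
    (hp : Summable p) (hσ0 : ∀ j, 0 ≤ σ j) (hinj : Function.Injective σ) {z : ℂ} {i : ℕ}
    (hi : p i * σ i ^ 2 ≠ 0) (hz : (σ i : ℂ) ^ 2 + z ^ 2 = 0) :
    Tendsto (poleSum σ p) (𝓝[≠] z) (Bornology.cobounded ℂ) := by
  obtain ⟨K, hK, h, hh, hev⟩ := exists_poleSum_eq hσ hp0 hp z (i + 1)
  have hiK : i ∈ Finset.range K := Finset.mem_range.2 hK
  have hz0 : z ≠ 0 := by
    rintro rfl
    have : σ i = 0 := by simpa using hz
    simp [this] at hi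
  have han : AnalyticAt ℂ (fun z => ∑ j ∈ (Finset.range K).erase i,
      ((p j * σ j ^ 2 : ℝ) : ℂ) / ((σ j : ℂ) ^ 2 + z ^ 2) + h z) z := by
    refine AnalyticAt.fun_add (Finset.analyticAt_fun_sum _ fun j hj => ?_) hh
    refine AnalyticAt.fun_div analyticAt_const (by fun_prop) fun h0 => ?_
    have h1 : (σ j : ℂ) ^ 2 = (σ i : ℂ) ^ 2 := by linear_combination h0 - hz
    have h2 : σ j ^ 2 = σ i ^ 2 := by exact_mod_cast h1
    exact (Finset.mem_erase.1 hj).1 (hinj ((sq_eq_sq₀ (hσ0 j) (hσ0 i)).1 h2))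
  have hpole : Tendsto (fun z => ((p i * σ i ^ 2 : ℝ) : ℂ) / ((σ i : ℂ) ^ 2 + z ^ 2)) (𝓝[≠] z)
      (Bornology.cobounded ℂ) := by
    have h1 : Tendsto (fun w : ℂ => (σ i : ℂ) ^ 2 + w ^ 2) (𝓝[≠] z) (𝓝[≠] 0) := by
      refine tendsto_nhdsWithin_iff.2 ⟨?_, ?_⟩
      · rw [← hz]
        exact (Continuous.tendsto (by fun_prop) z).mono_left nhdsWithin_le_nhds
      · have : ∀ᶠ w in 𝓝 z, w ≠ -z := by
          refine isOpen_ne.mem_nhds fun h => hz0 ?_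
          have : z + z = 0 := by linear_combination h
          simpa using this
        filter_upwards [self_mem_nhdsWithin, this.filter_mono nhdsWithin_le_nhds] with w h1 h2 h3
        have : (w - z) * (w + z) = 0 := by
          have h3 : (σ i : ℂ) ^ 2 + w ^ 2 = 0 := h3
          linear_combination h3 - hz
        rcases mul_eq_zero.1 this with h | h
        · exact h1 (sub_eq_zero.1 h)
        · exact h2 (eq_neg_of_add_eq_zero_left h)
    have h2 := tendsto_inv₀_nhdsNE_zero.comp h1
    rw [← tendsto_norm_atTop_iff_cobounded] at h2 ⊢
    have h3 : 0 < ‖((p i * σ i ^ 2 : ℝ) : ℂ)‖ := by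
      rw [norm_pos_iff]
      exact_mod_cast hi
    refine (h2.const_mul_atTop h3).congr fun w => ?_
    rw [div_eq_mul_inv, norm_mul]
    rfl
  have hsum : Tendsto (fun z => ((p i * σ i ^ 2 : ℝ) : ℂ) / ((σ i : ℂ) ^ 2 + z ^ 2) +
      (∑ j ∈ (Finset.range K).erase i,
        ((p j * σ j ^ 2 : ℝ) : ℂ) / ((σ j : ℂ) ^ 2 + z ^ 2) + h z)) (𝓝[≠] z)
      (Bornology.cobounded ℂ) := by
    rw [← tendsto_norm_atTop_iff_cobounded] at hpole ⊢
    have h4 := (han.continuousAt.tendsto.mono_left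
      (nhdsWithin_le_nhds (s := {z}ᶜ))).norm.neg
    refine tendsto_atTop_mono (fun w => ?_) (hpole.atTop_add h4)
    exact (sub_eq_add_neg _ _).symm.trans_le (norm_sub_le_norm_add _ _)
  refine hsum.congr' ?_
  filter_upwards [hev.filter_mono nhdsWithin_le_nhds] with w hw
  rw [hw.2, ← Finset.add_sum_erase _ _ hiK, add_assoc]

end PoleSum

/-! ### Analytic continuation of the partial fractions -/

theorem meromorphicAt_inv_gammaQuot_sub (A B : ℝ) (κ z : ℂ) :
    MeromorphicAt (fun z => (gammaQuot A B z - κ)⁻¹) z := by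
  have hΓ : ∀ (C : ℝ) (w : ℂ), MeromorphicAt (fun z => Complex.Gamma ((C : ℂ) + z * w / 2)) z := by
    intro C w
    have h : AnalyticAt ℂ (fun z : ℂ => (Complex.Gamma ((C : ℂ) + z * w / 2))⁻¹) z :=
      (Complex.analyticOnNhd_univ_iff_differentiable.2
        (Complex.differentiable_one_div_Gamma.comp
          (show Differentiable ℂ fun z : ℂ => (C : ℂ) + z * w / 2 by fun_prop))) z trivial
    simpa using h.meromorphicAt.fun_inv
  have hΓ' : ∀ C : ℝ,
      MeromorphicAt (fun z => Complex.Gamma ((C : ℂ) - z * Complex.I / 2)) z := fun C => by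
    simpa [sub_eq_add_neg, neg_div] using hΓ C (-Complex.I)
  exact (((hΓ A Complex.I).fun_mul (hΓ' A)).fun_div ((hΓ B Complex.I).fun_mul (hΓ' B))).fun_sub
    (MeromorphicAt.const _ _) |>.fun_inv

/-- Identity theorem for meromorphic functions: the zeros of `f - g` on the real axis accumulate at
`0`, so the order there is infinite, and infinite order propagates over `ℂ`. Punctured
neighbourhoods are used since values at poles are mere conventions. -/
theorem eventuallyEq_of_eqOn_real {f g : ℂ → ℂ} (hf : ∀ z, MeromorphicAt f z)
    (hg : ∀ z, MeromorphicAt g z) (h : ∀ ξ : ℝ, ξ ≠ 0 → f ξ = g ξ) (z : ℂ) :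
    f =ᶠ[𝓝[≠] z] g := by
  have hfg : Meromorphic fun z => f z - g z := fun z => (hf z).fun_sub (hg z)
  have h0 : meromorphicOrderAt (fun z => f z - g z) 0 = ⊤ := by
    rw [meromorphicOrderAt_eq_top_iff]
    refine (hfg 0).eventually_eq_zero_or_eventually_ne_zero.resolve_right fun hne => ?_
    have ht : Tendsto (fun ξ : ℝ => (ξ : ℂ)) (𝓝[≠] 0) (𝓝[≠] 0) := by
      refine tendsto_nhdsWithin_iff.2 ⟨?_, ?_⟩
      · exact (Complex.continuous_ofReal.tendsto' 0 0 (by simp)).mono_left nhdsWithin_le_nhds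
      · filter_upwards [self_mem_nhdsWithin] with ξ hξ
        simpa using hξ
    have := (ht.eventually hne).and self_mem_nhdsWithin
    obtain ⟨ξ, h1, h2⟩ := this.exists
    exact h1 (sub_eq_zero.2 (h ξ h2))
  have hz : meromorphicOrderAt (fun z => f z - g z) z = ⊤ := by
    by_contra hne
    exact hfg.exists_meromorphicOrderAt_ne_top_iff_forall.1 ⟨z, hne⟩ 0 h0
  exact (meromorphicOrderAt_eq_top_iff.1 hz).mono fun w hw => sub_eq_zero.1 hw

/-- At this point `A + iz/2 = -k`, so the numerator has a pole. The denominator does not, because `B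
- A - k` lies strictly between `-(k+1)` and `-k`. -/
theorem tendsto_inv_gammaQuot_sub_zero {A B : ℝ} (hB : 0 < B) (hBA : B < A) (hAB : A < B + 1)
    (κ : ℂ) (k : ℕ) :
    Tendsto (fun z => (gammaQuot A B z - κ)⁻¹)
      (𝓝[≠] (((2 * (A + k) : ℝ) : ℂ) * Complex.I)) (𝓝 0) := by
  have hA : 0 < A := hB.trans hBA
  have hk : (0 : ℝ) ≤ k := Nat.cast_nonneg k
  set z₀ : ℂ := ((2 * (A + k) : ℝ) : ℂ) * Complex.I with hz₀
  have hz₀I : z₀ * Complex.I / 2 = -((A : ℂ) + k) := by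
    rw [hz₀]
    push_cast
    linear_combination ((A : ℂ) + k) * Complex.I_sq
  let G : ℝ → ℂ → ℂ := fun C z =>
    Complex.Gamma ((C : ℂ) + z * Complex.I / 2) * Complex.Gamma ((C : ℂ) - z * Complex.I / 2)
  have hG : ∀ C, Continuous fun z => (G C z)⁻¹ := by
    intro C
    have h := Complex.differentiable_one_div_Gamma.continuous
    simp only [G, mul_inv]
    exact (h.comp (show Continuous fun z : ℂ => (C : ℂ) + z * Complex.I / 2 by fun_prop)).mul
      (h.comp (show Continuous fun z : ℂ => (C : ℂ) - z * Complex.I / 2 by fun_prop))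
  have hGA : (G A z₀)⁻¹ = 0 := by
    have h0 : Complex.Gamma (-(k : ℂ)) = 0 := Complex.Gamma_neg_nat_eq_zero k
    simp only [G, hz₀I, neg_add, add_neg_cancel_left, h0, zero_mul, inv_zero]
  have hGB : (G B z₀)⁻¹ ≠ 0 := by
    simp only [G, hz₀I]
    refine inv_ne_zero (mul_ne_zero (Complex.Gamma_ne_zero fun m hm => ?_)
      (Complex.Gamma_ne_zero_of_re_pos ?_))
    · have h1 : B - A - k = -(m : ℝ) := by
        have := congrArg Complex.re hm
        simp at this
        linarith
      have h2 : ((m : ℤ) : ℝ) < ((k + 1 : ℤ) : ℝ) := by push_cast; linarith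
      have h3 : ((k : ℤ) : ℝ) < ((m : ℤ) : ℝ) := by push_cast; linarith
      have h2 := Int.cast_lt.1 h2
      have h3 := Int.cast_lt.1 h3
      omega
    · simp; linarith
  have hne : ∀ᶠ z in 𝓝[≠] z₀, G A z ≠ 0 := by
    have hball : Metric.ball z₀ (min 1 A) ∈ 𝓝 z₀ := Metric.ball_mem_nhds _ (lt_min one_pos hA)
    filter_upwards [self_mem_nhdsWithin, mem_nhdsWithin_of_mem_nhds hball] with z h1 h2
    obtain ⟨w, rfl⟩ : ∃ w, z = z₀ + w := ⟨z - z₀, by ring⟩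
    have hw : ‖w‖ < min 1 A := by simpa using h2
    rw [lt_min_iff] at hw
    have hw0 : w ≠ 0 := by simpa using h1
    have hw2 : ‖w * Complex.I / 2‖ = ‖w‖ / 2 := by
      rw [norm_div, norm_mul, Complex.norm_I]
      norm_num
    have hw1 : ‖w * Complex.I / 2‖ < 1 := by
      rw [hw2]
      linarith [hw.1, norm_nonneg w]
    have e : (z₀ + w) * Complex.I / 2 = -((A : ℂ) + k) + w * Complex.I / 2 := by
      rw [← hz₀I]; ring
    simp only [G, e]
    refine mul_ne_zero (Complex.Gamma_ne_zero fun m hm => ?_)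
      (Complex.Gamma_ne_zero_of_re_pos ?_)
    · have h3 : w * Complex.I / 2 = (((k : ℤ) - m : ℤ) : ℂ) := by
        push_cast
        linear_combination hm
      rw [h3, Complex.norm_intCast] at hw1
      have h4 : |(k : ℤ) - m| < 1 := by exact_mod_cast hw1
      rw [Int.abs_lt_one_iff] at h4
      rw [h4] at h3
      have h5 : w * Complex.I = 0 := by
        have := congrArg (· * 2) h3
        simpa using this
      exact hw0 ((mul_eq_zero.1 h5).resolve_right Complex.I_ne_zero)
    · have := (le_abs_self _).trans (Complex.abs_re_le_norm (w * Complex.I / 2))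
      have := hw.2
      rw [Complex.sub_re, Complex.add_re]
      simp only [Complex.neg_re, Complex.add_re, Complex.ofReal_re, Complex.natCast_re]
      linarith
  -- Since `1/Γ` is entire, rewriting `1 / (G A / G B - κ)` in terms of `1 / G A` and `1 / G B`
  -- makes it continuous at `z₀`, with value `0`.
  have hlim : Tendsto (fun z => (G A z)⁻¹ * ((G B z)⁻¹ - κ * (G A z)⁻¹)⁻¹) (𝓝 z₀) (𝓝 0) := by
    have hc : ContinuousAt (fun z => (G A z)⁻¹ * ((G B z)⁻¹ - κ * (G A z)⁻¹)⁻¹) z₀ := by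
      refine (hG A).continuousAt.mul (ContinuousAt.inv₀ ?_ (by simpa [hGA] using hGB))
      exact (hG B).continuousAt.sub (continuousAt_const.mul (hG A).continuousAt)
    have := hc.tendsto
    rwa [hGA, zero_mul] at this
  refine (hlim.mono_left nhdsWithin_le_nhds).congr' (hne.mono fun z hz => ?_)
  have : gammaQuot A B z = G A z * (G B z)⁻¹ := div_eq_mul_inv _ _
  dsimp only
  rw [this, ← mul_inv]
  congr 1
  rw [mul_sub, mul_left_comm, mul_inv_cancel₀ hz, mul_one]

theorem continuousAt_gammaQuot_zero {A B : ℝ} (hA : 0 < A) (hB : 0 < B) :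
    ContinuousAt (gammaQuot A B) 0 := by
  have h : ∀ (C : ℝ), 0 < C → ContinuousAt Complex.Gamma (C : ℂ) := fun C hC =>
    Complex.continuousAt_Gamma _ fun m hm => by
      have := congrArg Complex.re hm
      have hm0 : (0 : ℝ) ≤ m := Nat.cast_nonneg m
      simp at this
      linarith
  have h1 : ∀ (C : ℝ), 0 < C →
      ContinuousAt (fun z : ℂ => Complex.Gamma ((C : ℂ) + z * Complex.I / 2)) 0 := fun C hC =>
    ContinuousAt.comp (by simpa using h C hC) (by fun_prop)
  have h2 : ∀ (C : ℝ), 0 < C →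
      ContinuousAt (fun z : ℂ => Complex.Gamma ((C : ℂ) - z * Complex.I / 2)) 0 := fun C hC =>
    ContinuousAt.comp (by simpa using h C hC) (by fun_prop)
  refine ((h1 A hA).mul (h2 A hA)).div ((h1 B hB).mul (h2 B hB)) ?_
  have := Gamma_add_mul_I_ne_zero hB 0
  simpa using this.1

theorem poleSum_mul_I (σ p : ℕ → ℝ) (x : ℝ) :
    poleSum σ p ((x : ℂ) * Complex.I) = ((∑' j, p j * σ j ^ 2 / (σ j ^ 2 - x ^ 2) : ℝ) : ℂ) := by
  rw [poleSum, Complex.ofReal_tsum]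
  refine tsum_congr fun j => ?_
  push_cast
  rw [mul_pow, Complex.I_sq]
  ring

/-- Partial fractions of `1 / (gammaQuot A B - κ)`; all poles are simple and purely imaginary. -/
theorem exists_partialFractions_gammaQuot {A B κ : ℝ} (hB : 0 < B) (hBA : B < A)
    (hAB : A < B + 1) (hκ : 0 ≤ κ) (hκ' : κ < (Real.Gamma A / Real.Gamma B) ^ 2) :
    ∃ σ c : ℕ → ℝ, StrictMono σ ∧ 0 < σ 0 ∧ (∀ j, 0 < c j) ∧ Tendsto σ atTop atTop ∧
      (Summable fun j => c j / σ j) ∧ σ 0 ≤ 2 * B ∧ (κ = 0 → ∀ j : ℕ, σ j = 2 * (B + j)) ∧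
      (∀ ξ : ℝ, κ < (gammaQuot A B ξ).re ∧ (gammaQuot A B ξ - κ)⁻¹ =
        ((∑' j, c j * (2 * σ j / (σ j ^ 2 + ξ ^ 2)) : ℝ) : ℂ)) ∧
      ∀ z : ℂ, meromorphicOrderAt (fun z => (gammaQuot A B z - κ)⁻¹) z < 0 ↔
        ∃ j, z.re = 0 ∧ |z.im| = σ j := by
  have hA : 0 < A := hB.trans hBA
  obtain ⟨σ, p, h0, h1, h2, h3, hp0, hp, hpf⟩ := exists_stieltjes_gammaQuot hB hBA hAB hκ hκ'
  have hmono : StrictMono σ := strictMono_nat_of_lt_succ fun k =>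
    (h2 k).trans_lt ((by linarith : 2 * (B + k) < 2 * (A + k)).trans_le (h1 k))
  have hσ0 : ∀ j, 0 ≤ σ j := fun j => h0.trans (hmono.monotone (Nat.zero_le j))
  have htop : Tendsto σ atTop atTop := by
    rw [← tendsto_add_atTop_iff_nat 1]
    refine tendsto_atTop_mono (fun j => ?_) tendsto_natCast_atTop_atTop
    have : (0 : ℝ) ≤ j := Nat.cast_nonneg j
    linarith [h1 j]
  set f : ℂ → ℂ := fun z => (gammaQuot A B z - κ)⁻¹ with hf
  have hfg : ∀ z, f =ᶠ[𝓝[≠] z] poleSum σ p := by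
    refine eventuallyEq_of_eqOn_real (fun z => meromorphicAt_inv_gammaQuot_sub A B κ z)
      (fun z => meromorphicAt_poleSum htop hp0 hp z) fun ξ hξ => ?_
    rw [hf]
    dsimp only
    rw [(hpf ξ hξ).2, poleSum, Complex.ofReal_tsum]
    refine tsum_congr fun j => ?_
    push_cast
    ring
  have hq0 : ∀ j, 0 ≤ p j * σ j ^ 2 := fun j => mul_nonneg (hp0 j) (sq_nonneg _)
  -- The representation is known only for `ξ ≠ 0`; both sides are continuous at `0`. A term with `σ
  -- j = 0` has zero coefficient and does not matter.
  have hval0 : poleSum σ p 0 = f 0 := by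
    have han : AnalyticAt ℂ (poleSum σ p) 0 := analyticAt_poleSum htop hp0 hp fun j hj => by
      have : σ j ≠ 0 := by rintro h; simp [h] at hj
      simpa using this
    have hc : ContinuousAt f 0 := by
      refine ContinuousAt.inv₀ ((continuousAt_gammaQuot_zero hA hB).sub continuousAt_const) ?_
      rw [gammaQuot_zero, ← Complex.ofReal_sub]
      exact_mod_cast (sub_pos.2 hκ').ne'
    exact tendsto_nhds_unique ((han.continuousAt.tendsto.mono_left nhdsWithin_le_nhds).congr'
      (hfg 0).symm) (hc.tendsto.mono_left nhdsWithin_le_nhds)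
  have hzero : ∀ k : ℕ, (∀ j, σ j = 2 * (A + k) → p j * σ j ^ 2 = 0) ∧
      ∑' j, p j * σ j ^ 2 / (σ j ^ 2 - (2 * (A + k)) ^ 2) = 0 := by
    intro k
    have hk : (0 : ℝ) ≤ k := Nat.cast_nonneg k
    have hlim := (tendsto_inv_gammaQuot_sub_zero hB hBA hAB κ k).congr' (hfg _)
    have hnp : ∀ j, σ j = 2 * (A + k) → p j * σ j ^ 2 = 0 := by
      intro j hj
      by_contra hne
      have := tendsto_poleSum_cobounded htop hp0 hp hσ0 hmono.injective hne
        (z := ((2 * (A + k) : ℝ) : ℂ) * Complex.I) (by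
          rw [hj, mul_pow, Complex.I_sq]; ring)
      rw [← tendsto_norm_atTop_iff_cobounded] at this
      exact not_tendsto_atTop_of_tendsto_nhds hlim.norm this
    refine ⟨hnp, ?_⟩
    have han := analyticAt_poleSum htop hp0 hp (z := ((2 * (A + k) : ℝ) : ℂ) * Complex.I)
      fun j hj h => hj (hnp j (by
        rw [mul_pow, Complex.I_sq] at h
        have h' : ((σ j ^ 2 : ℝ) : ℂ) = (((2 * (A + k)) ^ 2 : ℝ) : ℂ) := by
          push_cast at h ⊢
          linear_combination h
        exact (sq_eq_sq₀ (hσ0 j) (by linarith)).1 (Complex.ofReal_injective h')))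
    have := tendsto_nhds_unique (han.continuousAt.tendsto.mono_left nhdsWithin_le_nhds) hlim
    rw [poleSum_mul_I] at this
    exact_mod_cast this
  have hsumR : ∀ x : ℝ, Summable fun j => p j * σ j ^ 2 / (σ j ^ 2 - x ^ 2) := by
    intro x
    have := summable_poleSum htop hp0 hp ((x : ℂ) * Complex.I)
    rw [← Complex.summable_ofReal]
    refine this.congr fun j => ?_
    push_cast
    rw [mul_pow, Complex.I_sq]
    ring
  have hpos0 : 0 < ∑' j, p j * σ j ^ 2 / (σ j ^ 2 - (0 : ℝ) ^ 2) := by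
    have h5 := poleSum_mul_I σ p 0
    rw [Complex.ofReal_zero, zero_mul, hval0, hf] at h5
    dsimp only at h5
    rw [gammaQuot_zero, ← Complex.ofReal_sub, ← Complex.ofReal_inv] at h5
    rw [← Complex.ofReal_injective h5]
    exact inv_pos.2 (sub_pos.2 hκ')
  have hex : ∃ i, 0 < p i * σ i ^ 2 := by
    by_contra! hall
    have : ∀ j, p j * σ j ^ 2 = 0 := fun j => le_antisymm (hall j) (hq0 j)
    simp [this] at hpos0
  -- If the `j`-th coefficient vanished, the sum, as a function of `x` at `z = ix`, would have no
  -- pole between `x₀` and `2(A + j)` and would increase strictly there. Here `x₀` is the preceding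
  -- zero `2(A + j - 1)`, or `0` for `j = 0`, where the value is positive. This contradicts the zero
  -- at `2(A + j)`.
  have hpos : ∀ j, 0 < p j * σ j ^ 2 := by
    intro j
    refine (hq0 j).lt_of_ne fun hj => ?_
    have hj : p j * σ j ^ 2 = 0 := hj.symm
    obtain ⟨x₀, hx₀, hxA, hleft, hright, hval⟩ : ∃ x₀ : ℝ, 0 ≤ x₀ ∧ x₀ < 2 * (A + j) ∧
        (∀ i < j, 0 < p i * σ i ^ 2 → σ i < x₀) ∧
        (∀ i, j < i → 0 < p i * σ i ^ 2 → 2 * (A + j) < σ i) ∧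
        0 ≤ ∑' j, p j * σ j ^ 2 / (σ j ^ 2 - x₀ ^ 2) := by
      have hright : ∀ i, j < i → 0 < p i * σ i ^ 2 → 2 * (A + j) < σ i := fun i hi hpi =>
        ((h1 j).trans (hmono.monotone hi)).lt_of_ne fun h =>
          hpi.ne' ((hzero j).1 i h.symm)
      cases j with
      | zero =>
        exact ⟨0, le_rfl, by simpa using hA, fun i hi => absurd hi (Nat.not_lt_zero i), hright,
          hpos0.le⟩
      | succ j =>
        have hj0 : (0 : ℝ) ≤ j := Nat.cast_nonneg j
        refine ⟨2 * (A + j), by linarith, by push_cast; linarith, fun i hi _ => ?_, hright,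
          (hzero j).2.ge⟩
        exact (hmono.monotone (Nat.lt_succ_iff.1 hi)).trans_lt ((h2 j).trans_lt (by linarith))
    have hterm : ∀ i, p i * σ i ^ 2 / (σ i ^ 2 - x₀ ^ 2) ≤
        p i * σ i ^ 2 / (σ i ^ 2 - (2 * (A + j)) ^ 2) ∧ (0 < p i * σ i ^ 2 →
        p i * σ i ^ 2 / (σ i ^ 2 - x₀ ^ 2) <
        p i * σ i ^ 2 / (σ i ^ 2 - (2 * (A + j)) ^ 2)) := by
      intro i
      have key : 0 < p i * σ i ^ 2 → p i * σ i ^ 2 / (σ i ^ 2 - x₀ ^ 2) <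
        p i * σ i ^ 2 / (σ i ^ 2 - (2 * (A + j)) ^ 2) := by
        intro hpi
        have hsq : x₀ ^ 2 < (2 * (A + j)) ^ 2 := pow_lt_pow_left₀ hxA hx₀ two_ne_zero
        rcases lt_trichotomy i j with hij | rfl | hij
        · have h6 : σ i ^ 2 < x₀ ^ 2 := pow_lt_pow_left₀ (hleft i hij hpi) (hσ0 i) two_ne_zero
          rw [← neg_lt_neg_iff, ← div_neg, ← div_neg]
          exact div_lt_div_of_pos_left hpi (by linarith) (by linarith)
        · exact absurd hj hpi.ne'
        · have h6 : (2 * (A + j)) ^ 2 < σ i ^ 2 :=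
            pow_lt_pow_left₀ (hright i hij hpi) (hx₀.trans hxA.le) two_ne_zero
          exact div_lt_div_of_pos_left hpi (by linarith) (by linarith)
      refine ⟨?_, key⟩
      rcases (hq0 i).eq_or_lt with h | h
      · simp [← h]
      · exact (key h).le
    obtain ⟨i, hi⟩ := hex
    have := Summable.tsum_lt_tsum (fun i => (hterm i).1) ((hterm i).2 hi) (hsumR _) (hsumR _)
    rw [(hzero j).2] at this
    linarith
  have hσpos : ∀ j, 0 < σ j := fun j => (hσ0 j).lt_of_ne fun h => by
    have := hpos j
    simp [← h] at this
  have hppos : ∀ j, 0 < p j := fun j => (hp0 j).lt_of_ne fun h => by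
    have := hpos j
    simp [← h] at this
  refine ⟨σ, fun j => p j * σ j / 2, hmono, hσpos 0,
    fun j => by have := hσpos j; have := hppos j; positivity, htop, ?_, ?_, h3, ?_, ?_⟩
  · refine (hp.div_const 2).congr fun j => ?_
    have := (hσpos j).ne'
    field_simp
  · simpa using h2 0
  · intro ξ
    have e : ∀ j, p j * σ j / 2 * (2 * σ j / (σ j ^ 2 + ξ ^ 2)) =
        p j * σ j ^ 2 / (σ j ^ 2 + ξ ^ 2) := fun j => by ring
    simp only [e]
    rcases eq_or_ne ξ 0 with rfl | hξ
    · rw [Complex.ofReal_zero, gammaQuot_zero, Complex.ofReal_re]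
      refine ⟨hκ', ?_⟩
      have h5 := poleSum_mul_I σ p 0
      rw [Complex.ofReal_zero, zero_mul, hval0, hf] at h5
      dsimp only at h5
      rw [gammaQuot_zero] at h5
      rw [h5]
      congr 1
      exact tsum_congr fun j => by ring
    · exact hpf ξ hξ
  · intro z
    rw [meromorphicOrderAt_congr (hfg z)]
    have hz : ∀ j, (σ j : ℂ) ^ 2 + z ^ 2 = 0 ↔ z.re = 0 ∧ |z.im| = σ j := by
      intro j
      constructor
      · intro h
        have hre := congrArg Complex.re h
        have him := congrArg Complex.im h
        simp only [sq, Complex.add_re, Complex.mul_re, Complex.ofReal_re, Complex.ofReal_im,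
          Complex.zero_re, Complex.add_im, Complex.mul_im, Complex.zero_im] at hre him
        have hσj := hσpos j
        have h7 : z.re = 0 := by
          by_contra hne
          have : z.im = 0 := by
            have : z.re * z.im = 0 := by linarith
            exact (mul_eq_zero.1 this).resolve_left hne
          rw [this] at hre
          nlinarith [sq_nonneg z.re]
        refine ⟨h7, ?_⟩
        rw [h7] at hre
        rw [← abs_of_pos hσj]
        exact (sq_eq_sq_iff_abs_eq_abs _ _).1 (by nlinarith)
      · rintro ⟨h7, h8⟩
        have : z = (z.im : ℂ) * Complex.I := by
          apply Complex.ext <;> simp [h7]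
        rw [this, mul_pow, Complex.I_sq, ← h8]
        have : (|z.im| ^ 2 : ℝ) = z.im ^ 2 := sq_abs _
        have : ((|z.im| : ℝ) : ℂ) ^ 2 = (z.im : ℂ) ^ 2 := by exact_mod_cast this
        rw [this]
        ring
    constructor
    · intro hlt
      by_contra! hall
      have := (analyticAt_poleSum htop hp0 hp (z := z) fun j _ h =>
        hall j ((hz j).1 h).1 ((hz j).1 h).2).meromorphicOrderAt_nonneg
      exact absurd hlt (not_lt.2 this)
    · rintro ⟨j, hj⟩
      exact (tendsto_cobounded_iff_meromorphicOrderAt_neg (meromorphicAt_poleSum htop hp0 hp z)).1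
        (tendsto_poleSum_cobounded htop hp0 hp hσ0 hmono.injective (hpos j).ne' ((hz j).2 hj))

/-! ### Sums of two-sided exponentials -/

/-- Version of termwise integration that also yields integrability of a sum given only almost
everywhere, as needed for series undefined at `t = 0`. -/
theorem integrable_of_hasSum_of_summable_integral_norm {E : Type*} [NormedAddCommGroup E]
    [NormedSpace ℝ E] [CompleteSpace E] {μ : Measure ℝ} {F : ℕ → ℝ → E} {f : ℝ → E}
    (hF : ∀ j, Integrable (F j) μ) (hsum : Summable fun j => ∫ t, ‖F j t‖ ∂μ)
    (hf : ∀ᵐ t ∂μ, HasSum (fun j => F j t) (f t)) :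
    Integrable f μ ∧ HasSum (fun j => ∫ t, F j t ∂μ) (∫ t, f t ∂μ) := by
  constructor
  · refine ⟨?_, ?_⟩
    · exact aestronglyMeasurable_of_tendsto_ae atTop
        (f := fun (n : ℕ) t => ∑ j ∈ Finset.range n, F j t)
        (fun n => Finset.aestronglyMeasurable_fun_sum _ fun j _ => (hF j).1)
        (hf.mono fun t ht => ht.tendsto_sum_nat)
    · have h1 : ∫⁻ t, ‖f t‖ₑ ∂μ ≤ ∫⁻ t, ∑' j, ‖F j t‖ₑ ∂μ := by
        refine lintegral_mono_ae (hf.mono fun t ht => ?_)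
        refine le_of_tendsto' ht.tendsto_sum_nat.enorm fun n => ?_
        exact (enorm_sum_le _ _).trans (ENNReal.sum_le_tsum _)
      refine h1.trans_lt ?_
      rw [lintegral_tsum fun j => (hF j).1.enorm]
      have h2 : ∀ j, ∫⁻ t, ‖F j t‖ₑ ∂μ = ENNReal.ofReal (∫ t, ‖F j t‖ ∂μ) := fun j =>
        (ofReal_integral_norm_eq_lintegral_enorm (hF j)).symm
      simp only [h2]
      rw [← ENNReal.ofReal_tsum_of_nonneg (fun j => integral_nonneg fun t => norm_nonneg _) hsum]
      exact ENNReal.ofReal_lt_top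
  · have h := hasSum_integral_of_summable_integral_norm hF hsum
    rwa [integral_congr_ae (hf.mono fun t ht => ht.tsum_eq)] at h

theorem integral_exp_neg_mul_abs_mul_cexp {a : ℝ} (ha : 0 < a) (ξ : ℝ) :
    Integrable (fun t : ℝ => ((Real.exp (-a * |t|) : ℝ) : ℂ) * Complex.exp (Complex.I * ξ * t)) ∧
    ∫ t : ℝ, ((Real.exp (-a * |t|) : ℝ) : ℂ) * Complex.exp (Complex.I * ξ * t) =
      ((2 * a / (a ^ 2 + ξ ^ 2) : ℝ) : ℂ) := by
  have e1 : EqOn (fun t : ℝ => Complex.exp ((-a + Complex.I * ξ) * t))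
      (fun t : ℝ => ((Real.exp (-a * |t|) : ℝ) : ℂ) * Complex.exp (Complex.I * ξ * t))
      (Ioi 0) := fun t (ht : 0 < t) => by
    dsimp only
    rw [abs_of_pos ht, Complex.ofReal_exp, ← Complex.exp_add]
    push_cast
    congr 1
    ring
  have e2 : EqOn (fun t : ℝ => Complex.exp ((a + Complex.I * ξ) * t))
      (fun t : ℝ => ((Real.exp (-a * |t|) : ℝ) : ℂ) * Complex.exp (Complex.I * ξ * t))
      (Iic 0) := fun t (ht : t ≤ 0) => by
    dsimp only
    rw [abs_of_nonpos ht, Complex.ofReal_exp, ← Complex.exp_add]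
    push_cast
    congr 1
    ring
  have hr1 : (-a + Complex.I * ξ : ℂ).re < 0 := by simpa using ha
  have hr2 : 0 < (a + Complex.I * ξ : ℂ).re := by simpa using ha
  have i1 := (integrableOn_exp_mul_complex_Ioi hr1 0).congr_fun e1 measurableSet_Ioi
  have i2 := (integrableOn_exp_mul_complex_Iic hr2 0).congr_fun e2 measurableSet_Iic
  refine ⟨?_, ?_⟩
  · rw [← integrableOn_univ, ← Iic_union_Ioi (a := (0 : ℝ))]
    exact i2.union i1
  · rw [← intervalIntegral.integral_Iic_add_Ioi i2 i1, ← setIntegral_congr_fun measurableSet_Ioi e1,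
      ← setIntegral_congr_fun measurableSet_Iic e2, integral_exp_mul_complex_Ioi hr1,
      integral_exp_mul_complex_Iic hr2]
    have h1 : (-a + Complex.I * ξ : ℂ) ≠ 0 := fun h => by simp [h] at hr1
    have h2 : (a + Complex.I * ξ : ℂ) ≠ 0 := fun h => by simp [h] at hr2
    have h3 : ((a : ℂ) ^ 2 + (ξ : ℂ) ^ 2) ≠ 0 := by
      have : a ^ 2 + ξ ^ 2 ≠ 0 := by positivity
      exact_mod_cast this
    push_cast
    simp only [mul_zero, Complex.exp_zero]
    field_simp
    linear_combination -2 * (a : ℂ) * (ξ : ℂ) ^ 2 * Complex.I_sq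

theorem integral_exp_neg_mul_abs {a : ℝ} (ha : 0 < a) :
    Integrable (fun t : ℝ => Real.exp (-a * |t|)) ∧ ∫ t : ℝ, Real.exp (-a * |t|) = 2 / a := by
  obtain ⟨h1, h2⟩ := integral_exp_neg_mul_abs_mul_cexp ha 0
  simp only [Complex.ofReal_zero, mul_zero, zero_mul, Complex.exp_zero, mul_one] at h1 h2
  refine ⟨h1.re.congr (ae_of_all _ fun t => Complex.ofReal_re _), ?_⟩
  rw [integral_complex_ofReal] at h2
  rw [Complex.ofReal_injective h2]
  field_simp
  ring

/-- A nondecreasing sequence of positive exponents with nonnegative weights `c j` such that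
`∑ c j * exp (-σ j * |t|)` is an integrable function of `t`. -/
structure ExpSeries (σ c : ℕ → ℝ) : Prop where
  mono : Monotone σ
  pos_zero : 0 < σ 0
  nonneg : ∀ j, 0 ≤ c j
  summable : Summable fun j => c j / σ j

/-- The sum `∑ c j * exp (-σ j * |t|)`. -/
noncomputable abbrev expGreen (σ c : ℕ → ℝ) : ℝ → ℝ := green σ (fun _ => 0) c (fun _ => 0)

theorem greenTerm_eq (σ c : ℕ → ℝ) (j : ℕ) (t : ℝ) :
    greenTerm σ (fun _ => 0) c (fun _ => 0) j t = c j * Real.exp (-σ j * |t|) := by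
  simp [greenTerm, mul_comm]

theorem expGreen_neg (σ c : ℕ → ℝ) (t : ℝ) : expGreen σ c (-t) = expGreen σ c t := by
  simp [expGreen, green, greenTerm]

namespace ExpSeries

variable {σ c : ℕ → ℝ} (h : ExpSeries σ c)
include h

theorem pos (j : ℕ) : 0 < σ j := h.pos_zero.trans_le (h.mono (Nat.zero_le j))

theorem shift (M : ℕ) : ExpSeries (fun j => σ (j + M)) (fun j => c (j + M)) where
  mono := fun _ _ hij => h.mono (Nat.add_le_add_right hij M)
  pos_zero := h.pos _
  nonneg := fun _ => h.nonneg _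
  summable := (summable_nat_add_iff M).2 h.summable

theorem summable_exp {t : ℝ} (ht : t ≠ 0) : Summable fun j => c j * Real.exp (-σ j * |t|) := by
  have ht : 0 < |t| := abs_pos.2 ht
  refine Summable.of_nonneg_of_le (fun j => mul_nonneg (h.nonneg j) (Real.exp_pos _).le)
    (fun j => ?_) (h.summable.mul_right |t|⁻¹)
  have h1 := h.pos j
  rw [div_mul_eq_mul_div, le_div_iff₀ h1, mul_assoc, ← div_eq_mul_inv, le_div_iff₀ ht, mul_assoc]
  -- What remains is `y * exp (-y) ≤ 1` with `y = σ j * |t|`, so `∑ c j / σ j` controls the series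
  -- away from `0`.
  refine mul_le_of_le_one_right (h.nonneg j) ?_
  rw [mul_assoc, neg_mul, Real.exp_neg, inv_mul_le_iff₀ (Real.exp_pos _), mul_one]
  linarith [Real.add_one_le_exp (σ j * |t|)]

theorem hasSum_expGreen {t : ℝ} (ht : t ≠ 0) :
    HasSum (fun j => c j * Real.exp (-σ j * |t|)) (expGreen σ c t) := by
  have h1 := h.summable_exp ht
  rw [h1.hasSum_iff, h1.tsum_eq_zero_add]
  simp only [expGreen, green, greenTerm_eq]

theorem expGreen_nonneg (t : ℝ) : 0 ≤ expGreen σ c t := by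
  simp only [expGreen, green, greenTerm_eq]
  exact add_nonneg (mul_nonneg (h.nonneg 0) (Real.exp_pos _).le)
    (tsum_nonneg fun j => mul_nonneg (h.nonneg _) (Real.exp_pos _).le)

theorem expGreen_eq_sum_add (M : ℕ) {t : ℝ} (ht : t ≠ 0) :
    expGreen σ c t = ∑ j ∈ Finset.range M, c j * Real.exp (-σ j * |t|) +
      expGreen (fun j => σ (j + M)) (fun j => c (j + M)) t := by
  rw [← (h.hasSum_expGreen ht).tsum_eq, ← ((h.shift M).hasSum_expGreen ht).tsum_eq,
    (h.summable_exp ht).sum_add_tsum_nat_add M]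

/-- Termwise, `σ j (|t| - ε) ≥ σ 0 (|t| - ε)`: away from `0` the slowest exponential governs the
whole sum. -/
theorem expGreen_le {ε t : ℝ} (hε : 0 < ε) (ht : ε ≤ |t|) :
    expGreen σ c t ≤ expGreen σ c ε * Real.exp (σ 0 * ε) * Real.exp (-σ 0 * |t|) := by
  have ht0 : t ≠ 0 := abs_pos.1 (hε.trans_le ht)
  rw [mul_assoc]
  refine hasSum_le (fun j => ?_) (h.hasSum_expGreen ht0)
    ((h.hasSum_expGreen hε.ne').mul_right (Real.exp (σ 0 * ε) * Real.exp (-σ 0 * |t|)))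
  rw [mul_assoc, ← Real.exp_add, ← Real.exp_add, abs_of_pos hε]
  refine mul_le_mul_of_nonneg_left (Real.exp_le_exp.2 ?_) (h.nonneg j)
  nlinarith [h.mono (Nat.zero_le j)]

theorem summable_div_sub {α : ℝ} (hα0 : 0 ≤ α) (hα : α < σ 0) :
    Summable fun j => c j / (σ j - α) := by
  refine Summable.of_nonneg_of_le (fun j => ?_) (fun j => ?_)
    (h.summable.mul_right (σ 0 / (σ 0 - α)))
  · exact div_nonneg (h.nonneg j) (by linarith [h.mono (Nat.zero_le j)])
  · have h0 := h.mono (Nat.zero_le j)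
    have h1 := h.nonneg j
    rw [div_mul_div_comm, div_le_div_iff₀ (by linarith) (mul_pos (h.pos j) (by linarith)),
      mul_assoc]
    refine mul_le_mul_of_nonneg_left ?_ h1
    nlinarith

theorem integrable_expGreen_mul_exp {α : ℝ} (hα0 : 0 ≤ α) (hα : α < σ 0) :
    Integrable fun t => expGreen σ c t * Real.exp (α * |t|) := by
  have hpos : ∀ j, 0 < σ j - α := fun j => by linarith [h.mono (Nat.zero_le j)]
  refine (integrable_of_hasSum_of_summable_integral_norm
    (F := fun j t => c j * Real.exp (-(σ j - α) * |t|))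
    (fun j => (integral_exp_neg_mul_abs (hpos j)).1.const_mul _) ?_ ?_).1
  · refine ((h.summable_div_sub hα0 hα).mul_right 2).congr fun j => ?_
    have : ∀ t : ℝ, ‖c j * Real.exp (-(σ j - α) * |t|)‖ = c j * Real.exp (-(σ j - α) * |t|) :=
      fun t => Real.norm_of_nonneg (mul_nonneg (h.nonneg j) (Real.exp_pos _).le)
    simp only [this]
    rw [integral_const_mul, (integral_exp_neg_mul_abs (hpos j)).2]
    ring
  · have : ∀ᵐ t : ℝ, t ≠ 0 := by simp [ae_iff]
    filter_upwards [this] with t ht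
    refine ((h.hasSum_expGreen ht).mul_right (Real.exp (α * |t|))).congr_fun fun j => ?_
    rw [mul_assoc, ← Real.exp_add]
    ring_nf

theorem integrable_expGreen : Integrable (expGreen σ c) := by
  simpa using h.integrable_expGreen_mul_exp le_rfl h.pos_zero

theorem integral_expGreen_mul_cexp (ξ : ℝ) :
    ∫ t : ℝ, (expGreen σ c t : ℂ) * Complex.exp (Complex.I * ξ * t) =
      ((∑' j, c j * (2 * σ j / (σ j ^ 2 + ξ ^ 2)) : ℝ) : ℂ) := by
  have hs := (integrable_of_hasSum_of_summable_integral_norm (μ := volume)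
    (F := fun j (t : ℝ) => (c j : ℂ) * (((Real.exp (-σ j * |t|) : ℝ) : ℂ) *
      Complex.exp (Complex.I * ξ * t)))
    (f := fun t => (expGreen σ c t : ℂ) * Complex.exp (Complex.I * ξ * t))
    (fun j => (integral_exp_neg_mul_abs_mul_cexp (h.pos j) ξ).1.const_mul _) ?_ ?_).2
  · rw [← hs.tsum_eq, Complex.ofReal_tsum]
    refine tsum_congr fun j => ?_
    rw [integral_const_mul, (integral_exp_neg_mul_abs_mul_cexp (h.pos j) ξ).2,
      ← Complex.ofReal_mul]
  · refine (h.summable.mul_right 2).congr fun j => ?_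
    have : ∀ t : ℝ, ‖(c j : ℂ) * (((Real.exp (-σ j * |t|) : ℝ) : ℂ) *
        Complex.exp (Complex.I * ξ * t))‖ = c j * Real.exp (-σ j * |t|) := by
      intro t
      rw [norm_mul, norm_mul, Complex.norm_real, Complex.norm_real,
        Real.norm_of_nonneg (h.nonneg j), Real.norm_of_nonneg (Real.exp_pos _).le,
        Complex.norm_exp]
      simp
    simp only [this]
    rw [integral_const_mul, (integral_exp_neg_mul_abs (h.pos j)).2]
    ring
  · have : ∀ᵐ t : ℝ, t ≠ 0 := by simp [ae_iff]
    filter_upwards [this] with t ht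
    refine ((Complex.hasSum_ofReal.2 (h.hasSum_expGreen ht)).mul_right
      (Complex.exp (Complex.I * ξ * t))).congr_fun fun j => ?_
    push_cast
    ring

/-- For `t > 0` the series is the restriction of a holomorphic function on `Re z > 0`, by locally
uniform convergence; evenness gives `t < 0`. -/
theorem contDiffOn_expGreen : ContDiffOn ℝ ∞ (expGreen σ c) {0}ᶜ := by
  set g : ℂ → ℂ := fun z => ∑' j, (c j : ℂ) * Complex.exp (-σ j * z) with hg
  have hpos : ∀ t : ℝ, 0 < t → ContDiffAt ℝ ∞ (expGreen σ c) t := by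
    intro t ht
    have hopen : IsOpen {z : ℂ | t / 2 < z.re} := isOpen_lt continuous_const Complex.continuous_re
    have hd : DifferentiableOn ℂ g {z : ℂ | t / 2 < z.re} := by
      refine Complex.differentiableOn_tsum_of_summable_norm
        (h.summable_exp (show t / 2 ≠ 0 by positivity)) (fun j => by fun_prop) hopen
        fun j z (hz : t / 2 < z.re) => ?_
      rw [norm_mul, Complex.norm_real, Real.norm_of_nonneg (h.nonneg j), Complex.norm_exp,
        abs_of_pos (by positivity)]
      refine mul_le_mul_of_nonneg_left (Real.exp_le_exp.2 ?_) (h.nonneg j)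
      have : (-(σ j : ℂ) * z).re = -σ j * z.re := by simp
      rw [this]
      nlinarith [h.pos j]
    have han : AnalyticAt ℂ g (t : ℂ) :=
      hd.analyticAt (hopen.mem_nhds (show t / 2 < ((t : ℝ) : ℂ).re by simp [ht]))
    refine (han.contDiffAt (n := ∞)).real_of_complex.congr_of_eventuallyEq ?_
    filter_upwards [lt_mem_nhds ht] with s hs
    have h1 : g s = ((expGreen σ c s : ℝ) : ℂ) := by
      rw [hg, ← (h.hasSum_expGreen hs.ne').tsum_eq, Complex.ofReal_tsum]
      refine tsum_congr fun j => ?_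
      rw [abs_of_pos hs]
      push_cast
      rfl
    rw [h1, Complex.ofReal_re]
  intro t ht
  refine ContDiffAt.contDiffWithinAt ?_
  rcases lt_or_gt_of_ne ht with ht | ht
  · have h2 : expGreen σ c = fun s => expGreen σ c (-s) := by
      funext s; rw [expGreen_neg]
    rw [h2]
    exact (hpos (-t) (by linarith)).comp t contDiff_neg.contDiffAt
  · exact hpos t ht

end ExpSeries

open scoped FourierTransform

/-! ### The inverse Fourier transform of sums of Lorentzians -/

theorem hasDerivAt_lorentzian {a : ℝ} (ha : 0 < a) (x : ℝ) :
    HasDerivAt (fun x : ℝ => 2 * a / (a ^ 2 + x ^ 2)) (-(4 * a * x / (a ^ 2 + x ^ 2) ^ 2)) x := by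
  have h0 : a ^ 2 + x ^ 2 ≠ 0 := by positivity
  have h1 : HasDerivAt (fun x : ℝ => a ^ 2 + x ^ 2) (2 * x) x := by
    simpa using (hasDerivAt_pow 2 x).const_add (a ^ 2)
  exact ((hasDerivAt_const x (2 * a)).fun_div h1 h0).congr_deriv (by ring)

theorem continuous_lorentzian {a : ℝ} (ha : 0 < a) :
    Continuous fun x : ℝ => 2 * a / (a ^ 2 + x ^ 2) :=
  continuous_iff_continuousAt.2 fun x => (hasDerivAt_lorentzian ha x).continuousAt

/-- Integration by parts: the Lorentzian decreases on `[0, R]`, so boundary terms and total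
variation add up to twice its value `2 / a` at `0`, divided by `|t|`. The point is the factor `1 /
a`, uniform in `R`: the Lorentzians all have the same integral, and `∑ c j` is not assumed to
converge. -/
theorem norm_integral_cexp_mul_lorentzian_le_half {a t R : ℝ} (ha : 0 < a) (ht : t ≠ 0)
    (hR : 0 ≤ R) :
    ‖∫ ξ in (0 : ℝ)..R, ((2 * a / (a ^ 2 + ξ ^ 2) : ℝ) : ℂ) * Complex.exp (Complex.I * ξ * t)‖ ≤
      4 / (a * |t|) := by
  have hIt : Complex.I * t ≠ 0 := by simpa using ht
  have ht' : 0 < |t| := abs_pos.2 ht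
  set k : ℝ → ℝ := fun x => 2 * a / (a ^ 2 + x ^ 2) with hk
  set k' : ℝ → ℝ := fun x => -(4 * a * x / (a ^ 2 + x ^ 2) ^ 2) with hk'
  set v : ℝ → ℂ := fun x => Complex.exp (Complex.I * x * t) / (Complex.I * t) with hv
  have hkpos : ∀ x, 0 < k x := fun x => by simp only [hk]; positivity
  have hk'c : Continuous k' := by
    refine Continuous.neg (Continuous.div (by fun_prop) (by fun_prop) fun x => ?_)
    positivity
  have hvn : ∀ x, ‖v x‖ = |t|⁻¹ := fun x => by
    simp [hv, Complex.norm_exp]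
  have hvd : ∀ x : ℝ, HasDerivAt v (Complex.exp (Complex.I * x * t)) x := by
    intro x
    have h1 : HasDerivAt (fun x : ℝ => Complex.I * x * t) (Complex.I * t) x := by
      simpa using ((Complex.ofRealCLM.hasDerivAt (x := x)).const_mul Complex.I).mul_const (t : ℂ)
    have := h1.cexp.div_const (Complex.I * t)
    rwa [mul_div_cancel_right₀ _ hIt] at this
  have hparts := intervalIntegral.integral_mul_deriv_eq_deriv_mul (a := 0) (b := R)
    (u := fun x => (k x : ℂ)) (u' := fun x => (k' x : ℂ)) (v := v)
    (v' := fun x : ℝ => Complex.exp (Complex.I * x * t))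
    (fun x _ => (hasDerivAt_lorentzian ha x).ofReal_comp) (fun x _ => hvd x)
    ((Complex.continuous_ofReal.comp hk'c).intervalIntegrable _ _)
    (Continuous.intervalIntegrable (by fun_prop) _ _)
  rw [hparts]
  have hint : ‖∫ x in (0 : ℝ)..R, (k' x : ℂ) * v x‖ ≤ (k 0 - k R) * |t|⁻¹ := by
    have h1 : ‖∫ x in (0 : ℝ)..R, (k' x : ℂ) * v x‖ ≤ ∫ x in (0 : ℝ)..R, -k' x * |t|⁻¹ := by
      refine intervalIntegral.norm_integral_le_of_norm_le hR ?_
        ((hk'c.neg.mul continuous_const).intervalIntegrable _ _)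
      refine ae_of_all _ fun x hx => ?_
      rw [norm_mul, hvn, Complex.norm_real, Real.norm_eq_abs, abs_of_nonpos]
      have := hx.1.le
      simp only [hk', neg_nonpos]
      positivity
    refine h1.trans_eq ?_
    rw [intervalIntegral.integral_mul_const, intervalIntegral.integral_neg,
      intervalIntegral.integral_eq_sub_of_hasDerivAt (fun x _ => hasDerivAt_lorentzian ha x)
        (hk'c.intervalIntegrable _ _)]
    ring
  have hk0 : k 0 = 2 / a := by
    simp only [hk]; field_simp; ring
  refine (norm_sub_le _ _).trans ((add_le_add (norm_sub_le _ _) hint).trans_eq ?_)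
  rw [norm_mul, norm_mul, hvn, hvn, Complex.norm_real, Complex.norm_real,
    Real.norm_of_nonneg (hkpos _).le, Real.norm_of_nonneg (hkpos _).le, hk0]
  field_simp
  ring

theorem norm_integral_cexp_mul_lorentzian_le {a t R : ℝ} (ha : 0 < a) (ht : t ≠ 0) (hR : 0 ≤ R) :
    ‖∫ ξ in (-R)..R, ((2 * a / (a ^ 2 + ξ ^ 2) : ℝ) : ℂ) * Complex.exp (Complex.I * ξ * t)‖ ≤
      8 / (a * |t|) := by
  have hc : Continuous fun ξ : ℝ =>
      ((2 * a / (a ^ 2 + ξ ^ 2) : ℝ) : ℂ) * Complex.exp (Complex.I * ξ * t) :=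
    (Complex.continuous_ofReal.comp (continuous_lorentzian ha)).mul (by fun_prop)
  rw [← intervalIntegral.integral_add_adjacent_intervals (b := 0) (hc.intervalIntegrable _ _)
    (hc.intervalIntegrable _ _)]
  have h1 := norm_integral_cexp_mul_lorentzian_le_half ha ht hR
  have h2 := norm_integral_cexp_mul_lorentzian_le_half ha (neg_ne_zero.2 ht) hR
  have h3 : ∫ ξ in (-R)..0,
      ((2 * a / (a ^ 2 + ξ ^ 2) : ℝ) : ℂ) * Complex.exp (Complex.I * ξ * t) =
      ∫ ξ in (0 : ℝ)..R,
      ((2 * a / (a ^ 2 + ξ ^ 2) : ℝ) : ℂ) * Complex.exp (Complex.I * ξ * (-t : ℝ)) := by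
    have := intervalIntegral.integral_comp_neg (a := 0) (b := R) (fun ξ : ℝ =>
      ((2 * a / (a ^ 2 + ξ ^ 2) : ℝ) : ℂ) * Complex.exp (Complex.I * ξ * t))
    rw [neg_zero] at this
    rw [← this]
    refine intervalIntegral.integral_congr fun ξ _ => ?_
    simp
  rw [h3]
  rw [abs_neg] at h2
  refine (norm_add_le _ _).trans ((add_le_add h2 h1).trans_eq ?_)
  ring

theorem integrable_lorentzian {a : ℝ} (ha : 0 < a) :
    Integrable fun ξ : ℝ => 2 * a / (a ^ 2 + ξ ^ 2) := by
  refine ((integrable_inv_one_add_sq.comp_div ha.ne').const_mul (2 / a)).congr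
    (ae_of_all _ fun ξ => ?_)
  have : a ^ 2 + ξ ^ 2 ≠ 0 := by positivity
  dsimp only
  field_simp

theorem integral_lorentzian_mul_cexp {a : ℝ} (ha : 0 < a) (t : ℝ) :
    Integrable (fun ξ : ℝ => ((2 * a / (a ^ 2 + ξ ^ 2) : ℝ) : ℂ) *
      Complex.exp (Complex.I * ξ * t)) ∧
    ∫ ξ : ℝ, ((2 * a / (a ^ 2 + ξ ^ 2) : ℝ) : ℂ) * Complex.exp (Complex.I * ξ * t) =
      2 * π * ((Real.exp (-a * |t|) : ℝ) : ℂ) := by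
  set f : ℝ → ℂ := fun t => ((Real.exp (-a * |t|) : ℝ) : ℂ) with hf
  have hF : 𝓕 f = fun w : ℝ => ((2 * a / (a ^ 2 + (2 * π * w) ^ 2) : ℝ) : ℂ) := by
    funext w
    rw [Real.fourier_real_eq_integral_exp_smul]
    have := (integral_exp_neg_mul_abs_mul_cexp ha (-(2 * π * w))).2
    rw [neg_sq] at this
    rw [← this]
    refine integral_congr_ae (ae_of_all _ fun t => ?_)
    simp only [hf, smul_eq_mul]
    rw [mul_comm]
    push_cast
    ring_nf
  have hint : Integrable f := (integral_exp_neg_mul_abs ha).1.ofReal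
  have hFint : Integrable (𝓕 f) := by
    rw [hF]
    exact ((integrable_lorentzian ha).comp_mul_left' (by positivity : 2 * π ≠ 0)).ofReal
  have hcont : Continuous f := by fun_prop
  have hinv := congrFun (hcont.fourierInv_fourier_eq hint hFint) t
  rw [Real.fourierInv_eq', hF] at hinv
  constructor
  · refine (integrable_lorentzian ha).mono
      (Continuous.aestronglyMeasurable ?_) (ae_of_all _ fun ξ => ?_)
    · exact (Complex.continuous_ofReal.comp (continuous_lorentzian ha)).mul (by fun_prop)
    · have : (Complex.I * ξ * t).re = 0 := by simp
      rw [norm_mul, Complex.norm_exp, Complex.norm_real, this, Real.exp_zero, mul_one]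
  · have hsub := Measure.integral_comp_mul_left (fun ξ : ℝ =>
      ((2 * a / (a ^ 2 + ξ ^ 2) : ℝ) : ℂ) * Complex.exp (Complex.I * ξ * t)) (2 * π)
    have h2π : |(2 * π)⁻¹| = (2 * π)⁻¹ := abs_of_pos (by positivity)
    rw [h2π] at hsub
    have e : ∫ w : ℝ, ((2 * a / (a ^ 2 + (2 * π * w) ^ 2) : ℝ) : ℂ) *
        Complex.exp (Complex.I * ((2 * π * w : ℝ) : ℂ) * t) = f t := by
      rw [← hinv]
      refine integral_congr_ae (ae_of_all _ fun w => ?_)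
      simp only [smul_eq_mul, RCLike.inner_apply, conj_trivial]
      rw [mul_comm]
      push_cast
      ring_nf
    rw [e, Complex.real_smul] at hsub
    have hπ : (2 * π : ℂ) ≠ 0 := by exact_mod_cast (by positivity : (2 * π : ℝ) ≠ 0)
    change _ = 2 * π * f t
    rw [hsub]
    push_cast
    rw [mul_inv_cancel_left₀ hπ]

/-- Sum and integral are exchanged for fixed `R` with the bound `2 c_j / σ_j`. The limit `R → ∞` is
then taken termwise with the bound `8 c_j / (σ_j |t|)`. -/
theorem ExpSeries.tendsto_integral_green {σ c : ℕ → ℝ} (h : ExpSeries σ c) {t : ℝ} (ht : t ≠ 0) :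
    Tendsto (fun R : ℝ => ∫ ξ in (-R)..R,
      ((∑' j, c j * (2 * σ j / (σ j ^ 2 + ξ ^ 2)) : ℝ) : ℂ) * Complex.exp (Complex.I * ξ * t))
      atTop (𝓝 (2 * π * ((expGreen σ c t : ℝ) : ℂ))) := by
  have ht' : 0 < |t| := abs_pos.2 ht
  set F : ℕ → ℝ → ℂ := fun j ξ => (c j : ℂ) * (((2 * σ j / (σ j ^ 2 + ξ ^ 2) : ℝ) : ℂ) *
    Complex.exp (Complex.I * ξ * t)) with hF
  have hnorm : ∀ j ξ, ‖F j ξ‖ ≤ 2 * (c j / σ j) := by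
    intro j ξ
    have h1 := h.pos j
    rw [hF]
    simp only [norm_mul, Complex.norm_real, Complex.norm_exp]
    rw [Real.norm_of_nonneg (h.nonneg j), Real.norm_of_nonneg (by positivity)]
    have h2 : 2 * σ j / (σ j ^ 2 + ξ ^ 2) ≤ 2 / σ j := by
      rw [div_le_div_iff₀ (by positivity) h1]
      nlinarith [sq_nonneg ξ]
    have h3 := mul_le_mul_of_nonneg_left h2 (h.nonneg j)
    simp only [Complex.mul_re, Complex.I_re, Complex.I_im, Complex.mul_im, Complex.ofReal_re,
      Complex.ofReal_im]
    simp
    linarith [show c j * (2 / σ j) = 2 * (c j / σ j) by ring]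
  have hexch : ∀ R : ℝ, ∫ ξ in (-R)..R,
      ((∑' j, c j * (2 * σ j / (σ j ^ 2 + ξ ^ 2)) : ℝ) : ℂ) * Complex.exp (Complex.I * ξ * t) =
      ∑' j, ∫ ξ in (-R)..R, F j ξ := by
    intro R
    refine (HasSum.tsum_eq (intervalIntegral.hasSum_integral_of_dominated_convergence
      (fun j _ => 2 * (c j / σ j)) (fun j => Continuous.aestronglyMeasurable ?_)
      (fun j => ae_of_all _ fun ξ _ => hnorm j ξ) (ae_of_all _ fun ξ _ => h.summable.mul_left 2)
      intervalIntegrable_const (ae_of_all _ fun ξ _ => ?_))).symm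
    · exact continuous_const.mul
        ((Complex.continuous_ofReal.comp (continuous_lorentzian (h.pos j))).mul (by fun_prop))
    · have hs : Summable (fun j => F j ξ) :=
        Summable.of_norm_bounded (h.summable.mul_left 2) fun j => hnorm j ξ
      have e : ((∑' j, c j * (2 * σ j / (σ j ^ 2 + ξ ^ 2)) : ℝ) : ℂ) *
          Complex.exp (Complex.I * ξ * t) = ∑' j, F j ξ := by
        rw [Complex.ofReal_tsum, ← tsum_mul_right]
        refine tsum_congr fun j => ?_
        simp only [hF]
        push_cast
        ring
      rw [e]
      exact hs.hasSum
  simp only [hexch]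
  have hval : 2 * π * ((expGreen σ c t : ℝ) : ℂ) =
      ∑' j, (c j : ℂ) * (2 * π * ((Real.exp (-σ j * |t|) : ℝ) : ℂ)) := by
    rw [← (h.hasSum_expGreen ht).tsum_eq, Complex.ofReal_tsum, ← tsum_mul_left]
    refine tsum_congr fun j => ?_
    push_cast
    ring
  rw [hval]
  refine tendsto_tsum_of_dominated_convergence (h.summable.mul_right (8 / |t|)) (fun j => ?_) ?_
  · simp only [hF, intervalIntegral.integral_const_mul]
    refine Tendsto.const_mul _ ?_
    obtain ⟨h1, h2⟩ := integral_lorentzian_mul_cexp (h.pos j) t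
    rw [← h2]
    exact intervalIntegral_tendsto_integral h1 tendsto_neg_atTop_atBot tendsto_id
  · filter_upwards [eventually_ge_atTop 0] with R hR j
    simp only [hF, intervalIntegral.integral_const_mul]
    rw [norm_mul, Complex.norm_real, Real.norm_of_nonneg (h.nonneg j)]
    refine (mul_le_mul_of_nonneg_left
      (norm_integral_cexp_mul_lorentzian_le (h.pos j) ht hR) (h.nonneg j)).trans_eq ?_
    have := (h.pos j).ne'
    field_simp

/-! ### Convolution with a source of exponential growth -/

/-- A locally integrable function which is `O(e^{-δ t})` at `+∞` and `O(e^{δ₀ t})` at `-∞`. -/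
structure ExpBounded (u : ℝ → ℝ) (δ δ₀ : ℝ) : Prop where
  locallyIntegrable : LocallyIntegrable u
  isBigO_atTop : u =O[atTop] fun t => Real.exp (-δ * t)
  isBigO_atBot : u =O[atBot] fun t => Real.exp (δ₀ * t)

theorem integrableAtFilter_exp_atTop {a : ℝ} (ha : a < 0) :
    IntegrableAtFilter (fun t : ℝ => Real.exp (a * t)) atTop :=
  ⟨Ioi 0, Ioi_mem_atTop 0, integrableOn_exp_mul_Ioi ha 0⟩

theorem integrableAtFilter_exp_atBot {a : ℝ} (ha : 0 < a) :
    IntegrableAtFilter (fun t : ℝ => Real.exp (a * t)) atBot :=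
  ⟨Iic 0, Iic_mem_atBot 0, integrableOn_exp_mul_Iic ha 0⟩

namespace ExpBounded

variable {u : ℝ → ℝ} {δ δ₀ : ℝ} (hu : ExpBounded u δ δ₀)
include hu

theorem comp_neg : ExpBounded (fun t => u (-t)) δ₀ δ where
  locallyIntegrable := fun x => by
    obtain ⟨s, hs, hi⟩ := hu.locallyIntegrable (-x)
    exact ⟨-s, (continuous_neg.tendsto x) hs, hi.comp_neg⟩
  isBigO_atTop := by
    refine (hu.isBigO_atBot.comp_tendsto tendsto_neg_atTop_atBot).congr_right fun t => ?_
    simp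
  isBigO_atBot := by
    refine (hu.isBigO_atTop.comp_tendsto tendsto_neg_atBot_atTop).congr_right fun t => ?_
    simp

theorem integrable_weight {w : ℝ → ℝ} (hw : Continuous w) {a b : ℝ}
    (hwa : ∀ t, 0 ≤ t → |w t| ≤ Real.exp (a * t)) (hwb : ∀ t, t ≤ 0 → |w t| ≤ Real.exp (b * t))
    (ha : a < δ) (hb : -δ₀ < b) : Integrable fun t => w t * u t := by
  have hl : LocallyIntegrable fun t => w t * u t := by
    simpa only [mul_comm] using hu.locallyIntegrable.mul_continuous hw
  refine hl.integrable_of_isBigO_atBot_atTop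
    (g := fun t => Real.exp ((b + δ₀) * t)) (g' := fun t => Real.exp ((a - δ) * t)) ?_
    (integrableAtFilter_exp_atBot (by linarith)) ?_ (integrableAtFilter_exp_atTop (by linarith))
  · have h1 : w =O[atBot] fun t => Real.exp (b * t) := IsBigO.of_bound 1 (by
      filter_upwards [eventually_le_atBot 0] with t ht
      simpa using hwb t ht)
    refine (h1.mul hu.isBigO_atBot).congr_right fun t => ?_
    rw [← Real.exp_add]; ring_nf
  · have h1 : w =O[atTop] fun t => Real.exp (a * t) := IsBigO.of_bound 1 (by
      filter_upwards [eventually_ge_atTop 0] with t ht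
      simpa using hwa t ht)
    refine (h1.mul hu.isBigO_atTop).congr_right fun t => ?_
    rw [← Real.exp_add]; ring_nf

theorem integrable_exp_mul {η : ℝ} (h1 : η < δ) (h2 : -δ₀ < η) :
    Integrable fun t => Real.exp (η * t) * u t :=
  hu.integrable_weight (by fun_prop) (fun t _ => (abs_of_pos (Real.exp_pos _)).le)
    (fun t _ => (abs_of_pos (Real.exp_pos _)).le) h1 h2

theorem integrable_exp_neg_abs_mul {α : ℝ} (h1 : -α < δ) (h2 : -δ₀ < α) :
    Integrable fun t => Real.exp (-α * |t|) * u t := by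
  refine hu.integrable_weight (a := -α) (b := α) (by fun_prop) (fun t ht => ?_) (fun t ht => ?_)
    h1 h2
  · rw [abs_of_pos (Real.exp_pos _), abs_of_nonneg ht]
  · rw [abs_of_pos (Real.exp_pos _), abs_of_nonpos ht]
    simp

theorem exists_bound_atTop : ∃ C T, 0 ≤ C ∧ 1 ≤ T ∧ ∀ t, T ≤ t → |u t| ≤ C * Real.exp (-δ * t) := by
  obtain ⟨C, hC⟩ := hu.isBigO_atTop.bound
  obtain ⟨T, hT⟩ := hC.exists_forall_of_atTop
  refine ⟨max C 0, max T 1, le_max_right _ _, le_max_right _ _, fun t ht => ?_⟩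
  have := hT t ((le_max_left _ _).trans ht)
  rw [Real.norm_eq_abs, Real.norm_of_nonneg (Real.exp_pos _).le] at this
  exact this.trans (mul_le_mul_of_nonneg_right (le_max_left _ _) (Real.exp_pos _).le)

end ExpBounded

namespace ExpSeries

variable {σ c : ℕ → ℝ} (h : ExpSeries σ c)
include h

/-- Since `e^{-α|t|} ≤ e^{α|t-s|} e^{-α|s|}`, the weighted kernel is dominated by the convolution
integrand of two integrable functions. -/
theorem integrable_prod {u : ℝ → ℝ} {α : ℝ} (hα0 : 0 ≤ α) (hα : α < σ 0)
    (hu : Integrable fun t => Real.exp (-α * |t|) * u t) :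
    Integrable (fun p : ℝ × ℝ => Real.exp (-α * |p.1|) * (expGreen σ c (p.1 - p.2) * u p.2))
      (volume.prod volume) := by
  have h1 := hu.convolution_integrand (ContinuousLinearMap.mul ℝ ℝ)
    (h.integrable_expGreen_mul_exp hα0 hα)
  have h2 : Continuous fun p : ℝ × ℝ =>
      Real.exp (-α * |p.1|) * Real.exp (-α * |p.1 - p.2|) * Real.exp (α * |p.2|) := by fun_prop
  refine (h1.bdd_mul (c := 1) h2.aestronglyMeasurable (ae_of_all _ fun p => ?_)).congr
    (ae_of_all _ fun p => ?_)
  · rw [Real.norm_of_nonneg (by positivity), ← Real.exp_add, ← Real.exp_add, Real.exp_le_one_iff]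
    have := abs_sub_abs_le_abs_sub p.2 p.1
    rw [abs_sub_comm] at this
    nlinarith
  · simp only [ContinuousLinearMap.mul_apply']
    have e1 : Real.exp (α * |p.2|) * Real.exp (-α * |p.2|) = 1 := by
      rw [← Real.exp_add]; simp
    have e2 : Real.exp (-α * |p.1 - p.2|) * Real.exp (α * |p.1 - p.2|) = 1 := by
      rw [← Real.exp_add]; simp
    linear_combination (Real.exp (-α * |p.1|) * expGreen σ c (p.1 - p.2) * u p.2) *
      (e1 * (Real.exp (-α * |p.1 - p.2|) * Real.exp (α * |p.1 - p.2|)) + e2)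

/-- Near `s = t` the source is bounded and the kernel integrable; elsewhere the kernel is at most a
constant times `e^{-σ_0|t-s|}`, hence bounded by the weight `e^{-α|s|}` up to a factor depending on
`t`. -/
theorem integrable_mul_of_isBigO {u : ℝ → ℝ} {α : ℝ} (hα : α < σ 0) (hα0 : 0 ≤ α)
    (hum : AEStronglyMeasurable u) (hu : Integrable fun t => Real.exp (-α * |t|) * u t) {t : ℝ}
    (ht : u =O[𝓝 t] fun _ => (1 : ℝ)) : Integrable fun s => expGreen σ c (t - s) * u s := by
  obtain ⟨C, hC⟩ := ht.bound
  obtain ⟨ε, hε, hball⟩ := Metric.eventually_nhds_iff.1 hC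
  have hG : Integrable fun s => expGreen σ c (t - s) := h.integrable_expGreen.comp_sub_left t
  set K := expGreen σ c ε * Real.exp (σ 0 * ε) with hK
  have hK0 : 0 ≤ K := mul_nonneg (h.expGreen_nonneg _) (Real.exp_pos _).le
  have hdom : Integrable fun s => |C| * expGreen σ c (t - s) +
      K * Real.exp (α * |t|) * ‖Real.exp (-α * |s|) * u s‖ :=
    (hG.const_mul _).add (hu.norm.const_mul _)
  refine hdom.mono' (hG.1.mul hum) (ae_of_all _ fun s => ?_)
  have hg := h.expGreen_nonneg (t - s)
  rw [norm_mul, Real.norm_of_nonneg hg]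
  rcases lt_or_ge (dist s t) ε with hs | hs
  · have h1 := hball hs
    simp only [norm_one, mul_one] at h1
    have h2 : 0 ≤ K * Real.exp (α * |t|) * ‖Real.exp (-α * |s|) * u s‖ := by positivity
    have h3 := mul_le_mul_of_nonneg_left (h1.trans (le_abs_self C)) hg
    linarith
  · have hs' : ε ≤ |t - s| := by rwa [abs_sub_comm, ← Real.dist_eq]
    have h1 := h.expGreen_le hε hs'
    have h2 : 0 ≤ |C| * expGreen σ c (t - s) := by positivity
    have h3 : Real.exp (-σ 0 * |t - s|) ≤ Real.exp (α * |t|) * Real.exp (-α * |s|) := by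
      rw [← Real.exp_add, Real.exp_le_exp]
      have h4 := abs_sub_abs_le_abs_sub s t
      rw [abs_sub_comm] at h4
      nlinarith [abs_nonneg (t - s)]
    have h5 : expGreen σ c (t - s) ≤ K * (Real.exp (α * |t|) * Real.exp (-α * |s|)) :=
      h1.trans (mul_le_mul_of_nonneg_left h3 hK0)
    have h6 := mul_le_mul_of_nonneg_right h5 (norm_nonneg (u s))
    rw [norm_mul, Real.norm_of_nonneg (Real.exp_pos _).le]
    linarith

/-! ### Asymptotic expansion of the convolution -/

theorem integrableOn_kernel {M : ℕ} {δ : ℝ} (hδ : -σ 0 < δ) (hM : ∀ j < M, σ j < δ) :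
    IntegrableOn (fun v => (expGreen σ c v + ∑ j ∈ Finset.range M, c j * Real.exp (σ j * v)) *
      Real.exp (-δ * v)) (Ici (-1)) := by
  simp only [add_mul, Finset.sum_mul]
  refine Integrable.add ?_ (integrable_finsetSum _ fun j hj => ?_)
  · have hα : max 0 (-δ) < σ 0 := max_lt h.pos_zero (by linarith)
    have h1 := (h.integrable_expGreen_mul_exp (le_max_left 0 (-δ)) hα).const_mul (Real.exp |δ|)
    refine (h1.integrableOn (s := Ici (-1))).mono'
      (h.integrable_expGreen.1.restrict.mul (Continuous.aestronglyMeasurable (by fun_prop))) ?_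
    refine (ae_restrict_iff' measurableSet_Ici).2 (ae_of_all _ fun v (hv : -1 ≤ v) => ?_)
    have hg := h.expGreen_nonneg v
    rw [norm_mul, Real.norm_of_nonneg hg, Real.norm_of_nonneg (Real.exp_pos _).le,
      mul_left_comm, ← Real.exp_add]
    refine mul_le_mul_of_nonneg_left (Real.exp_le_exp.2 ?_) hg
    rcases le_or_gt 0 v with h0 | h0
    · rw [abs_of_nonneg h0]
      have := mul_le_mul_of_nonneg_right (le_max_right 0 (-δ)) h0
      linarith [abs_nonneg δ]
    · have h2 : -δ * v ≤ |δ| := by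
        have : |(-δ) * v| ≤ |δ| * 1 := by
          rw [abs_mul, abs_neg]
          exact mul_le_mul_of_nonneg_left (abs_le.2 ⟨hv, by linarith⟩) (abs_nonneg _)
        linarith [le_abs_self (-δ * v)]
      have := mul_nonneg (le_max_left 0 (-δ)) (abs_nonneg v)
      linarith
  · have h1 := hM j (Finset.mem_range.1 hj)
    have h2 := ((integrableOn_Ici_iff_integrableOn_Ioi).2
      (integrableOn_exp_mul_Ioi (show σ j - δ < 0 by linarith) (-1))).const_mul (c j)
    refine h2.congr (ae_of_all _ fun v => ?_)
    dsimp only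
    rw [mul_assoc, ← Real.exp_add]
    ring_nf

/-- For `s ≤ t - 1` the first `M` exponentials cancel exactly and the tail decays at rate `σ M`. For
`s > t - 1` no cancellation is used; the source compensates the growth there. -/
theorem abs_kernel_le {M : ℕ} {t s : ℝ} (hs : s ≠ t) :
    (s ≤ t - 1 → |expGreen σ c (t - s) -
        ∑ j ∈ Finset.range M, c j * Real.exp (-σ j * (t - s))| ≤
      expGreen (fun j => σ (j + M)) (fun j => c (j + M)) 1 * Real.exp (σ M) *
        (Real.exp (-σ M * t) * Real.exp (σ M * s))) ∧
    |expGreen σ c (t - s) - ∑ j ∈ Finset.range M, c j * Real.exp (-σ j * (t - s))| ≤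
      expGreen σ c (s - t) + ∑ j ∈ Finset.range M, c j * Real.exp (σ j * (s - t)) := by
  have hts : t - s ≠ 0 := sub_ne_zero.2 hs.symm
  have hsum : 0 ≤ ∑ j ∈ Finset.range M, c j * Real.exp (σ j * (s - t)) :=
    Finset.sum_nonneg fun j _ => mul_nonneg (h.nonneg j) (Real.exp_pos _).le
  have hG : expGreen σ c (s - t) = expGreen σ c (t - s) := by
    rw [← neg_sub, expGreen_neg]
  have htail : 0 < t - s → expGreen σ c (t - s) -
      ∑ j ∈ Finset.range M, c j * Real.exp (-σ j * (t - s)) =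
      expGreen (fun j => σ (j + M)) (fun j => c (j + M)) (t - s) := fun h0 => by
    rw [h.expGreen_eq_sum_add M hts, abs_of_pos h0, add_sub_cancel_left]
  refine ⟨fun hst => ?_, ?_⟩
  · rw [htail (by linarith), abs_of_nonneg ((h.shift M).expGreen_nonneg _)]
    have := (h.shift M).expGreen_le one_pos (t := t - s) ((by linarith : 1 ≤ t - s).trans
      (le_abs_self _))
    rw [abs_of_pos (by linarith : 0 < t - s)] at this
    simp only [zero_add, mul_one] at this
    refine this.trans_eq ?_
    rw [← Real.exp_add]
    congr 2
    ring
  · rw [hG]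
    have hg := h.expGreen_nonneg (t - s)
    rw [abs_le]
    constructor
    · have : ∑ j ∈ Finset.range M, c j * Real.exp (-σ j * (t - s)) =
        ∑ j ∈ Finset.range M, c j * Real.exp (σ j * (s - t)) :=
        Finset.sum_congr rfl fun j _ => by ring_nf
      linarith
    · have : 0 ≤ ∑ j ∈ Finset.range M, c j * Real.exp (-σ j * (t - s)) :=
        Finset.sum_nonneg fun j _ => mul_nonneg (h.nonneg j) (Real.exp_pos _).le
      linarith

end ExpSeries

theorem exists_weight {a δ δ₀ : ℝ} (ha : 0 < a) (hδ : -a < δ) (hδ₀ : -a < δ₀) :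
    ∃ α, 0 ≤ α ∧ α < a ∧ -α < δ ∧ -δ₀ < α := by
  obtain ⟨α, h1, h2⟩ := exists_between (max_lt ha (max_lt (neg_lt.1 hδ) (neg_lt.1 hδ₀)))
  rw [max_lt_iff, max_lt_iff] at h1
  exact ⟨α, h1.1.le, h2, neg_lt.1 h1.2.1, h1.2.2⟩

theorem particular_expGreen_comp_neg (σ c : ℕ → ℝ) (u : ℝ → ℝ) (t : ℝ) :
    particular (expGreen σ c) (fun s => u (-s)) t = particular (expGreen σ c) u (-t) := by
  rw [particular, particular,
    ← integral_neg_eq_self (fun s => expGreen σ c (-t - s) * u s)]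
  refine integral_congr_ae (ae_of_all _ fun s => ?_)
  dsimp only
  rw [← expGreen_neg σ c (t - s)]
  ring_nf

namespace ExpSeries

variable {σ c : ℕ → ℝ} (h : ExpSeries σ c)
include h

/-- The remainder is the convolution of `u` with the kernel minus its first `M` exponentials. The
three terms come from `s < T`, where only integrability of `u` is used, from `T < s ≤ t - 1`, and
from `s > t - 1`, where the decay of `u` is used. -/
theorem exists_bound_remainder {u : ℝ → ℝ} {δ δ₀ : ℝ} (hu : ExpBounded u δ δ₀) (hδ : -σ 0 < δ)
    (hδ₀ : -σ 0 < δ₀) {M : ℕ} (hM : ∀ j < M, σ j < δ) :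
    ∃ C T, 0 ≤ C ∧ 1 ≤ T ∧ ∀ t, T + 1 ≤ t →
      |particular (expGreen σ c) u t -
        ∑ j ∈ Finset.range M, c j * (∫ s, Real.exp (σ j * s) * u s) * Real.exp (-σ j * t)| ≤
      C * (Real.exp (-σ M * t) + Real.exp (-σ M * t) * (∫ s in T..t, Real.exp ((σ M - δ) * s)) +
        Real.exp (-δ * t)) := by
  obtain ⟨α, hα0, hα, hαδ, hαδ₀⟩ := exists_weight h.pos_zero hδ hδ₀
  obtain ⟨C, T, hC0, hT1, hCT⟩ := hu.exists_bound_atTop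
  have hSpos := h.pos M
  have hS0 : -δ₀ < σ M := by linarith [h.mono (Nat.zero_le M)]
  set S := σ M with hS
  -- This weight behaves like `e^{Ss}` at `-∞` and like `e^{-αs}` at `+∞`, so `w * u` is integrable
  -- whatever the order of `S` and `δ`. On `s ≤ T` it dominates `e^{Ss}` up to the constant `L`.
  set w : ℝ → ℝ := fun s => Real.exp (min (S * s) (-α * s)) with hw
  have hwu : Integrable fun s => w s * u s := by
    refine hu.integrable_weight (a := -α) (b := S) (by fun_prop) (fun t ht => ?_) (fun t ht => ?_)
      hαδ hS0
    · rw [abs_of_pos (Real.exp_pos _)]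
      exact Real.exp_le_exp.2 (min_le_right _ _)
    · rw [abs_of_pos (Real.exp_pos _)]
      exact Real.exp_le_exp.2 (min_le_left _ _)
  set K := expGreen (fun j => σ (j + M)) (fun j => c (j + M)) 1 * Real.exp S with hK
  have hK0 : 0 ≤ K := mul_nonneg ((h.shift M).expGreen_nonneg _) (Real.exp_pos _).le
  set H : ℝ → ℝ := fun v => (expGreen σ c v + ∑ j ∈ Finset.range M, c j * Real.exp (σ j * v)) *
    Real.exp (-δ * v) with hH
  have hH0 : ∀ v, 0 ≤ H v := fun v => mul_nonneg (add_nonneg (h.expGreen_nonneg v)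
    (Finset.sum_nonneg fun j _ => mul_nonneg (h.nonneg j) (Real.exp_pos _).le)) (Real.exp_pos _).le
  have hHint : Integrable ((Ici (-1)).indicator H) :=
    (h.integrableOn_kernel hδ hM).integrable_indicator measurableSet_Ici
  set L := Real.exp ((S + α) * T) with hL
  set I₁ := ∫ s, |w s * u s| with hI₁
  set I₃ := ∫ v, (Ici (-1)).indicator H v with hI₃
  have hI₁0 : 0 ≤ I₁ := integral_nonneg fun s => abs_nonneg _
  have hI₃0 : 0 ≤ I₃ := integral_nonneg fun v => indicator_nonneg (fun v _ => hH0 v) v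
  refine ⟨K * L * I₁ + K * C + C * I₃, T, by positivity, hT1, fun t ht => ?_⟩
  have hbd : u =O[𝓝 t] fun _ => (1 : ℝ) := by
    have h1 : u =O[𝓝 t] fun s => Real.exp (-δ * s) := IsBigO.of_bound C (by
      filter_upwards [lt_mem_nhds (show T < t by linarith)] with s hs
      rw [Real.norm_eq_abs, Real.norm_of_nonneg (Real.exp_pos _).le]
      exact hCT s hs.le)
    have h2 : Continuous fun s : ℝ => Real.exp (-δ * s) := by fun_prop
    exact h1.trans ((h2.tendsto t).isBigO_one ℝ)
  have hGu := h.integrable_mul_of_isBigO hα hα0 hu.locallyIntegrable.aestronglyMeasurable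
    (hu.integrable_exp_neg_abs_mul hαδ hαδ₀) hbd
  have hju : ∀ j ∈ Finset.range M,
      Integrable fun s => c j * Real.exp (-σ j * (t - s)) * u s := by
    intro j hj
    have := (hu.integrable_exp_mul (hM j (Finset.mem_range.1 hj))
      (by linarith [h.mono (Nat.zero_le j)])).const_mul (c j * Real.exp (-σ j * t))
    refine this.congr (ae_of_all _ fun s => ?_)
    dsimp only
    rw [show -σ j * (t - s) = -σ j * t + σ j * s by ring, Real.exp_add]
    ring
  have hD : particular (expGreen σ c) u t -
      ∑ j ∈ Finset.range M, c j * (∫ s, Real.exp (σ j * s) * u s) * Real.exp (-σ j * t) =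
      ∫ s, (expGreen σ c (t - s) -
        ∑ j ∈ Finset.range M, c j * Real.exp (-σ j * (t - s))) * u s := by
    simp only [sub_mul, Finset.sum_mul]
    rw [integral_sub hGu (integrable_finsetSum _ hju), integral_finsetSum _ hju, particular]
    congr 1
    refine Finset.sum_congr rfl fun j _ => ?_
    rw [mul_right_comm, ← integral_const_mul]
    refine integral_congr_ae (ae_of_all _ fun s => ?_)
    dsimp only
    rw [show -σ j * (t - s) = -σ j * t + σ j * s by ring, Real.exp_add]
    ring
  set g₁ : ℝ → ℝ := fun s => K * Real.exp (-S * t) * L * |w s * u s| with hg₁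
  set g₂ : ℝ → ℝ := fun s => K * C * Real.exp (-S * t) *
    (Ioc T t).indicator (fun s => Real.exp ((S - δ) * s)) s with hg₂
  set g₃ : ℝ → ℝ := fun s => C * Real.exp (-δ * t) * (Ici (-1)).indicator H (s - t) with hg₃
  have i₁ : Integrable g₁ := hwu.abs.const_mul _
  have i₂ : Integrable g₂ := by
    refine Integrable.const_mul (IntegrableOn.integrable_indicator ?_ measurableSet_Ioc) _
    exact (Continuous.integrableOn_Icc (by fun_prop)).mono_set Ioc_subset_Icc_self
  have i₃ : Integrable g₃ := (hHint.comp_sub_right t).const_mul _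
  have p₁ : ∀ s, 0 ≤ g₁ s := fun s => by positivity
  have p₂ : ∀ s, 0 ≤ g₂ s := fun s =>
    mul_nonneg (by positivity) (indicator_nonneg (fun s _ => (Real.exp_pos _).le) s)
  have p₃ : ∀ s, 0 ≤ g₃ s := fun s =>
    mul_nonneg (by positivity) (indicator_nonneg (fun v _ => hH0 v) _)
  have hle : ∀ᵐ s, ‖(expGreen σ c (t - s) -
      ∑ j ∈ Finset.range M, c j * Real.exp (-σ j * (t - s))) * u s‖ ≤ g₁ s + g₂ s + g₃ s := by
    have h1 : ∀ᵐ s : ℝ, s ≠ t := by simp [ae_iff]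
    have h2 : ∀ᵐ s : ℝ, s ≠ T := by simp [ae_iff]
    filter_upwards [h1, h2] with s hst hsT
    obtain ⟨k1, k2⟩ := h.abs_kernel_le (M := M) hst
    have q₁ := p₁ s
    have q₂ := p₂ s
    have q₃ := p₃ s
    rw [norm_mul, Real.norm_eq_abs, Real.norm_eq_abs]
    rcases le_or_gt s (t - 1) with hs1 | hs1
    · have k3 := mul_le_mul_of_nonneg_right (k1 hs1) (abs_nonneg (u s))
      rcases lt_or_gt_of_ne hsT with hs2 | hs2
      · have hexp : Real.exp (S * s) ≤ L * w s := by
          rw [hL, hw, ← Real.exp_add, Real.exp_le_exp]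
          rcases min_choice (S * s) (-α * s) with h3 | h3 <;> rw [h3]
          · have : 0 ≤ (S + α) * T := by positivity
            linarith
          · nlinarith
        have : K * (Real.exp (-S * t) * Real.exp (S * s)) * |u s| ≤ g₁ s := by
          have h4 : K * Real.exp (-S * t) * |u s| * Real.exp (S * s) ≤
              K * Real.exp (-S * t) * |u s| * (L * w s) :=
            mul_le_mul_of_nonneg_left hexp (by positivity)
          simp only [hg₁]
          rw [abs_mul, abs_of_pos (show 0 < w s from Real.exp_pos _)]
          linarith
        linarith
      · have : K * (Real.exp (-S * t) * Real.exp (S * s)) * |u s| ≤ g₂ s := by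
          simp only [hg₂]
          rw [indicator_of_mem (show s ∈ Ioc T t from ⟨hs2, by linarith⟩)]
          have h4 : K * (Real.exp (-S * t) * Real.exp (S * s)) * |u s| ≤
              K * (Real.exp (-S * t) * Real.exp (S * s)) * (C * Real.exp (-δ * s)) :=
            mul_le_mul_of_nonneg_left (hCT s hs2.le) (by positivity)
          refine h4.trans_eq ?_
          rw [show (S - δ) * s = S * s + -δ * s by ring, Real.exp_add]
          ring
        linarith
    · have k3 := mul_le_mul k2 (hCT s (by linarith)) (abs_nonneg _) ((abs_nonneg _).trans k2)
      have : (expGreen σ c (s - t) + ∑ j ∈ Finset.range M, c j * Real.exp (σ j * (s - t))) *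
          (C * Real.exp (-δ * s)) = g₃ s := by
        simp only [hg₃]
        rw [indicator_of_mem (show s - t ∈ Ici (-1 : ℝ) from by
          rw [mem_Ici]; linarith)]
        simp only [hH]
        rw [show -δ * s = -δ * t + -δ * (s - t) by ring, Real.exp_add]
        ring
      linarith
  rw [hD]
  refine (norm_integral_le_of_norm_le ((i₁.add i₂).add i₃) hle).trans ?_
  rw [integral_add' (i₁.add i₂) i₃, integral_add' i₁ i₂]
  have e₁ : ∫ s, g₁ s = K * L * I₁ * Real.exp (-S * t) := by
    simp only [hg₁]
    rw [integral_const_mul]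
    ring
  have e₂ : ∫ s, g₂ s = K * C * (Real.exp (-S * t) * ∫ s in T..t, Real.exp ((S - δ) * s)) := by
    simp only [hg₂]
    rw [integral_const_mul, integral_indicator measurableSet_Ioc,
      intervalIntegral.integral_of_le (by linarith)]
    ring
  have e₃ : ∫ s, g₃ s = C * I₃ * Real.exp (-δ * t) := by
    simp only [hg₃]
    rw [integral_const_mul, integral_sub_right_eq_self (fun v => (Ici (-1)).indicator H v) t]
    ring
  rw [e₁, e₂, e₃]
  have hE : 0 ≤ ∫ s in T..t, Real.exp ((S - δ) * s) :=
    intervalIntegral.integral_nonneg (by linarith) fun s _ => (Real.exp_pos _).le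
  set X := Real.exp (-S * t)
  set Y := Real.exp (-S * t) * ∫ s in T..t, Real.exp ((S - δ) * s) with hY
  set Z := Real.exp (-δ * t)
  have hX : 0 < X := Real.exp_pos _
  have hY0 : 0 ≤ Y := mul_nonneg hX.le hE
  have hZ : 0 < Z := Real.exp_pos _
  have hp : 0 ≤ K * L * I₁ := by positivity
  have hq : 0 ≤ K * C := by positivity
  have hr : 0 ≤ C * I₃ := by positivity
  nlinarith [mul_nonneg hp hY0, mul_nonneg hp hZ.le, mul_nonneg hq hX.le, mul_nonneg hq hZ.le,
    mul_nonneg hr hX.le, mul_nonneg hr hY0]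

/-- The middle integral of `e^{(σ_M - δ)s}` is explicit: after multiplication by `e^{-σ_M t}` it has
the slower of the two rates, and the factor `t` appears at resonance `δ = σ_M`. -/
theorem isBigO_remainder {u : ℝ → ℝ} {δ δ₀ : ℝ} (hu : ExpBounded u δ δ₀) (hδ : -σ 0 < δ)
    (hδ₀ : -σ 0 < δ₀) {M : ℕ} (hM : ∀ j < M, σ j < δ) :
    (δ ≠ σ M → (fun t => particular (expGreen σ c) u t -
        ∑ j ∈ Finset.range M, c j * (∫ s, Real.exp (σ j * s) * u s) * Real.exp (-σ j * t))
      =O[atTop] fun t => Real.exp (-(min δ (σ M)) * t)) ∧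
    (δ = σ M → (fun t => particular (expGreen σ c) u t -
        ∑ j ∈ Finset.range M, c j * (∫ s, Real.exp (σ j * s) * u s) * Real.exp (-σ j * t))
      =O[atTop] fun t => t * Real.exp (-δ * t)) := by
  obtain ⟨C, T, hC, hT, hb⟩ := h.exists_bound_remainder hu hδ hδ₀ hM
  set S := σ M with hS
  constructor
  · intro hne
    have hne' : S - δ ≠ 0 := sub_ne_zero.2 hne.symm
    set A := (Real.exp ((S - δ) * T) + 1) * |(S - δ)⁻¹| with hA
    refine IsBigO.of_bound (C * (1 + A + 1)) ?_
    filter_upwards [eventually_ge_atTop (T + 1)] with t ht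
    have ht0 : 0 ≤ t := by linarith
    rw [Real.norm_eq_abs, Real.norm_of_nonneg (Real.exp_pos _).le]
    refine (hb t ht).trans ?_
    rw [mul_assoc]
    refine mul_le_mul_of_nonneg_left ?_ hC
    set W := Real.exp (-(min δ S) * t) with hW
    have h1 : Real.exp (-S * t) ≤ W := Real.exp_le_exp.2
      (mul_le_mul_of_nonneg_right (neg_le_neg (min_le_right _ _)) ht0)
    have h2 : Real.exp (-δ * t) ≤ W := Real.exp_le_exp.2
      (mul_le_mul_of_nonneg_right (neg_le_neg (min_le_left _ _)) ht0)
    have h3 : Real.exp (-S * t) * (∫ s in T..t, Real.exp ((S - δ) * s)) ≤ A * W := by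
      have hint : ∫ s in T..t, Real.exp ((S - δ) * s) =
          (Real.exp ((S - δ) * t) - Real.exp ((S - δ) * T)) * (S - δ)⁻¹ := by
        have h4 : ∀ s : ℝ, HasDerivAt (fun s : ℝ => Real.exp ((S - δ) * s) * (S - δ)⁻¹)
            (Real.exp ((S - δ) * s)) s := fun s => by
          have h4 : HasDerivAt (fun s : ℝ => (S - δ) * s) (S - δ) s := by
            simpa using (hasDerivAt_id s).const_mul (S - δ)
          have := h4.exp.mul_const (S - δ)⁻¹
          rwa [mul_inv_cancel_right₀ hne'] at this
        rw [intervalIntegral.integral_eq_sub_of_hasDerivAt (fun s _ => h4 s)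
          (Continuous.intervalIntegrable (by fun_prop) _ _)]
        ring
      rw [hint, ← mul_assoc]
      have h5 : |Real.exp (-S * t) * (Real.exp ((S - δ) * t) - Real.exp ((S - δ) * T))| ≤
          (Real.exp ((S - δ) * T) + 1) * W := by
        have e : Real.exp (-S * t) * Real.exp ((S - δ) * t) = Real.exp (-δ * t) := by
          rw [← Real.exp_add]; ring_nf
        rw [mul_sub, e]
        refine (abs_sub _ _).trans ?_
        rw [abs_of_pos (Real.exp_pos _), abs_of_pos (by positivity)]
        have := mul_le_mul_of_nonneg_right h1 (Real.exp_pos ((S - δ) * T)).le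
        linarith
      refine (le_abs_self _).trans ?_
      rw [abs_mul, hA]
      have := mul_le_mul_of_nonneg_right h5 (abs_nonneg (S - δ)⁻¹)
      linarith
    linarith
  · intro heq
    refine IsBigO.of_bound (C * 3) ?_
    filter_upwards [eventually_ge_atTop (T + 1)] with t ht
    have ht0 : 1 ≤ t := by linarith
    rw [Real.norm_eq_abs, Real.norm_of_nonneg (by positivity)]
    refine (hb t ht).trans ?_
    rw [mul_assoc]
    refine mul_le_mul_of_nonneg_left ?_ hC
    rw [← heq]
    simp only [sub_self, zero_mul, Real.exp_zero, intervalIntegral.integral_const, smul_eq_mul,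
      mul_one]
    have := Real.exp_pos (-δ * t)
    nlinarith

theorem isBigO_particular_atBot {u : ℝ → ℝ} {δ δ₀ : ℝ} (hu : ExpBounded u δ δ₀) (hδ : -σ 0 < δ)
    (hδ₀ : -σ 0 < δ₀) :
    (δ₀ ≠ σ 0 → particular (expGreen σ c) u
      =O[atBot] fun t => Real.exp (-(min δ₀ (σ 0)) * |t|)) ∧
    (δ₀ = σ 0 → particular (expGreen σ c) u
      =O[atBot] fun t => |t| * Real.exp (-δ₀ * |t|)) := by
  -- By evenness of the kernel, `-∞` is `+∞` for the reflected source, with `δ` and `δ₀` exchanged;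
  -- `M = 0` subtracts nothing.
  have hr := h.isBigO_remainder hu.comp_neg hδ₀ hδ (M := 0) (fun j hj => absurd hj (by omega))
  simp only [Finset.range_zero, Finset.sum_empty, sub_zero, particular_expGreen_comp_neg] at hr
  have habs : ∀ᶠ t : ℝ in atBot, -t = |t| := by
    filter_upwards [eventually_le_atBot 0] with t ht
    rw [abs_of_nonpos ht]
  refine ⟨fun hne => ?_, fun heq => ?_⟩
  · refine ((hr.1 hne).comp_tendsto tendsto_neg_atBot_atTop).congr' ?_ ?_
    · exact Eventually.of_forall fun t => by simp
    · filter_upwards [habs] with t ht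
      simp only [Function.comp_apply, ht]
  · refine ((hr.2 heq).comp_tendsto tendsto_neg_atBot_atTop).congr' ?_ ?_
    · exact Eventually.of_forall fun t => by simp
    · filter_upwards [habs] with t ht
      simp only [Function.comp_apply, ht]

end ExpSeries

/-! ### Test functions and their Fourier transforms -/

theorem fourierHat_eq_fourier (v : ℝ → ℂ) (ξ : ℝ) :
    fourierHat v ξ = ((1 / √(2 * π) : ℝ) : ℂ) * 𝓕 v (ξ / (2 * π)) := by
  rw [fourierHat, Real.fourier_real_eq_integral_exp_smul]
  congr 1
  refine integral_congr_ae (ae_of_all _ fun t => ?_)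
  have : -2 * π * t * (ξ / (2 * π)) = -(ξ * t) := by
    field_simp
  simp only [this, smul_eq_mul]
  push_cast
  ring_nf

theorem integral_cexp_mul_fourierHat_eq (v : ℝ → ℂ) (t : ℝ) :
    ((1 / √(2 * π) : ℝ) : ℂ) * ∫ ξ : ℝ, Complex.exp (Complex.I * ξ * t) * fourierHat v ξ =
      𝓕⁻ (𝓕 v) t := by
  have h1 : ∀ ξ : ℝ, Complex.exp (Complex.I * ξ * t) * fourierHat v ξ =
      ((1 / √(2 * π) : ℝ) : ℂ) * (fun η : ℝ => Complex.exp (((2 * π * (η * t) : ℝ) : ℂ) * Complex.I) *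
        𝓕 v η) (ξ / (2 * π)) := fun ξ => by
    have e : (2 * π * (ξ / (2 * π) * t) : ℝ) = ξ * t := by field_simp
    simp only [fourierHat_eq_fourier, e]
    push_cast
    ring_nf
  simp only [h1]
  rw [integral_const_mul, Measure.integral_comp_div (fun η : ℝ =>
    Complex.exp (((2 * π * (η * t) : ℝ) : ℂ) * Complex.I) * 𝓕 v η), Real.fourierInv_eq',
    abs_of_pos (by positivity), Complex.real_smul, ← mul_assoc, ← mul_assoc, ← Complex.ofReal_mul,
    ← Complex.ofReal_mul]
  have : 1 / √(2 * π) * (1 / √(2 * π)) * (2 * π) = 1 := by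
    rw [div_mul_div_comm, Real.mul_self_sqrt (by positivity)]
    field_simp
  rw [this, Complex.ofReal_one, one_mul]
  refine integral_congr_ae (ae_of_all _ fun η => ?_)
  simp [mul_comm t η]

section TestFunction

variable {φ : ℝ → ℂ} (hφ : ContDiff ℝ ∞ φ) (hc : HasCompactSupport φ)
include hφ hc

theorem integrable_fourierHat : Integrable (fourierHat φ) := by
  have h1 : Integrable (𝓕 φ) := (𝓕 (hc.toSchwartzMap hφ)).integrable
  refine ((h1.comp_div (R := 2 * π) (by positivity)).const_mul
    (((1 / √(2 * π) : ℝ) : ℂ))).congr (ae_of_all _ fun ξ => ?_)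
  rw [fourierHat_eq_fourier]

theorem integral_cexp_mul_fourierHat (t : ℝ) :
    ((1 / √(2 * π) : ℝ) : ℂ) * ∫ ξ : ℝ, Complex.exp (Complex.I * ξ * t) * fourierHat φ ξ = φ t := by
  rw [integral_cexp_mul_fourierHat_eq]
  have h1 : Integrable (𝓕 φ) := (𝓕 (hc.toSchwartzMap hφ)).integrable
  exact congrFun (hφ.continuous.fourierInv_fourier_eq
    (hφ.continuous.integrable_of_hasCompactSupport hc) h1) t

theorem fourierHat_deriv (ξ : ℝ) : fourierHat (deriv φ) ξ = Complex.I * ξ * fourierHat φ ξ := by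
  have hd : ContDiff ℝ ∞ (deriv φ) := (contDiff_infty_iff_deriv.1 hφ).2
  have h1 := congrFun (Real.fourier_deriv (hφ.continuous.integrable_of_hasCompactSupport hc)
    (hφ.differentiable (by simp)) (hd.continuous.integrable_of_hasCompactSupport hc.deriv))
    (ξ / (2 * π))
  rw [fourierHat_eq_fourier, h1, fourierHat_eq_fourier, smul_eq_mul]
  have hπ : (π : ℂ) ≠ 0 := Complex.ofReal_ne_zero.2 Real.pi_ne_zero
  push_cast
  field_simp

theorem exists_fourierHat_eq_mul (a b : ℝ) : ∃ χ : ℝ → ℂ, ContDiff ℝ ∞ χ ∧ HasCompactSupport χ ∧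
    ∀ ξ : ℝ, fourierHat χ ξ = ((a + b * ξ ^ 2 : ℝ) : ℂ) * fourierHat φ ξ := by
  have hd : ContDiff ℝ ∞ (deriv φ) := (contDiff_infty_iff_deriv.1 hφ).2
  have hdd : ContDiff ℝ ∞ (deriv (deriv φ)) := (contDiff_infty_iff_deriv.1 hd).2
  -- The function is `aφ - bφ''`, since two derivatives multiply the transform by `-ξ²`.
  refine ⟨fun t => (a : ℂ) * φ t + (-b : ℂ) * deriv (deriv φ) t,
    (contDiff_const.mul hφ).add (contDiff_const.mul hdd),
    (hc.mul_left).add (hc.deriv.deriv.mul_left), fun ξ => ?_⟩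
  have h2 : fourierHat (deriv (deriv φ)) ξ = -(ξ : ℂ) ^ 2 * fourierHat φ ξ := by
    rw [fourierHat_deriv hd hc.deriv, fourierHat_deriv hφ hc]
    linear_combination (ξ : ℂ) ^ 2 * fourierHat φ ξ * Complex.I_sq
  have hi : ∀ f : ℝ → ℂ, Continuous f → HasCompactSupport f →
      Integrable fun t : ℝ => Complex.exp (-Complex.I * ξ * t) * f t := fun f hf hfc =>
    Continuous.integrable_of_hasCompactSupport (by fun_prop) hfc.mul_left
  have h3 : fourierHat (fun t => (a : ℂ) * φ t + (-b : ℂ) * deriv (deriv φ) t) ξ =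
      (a : ℂ) * fourierHat φ ξ + (-b : ℂ) * fourierHat (deriv (deriv φ)) ξ := by
    simp only [fourierHat, mul_add, mul_left_comm (Complex.exp _)]
    rw [integral_add ((hi _ hφ.continuous hc).const_mul _)
      ((hi _ hdd.continuous hc.deriv.deriv).const_mul _), integral_const_mul, integral_const_mul]
    ring
  rw [h3, h2]
  push_cast
  ring

end TestFunction

/-! ### Fourier multipliers given by exponential series -/

/-- The Fourier transform `∑ 2 c j σ j / (σ j ^ 2 + ξ ^ 2)` of an exponential series. -/
noncomputable def expSymbol (σ c : ℕ → ℝ) (ξ : ℝ) : ℝ := ∑' j, c j * (2 * σ j / (σ j ^ 2 + ξ ^ 2))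

namespace ExpSeries

variable {σ c : ℕ → ℝ} (h : ExpSeries σ c)
include h

theorem integrable_expSymbol_mul {v : ℝ → ℂ} (hv : Integrable v) :
    Integrable fun ξ => (expSymbol σ c ξ : ℂ) * v ξ := by
  have e : ∀ ξ : ℝ, (expSymbol σ c ξ : ℂ) =
      ∫ t : ℝ, (expGreen σ c t : ℂ) * Complex.exp (Complex.I * ξ * t) := fun ξ =>
    (h.integral_expGreen_mul_cexp ξ).symm
  have hnorm : ∀ ξ t : ℝ, ‖(expGreen σ c t : ℂ) * Complex.exp (Complex.I * ξ * t)‖ =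
      ‖expGreen σ c t‖ := fun ξ t => by
    rw [norm_mul, Complex.norm_exp, Complex.norm_real]; simp
  have hcont : Continuous fun ξ : ℝ => (expSymbol σ c ξ : ℂ) := by
    simp only [e]
    refine continuous_of_dominated (bound := fun t => ‖expGreen σ c t‖) (fun ξ => ?_)
      (fun ξ => ae_of_all _ fun t => (hnorm ξ t).le) h.integrable_expGreen.norm
      (ae_of_all _ fun t => by fun_prop)
    exact h.integrable_expGreen.ofReal.1.mul (Continuous.aestronglyMeasurable (by fun_prop))
  refine hv.bdd_mul (c := ∫ t, ‖expGreen σ c t‖) hcont.aestronglyMeasurable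
    (ae_of_all _ fun ξ => ?_)
  rw [e]
  refine (norm_integral_le_integral_norm _).trans_eq ?_
  simp only [hnorm]

/-- Convolution theorem in the form needed: Fubini, then the substitution `s ↦ t - s` produces the
symbol at `-ξ`, and the symbol is even. -/
theorem integral_expGreen_mul_integral_cexp {v : ℝ → ℂ} (hv : Integrable v) (t : ℝ) :
    ∫ s : ℝ, (expGreen σ c (t - s) : ℂ) * ∫ ξ : ℝ, Complex.exp (Complex.I * ξ * s) * v ξ =
      ∫ ξ : ℝ, Complex.exp (Complex.I * ξ * t) * ((expSymbol σ c ξ : ℂ) * v ξ) := by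
  have hG : Integrable fun s => (expGreen σ c (t - s) : ℂ) :=
    (h.integrable_expGreen.comp_sub_left t).ofReal
  have hint : Integrable (fun p : ℝ × ℝ => (expGreen σ c (t - p.1) : ℂ) *
      (Complex.exp (Complex.I * p.2 * p.1) * v p.2)) (volume.prod volume) := by
    refine ((hG.mul_prod hv).bdd_mul (c := 1)
      (f := fun p : ℝ × ℝ => Complex.exp (Complex.I * p.2 * p.1))
      (Continuous.aestronglyMeasurable (by fun_prop)) (ae_of_all _ fun p => ?_)).congr
      (ae_of_all _ fun p => ?_)
    · rw [Complex.norm_exp]; simp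
    · simp only; ring
  simp only [← integral_const_mul]
  rw [integral_integral_swap hint]
  refine integral_congr_ae (ae_of_all _ fun ξ => ?_)
  have h1 := h.integral_expGreen_mul_cexp (-ξ)
  rw [← integral_sub_left_eq_self _ _ t, show ∑' j, c j * (2 * σ j / (σ j ^ 2 + (-ξ) ^ 2)) =
    expSymbol σ c ξ by simp only [expSymbol, neg_sq]] at h1
  simp only
  rw [← h1, ← integral_mul_const, ← integral_const_mul]
  refine integral_congr_ae (ae_of_all _ fun s => ?_)
  have e : Complex.exp (Complex.I * ξ * s) = Complex.exp (Complex.I * ξ * t) *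
      Complex.exp (Complex.I * ((-ξ : ℝ) : ℂ) * ((t - s : ℝ) : ℂ)) := by
    rw [← Complex.exp_add]
    push_cast
    ring_nf
  simp only [e]
  ring

theorem exists_norm_integral_expGreen_mul_le {χ : ℝ → ℂ} (hχ : Continuous χ)
    (hc : HasCompactSupport χ) {α : ℝ} (hα0 : 0 ≤ α) (hα : α < σ 0) :
    ∃ C, ∀ t, ‖∫ s, (expGreen σ c (t - s) : ℂ) * χ s‖ ≤ C * Real.exp (-α * |t|) := by
  obtain ⟨M, hM⟩ := (show Continuous fun s : ℝ => ((Real.exp (α * |s|) : ℝ) : ℂ) * χ s by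
    fun_prop).bounded_above_of_compact_support hc.mul_left
  refine ⟨M * ∫ s, expGreen σ c s * Real.exp (α * |s|), fun t => ?_⟩
  have h1 := (h.integrable_expGreen_mul_exp hα0 hα)
  have h2 := ((h1.comp_sub_left t).const_mul (M * Real.exp (-α * |t|)))
  refine (norm_integral_le_of_norm_le h2 (ae_of_all _ fun s => ?_)).trans_eq ?_
  · have h3 := hM s
    have h4 := h.expGreen_nonneg (t - s)
    rw [norm_mul, Complex.norm_real, Real.norm_of_nonneg (Real.exp_pos _).le] at h3
    have h5 : 1 ≤ Real.exp (-α * |t|) * Real.exp (α * |t - s|) * Real.exp (α * |s|) := by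
      rw [← Real.exp_add, ← Real.exp_add, Real.one_le_exp_iff]
      have := abs_sub_abs_le_abs_sub t s
      nlinarith
    rw [norm_mul, Complex.norm_real, Real.norm_of_nonneg h4]
    have h6 : ‖χ s‖ ≤ Real.exp (-α * |t|) * Real.exp (α * |t - s|) * M := by
      calc ‖χ s‖ ≤ Real.exp (-α * |t|) * Real.exp (α * |t - s|) * Real.exp (α * |s|) * ‖χ s‖ :=
            le_mul_of_one_le_left (norm_nonneg _) h5
        _ = Real.exp (-α * |t|) * Real.exp (α * |t - s|) * (Real.exp (α * |s|) * ‖χ s‖) := by ring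
        _ ≤ _ := mul_le_mul_of_nonneg_left h3 (by positivity)
    refine (mul_le_mul_of_nonneg_left h6 h4).trans_eq ?_
    ring
  · rw [integral_const_mul,
      integral_sub_left_eq_self (fun s => expGreen σ c s * Real.exp (α * |s|)) _ t]
    ring

end ExpSeries

/-! ### The convolution solves the equation -/

namespace ExpSeries

variable {n m : ℕ} {γ κ a b : ℝ} {σ c σ' c' : ℕ → ℝ}

/-- The quadratic factor is absorbed into a test function `χ = aφ - bφ''`, so the growing multiplier
becomes a convolution of `χ` with an exponentially decaying kernel. -/
theorem exists_norm_projOp_le (h' : ExpSeries σ' c')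
    (hΘ : ∀ ξ : ℝ, symbol n γ m ξ = ((expSymbol σ' c' ξ * (a + b * ξ ^ 2) : ℝ) : ℂ))
    {φ : ℝ → ℂ} (hφ : ContDiff ℝ ∞ φ) (hc : HasCompactSupport φ) {α : ℝ} (hα0 : 0 ≤ α)
    (hα : α < σ' 0) :
    (Integrable fun ξ : ℝ => symbol n γ m ξ * fourierHat φ ξ) ∧
      ∃ C, ∀ t, ‖projOp n γ m φ t‖ ≤ C * Real.exp (-α * |t|) := by
  obtain ⟨χ, hχ, hχc, hχφ⟩ := exists_fourierHat_eq_mul hφ hc a b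
  have e : ∀ ξ : ℝ, symbol n γ m ξ * fourierHat φ ξ =
      (expSymbol σ' c' ξ : ℂ) * fourierHat χ ξ := fun ξ => by
    rw [hΘ, hχφ]
    push_cast
    ring
  have hi := integrable_fourierHat hχ hχc
  refine ⟨by simpa only [e] using h'.integrable_expSymbol_mul hi, ?_⟩
  obtain ⟨C, hC⟩ := h'.exists_norm_integral_expGreen_mul_le hχ.continuous hχc hα0 hα
  refine ⟨C, fun t => ?_⟩
  have h1 : projOp n γ m φ t = ∫ s, (expGreen σ' c' (t - s) : ℂ) * χ s := by
    simp only [projOp, e]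
    rw [← h'.integral_expGreen_mul_integral_cexp hi, ← integral_const_mul]
    refine integral_congr_ae (ae_of_all _ fun s => ?_)
    simp only
    rw [mul_left_comm, integral_cexp_mul_fourierHat hχ hχc]
  rw [h1]
  exact hC t

variable (h : ExpSeries σ c)
include h

theorem integral_expGreen_mul_projOp_sub
    (hD : ∀ ξ : ℝ, (expSymbol σ c ξ : ℂ) * (symbol n γ m ξ - κ) = 1)
    {φ : ℝ → ℂ} (hφ : ContDiff ℝ ∞ φ) (hc : HasCompactSupport φ)
    (hi : Integrable fun ξ : ℝ => symbol n γ m ξ * fourierHat φ ξ) (t : ℝ) :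
    ∫ s, (expGreen σ c (t - s) : ℂ) * (projOp n γ m φ s - κ * φ s) = φ t := by
  set k : ℂ := ((1 / √(2 * π) : ℝ) : ℂ) with hk
  have hφi := integrable_fourierHat hφ hc
  have hb : ∀ {f : ℝ → ℂ}, Integrable f → ∀ s : ℝ,
      Integrable fun ξ : ℝ => Complex.exp (Complex.I * ξ * s) * f ξ := fun hf s =>
    hf.bdd_mul (c := 1) (Continuous.aestronglyMeasurable (by fun_prop)) (ae_of_all _ fun ξ => by
      rw [Complex.norm_exp]; simp)
  have h1 : ∀ s : ℝ, projOp n γ m φ s - κ * φ s =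
      ∫ ξ : ℝ, Complex.exp (Complex.I * ξ * s) * (k * ((symbol n γ m ξ - κ) * fourierHat φ ξ)) :=
    fun s => by
      rw [← integral_cexp_mul_fourierHat hφ hc s, projOp, ← hk, mul_left_comm, ← mul_sub,
        ← integral_const_mul, ← integral_sub (hb hi s) ((hb hφi s).const_mul _),
        ← integral_const_mul]
      refine integral_congr_ae (ae_of_all _ fun ξ => ?_)
      simp only
      ring
  have hv : Integrable fun ξ : ℝ => k * ((symbol n γ m ξ - κ) * fourierHat φ ξ) := by
    simp only [sub_mul]
    exact (hi.sub (hφi.const_mul _)).const_mul _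
  simp only [h1]
  rw [h.integral_expGreen_mul_integral_cexp hv, ← integral_cexp_mul_fourierHat hφ hc t,
    ← integral_const_mul]
  refine integral_congr_ae (ae_of_all _ fun ξ => ?_)
  simp only
  linear_combination Complex.exp (Complex.I * ξ * t) * k * fourierHat φ ξ * hD ξ

theorem integrable_exp_mul_particular {u : ℝ → ℝ} {α : ℝ} (hα0 : 0 ≤ α) (hα : α < σ 0)
    (hu : Integrable fun t => Real.exp (-α * |t|) * u t) :
    Integrable fun t => Real.exp (-α * |t|) * particular (expGreen σ c) u t := by
  simpa only [integral_const_mul, particular] using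
    (h.integrable_prod hα0 hα hu).integral_prod_left

theorem locallyIntegrable_particular {u : ℝ → ℝ} {α : ℝ} (hα0 : 0 ≤ α) (hα : α < σ 0)
    (hu : Integrable fun t => Real.exp (-α * |t|) * u t) :
    LocallyIntegrable (particular (expGreen σ c) u) := by
  have h1 := (h.integrable_exp_mul_particular hα0 hα hu).locallyIntegrable.mul_continuous
    (show Continuous fun t : ℝ => Real.exp (α * |t|) by fun_prop)
  refine h1.congr (ae_of_all _ fun t => ?_)
  simp only
  rw [mul_right_comm, ← Real.exp_add]
  simp

theorem ae_integrable_expGreen_mul {u : ℝ → ℝ} {α : ℝ} (hα0 : 0 ≤ α) (hα : α < σ 0)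
    (hu : Integrable fun t => Real.exp (-α * |t|) * u t) :
    ∀ᵐ t, Integrable fun s => expGreen σ c (t - s) * u s := by
  filter_upwards [(h.integrable_prod hα0 hα hu).prod_right_ae] with t ht
  refine (ht.const_mul (Real.exp (α * |t|))).congr (ae_of_all _ fun s => ?_)
  simp only
  rw [← mul_assoc, ← Real.exp_add]
  simp

/-- Fubini moves the convolution onto the test function, where, by evenness of the kernel, it
inverts `P - κ`. The condition `σ 0 ≤ σ' 0` makes `Pφ` decay fast enough for every weight `α < σ 0`.
-/
theorem isSolution_particular (h' : ExpSeries σ' c') (hσ : σ 0 ≤ σ' 0)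
    (hΘ : ∀ ξ : ℝ, symbol n γ m ξ = ((expSymbol σ' c' ξ * (a + b * ξ ^ 2) : ℝ) : ℂ))
    (hD : ∀ ξ : ℝ, (expSymbol σ c ξ : ℂ) * (symbol n γ m ξ - κ) = 1)
    {u : ℝ → ℝ} (hul : LocallyIntegrable u) {α : ℝ} (hα0 : 0 ≤ α) (hα : α < σ 0)
    (hu : Integrable fun t => Real.exp (-α * |t|) * u t) :
    IsSolution n γ m κ (particular (expGreen σ c) u) u := by
  refine ⟨h.locallyIntegrable_particular hα0 hα hu, hul, fun φ hφ hc => ?_⟩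
  obtain ⟨hi, C, hC⟩ := h'.exists_norm_projOp_le hΘ hφ hc hα0 (hα.trans_le hσ)
  have hP : Continuous (projOp n γ m φ) := by
    refine continuous_const.mul (continuous_of_dominated
      (bound := fun ξ : ℝ => ‖symbol n γ m ξ * fourierHat φ ξ‖) (fun t => ?_)
      (fun t => ae_of_all _ fun ξ => ?_) hi.norm (ae_of_all _ fun ξ => by fun_prop))
    · exact (Continuous.aestronglyMeasurable (by fun_prop)).mul hi.1
    · rw [norm_mul, Complex.norm_exp]; simp
  have hexp : ∀ (f : ℝ → ℂ) (C : ℝ), (∀ t, ‖f t‖ ≤ C * Real.exp (-α * |t|)) →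
      ∀ t : ℝ, ‖((Real.exp (α * |t|) : ℝ) : ℂ) * f t‖ ≤ C := fun f C hf t => by
    rw [norm_mul, Complex.norm_real, Real.norm_of_nonneg (Real.exp_pos _).le]
    refine (mul_le_mul_of_nonneg_left (hf t) (Real.exp_pos _).le).trans_eq ?_
    rw [mul_left_comm, ← Real.exp_add]
    simp
  have hcancel : ∀ t : ℝ, ((Real.exp (α * |t|) : ℝ) : ℂ) * ((Real.exp (-α * |t|) : ℝ) : ℂ) = 1 :=
    fun t => by
      rw [← Complex.ofReal_mul, ← Real.exp_add]
      simp
  have hce : Continuous fun t : ℝ => ((Real.exp (α * |t|) : ℝ) : ℂ) := by fun_prop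
  constructor
  · refine ((h.integrable_exp_mul_particular hα0 hα hu).ofReal.bdd_mul (c := C)
      (hce.mul hP).aestronglyMeasurable (ae_of_all _ (hexp _ C hC))).congr
      (ae_of_all _ fun t => ?_)
    simp only [Pi.mul_apply]
    push_cast [-Complex.ofReal_exp]
    linear_combination projOp n γ m φ t * (particular (expGreen σ c) u t : ℂ) * hcancel t
  set ψ : ℝ → ℂ := fun t => projOp n γ m φ t - κ * φ t with hψ
  have hψc : Continuous ψ := hP.sub (continuous_const.mul hφ.continuous)
  obtain ⟨M, hM⟩ := (hce.mul hφ.continuous).bounded_above_of_compact_support hc.mul_left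
  have hψb : ∀ t : ℝ, ‖((Real.exp (α * |t|) : ℝ) : ℂ) * ψ t‖ ≤ C + ‖(κ : ℂ)‖ * M := fun t => by
    rw [hψ, mul_sub, mul_left_comm]
    refine (norm_sub_le _ _).trans (add_le_add (hexp _ C hC t) ?_)
    rw [norm_mul]
    exact mul_le_mul_of_nonneg_left (hM t) (norm_nonneg _)
  have hF : Integrable (fun p : ℝ × ℝ => ((expGreen σ c (p.1 - p.2) * u p.2 : ℝ) : ℂ) * ψ p.1)
      (volume.prod volume) := by
    refine ((h.integrable_prod hα0 hα hu).ofReal.bdd_mul (c := C + ‖(κ : ℂ)‖ * M)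
      (f := fun p : ℝ × ℝ => ((Real.exp (α * |p.1|) : ℝ) : ℂ) * ψ p.1)
      (Continuous.aestronglyMeasurable (by fun_prop)) (ae_of_all _ fun p => hψb p.1)).congr
      (ae_of_all _ fun p => ?_)
    simp only
    push_cast [-Complex.ofReal_exp]
    linear_combination ψ p.1 * (expGreen σ c (p.1 - p.2) : ℂ) * (u p.2 : ℂ) * hcancel p.1
  calc ∫ t, (particular (expGreen σ c) u t : ℂ) * ψ t
      = ∫ t, ∫ s, ((expGreen σ c (t - s) * u s : ℝ) : ℂ) * ψ t := by
        refine integral_congr_ae (ae_of_all _ fun t => ?_)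
        simp only
        rw [integral_mul_const, integral_complex_ofReal, particular]
    _ = ∫ s, ∫ t, ((expGreen σ c (t - s) * u s : ℝ) : ℂ) * ψ t := integral_integral_swap hF
    _ = ∫ s, (u s : ℂ) * φ s := by
        refine integral_congr_ae (ae_of_all _ fun s => ?_)
        simp only
        rw [← h.integral_expGreen_mul_projOp_sub hD hφ hc hi s, ← integral_const_mul]
        refine integral_congr_ae (ae_of_all _ fun t => ?_)
        simp only
        rw [← expGreen_neg, neg_sub]
        push_cast
        ring

end ExpSeries

/-! ### The constants -/

/-- If `B < A < B + 1`, the pair `(B + 1, A)` again satisfies `A < B + 1 < A + 1`, so the reciprocal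
on the right has the partial fractions of the case `κ = 0`. -/
theorem gammaQuot_eq_mul {A B : ℝ} (hA : 0 < A) (hB : 0 < B) (ξ : ℝ) :
    gammaQuot A B ξ = ((B ^ 2 + 4⁻¹ * ξ ^ 2 : ℝ) : ℂ) * (gammaQuot (B + 1) A ξ)⁻¹ := by
  obtain ⟨hA1, hA2⟩ := Gamma_add_mul_I_ne_zero hA ξ
  obtain ⟨hB1, hB2⟩ := Gamma_add_mul_I_ne_zero hB ξ
  have hz : ∀ z : ℂ, (B : ℂ) + z ≠ 0 → Complex.Gamma (((B + 1 : ℝ) : ℂ) + z) =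
      ((B : ℂ) + z) * Complex.Gamma ((B : ℂ) + z) := fun z hz => by
    rw [← Complex.Gamma_add_one _ hz]
    push_cast
    ring_nf
  have h1 : (B : ℂ) + ξ * Complex.I / 2 ≠ 0 := fun h0 => hB.ne' (by
    simpa using congrArg Complex.re h0)
  have h2 : (B : ℂ) + -(ξ * Complex.I / 2) ≠ 0 := fun h0 => hB.ne' (by
    simpa using congrArg Complex.re h0)
  have e : ((B ^ 2 + 4⁻¹ * ξ ^ 2 : ℝ) : ℂ) =
      ((B : ℂ) + ξ * Complex.I / 2) * ((B : ℂ) + -(ξ * Complex.I / 2)) := by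
    push_cast
    linear_combination ((ξ : ℂ) ^ 2 / 4) * Complex.I_sq
  rw [e, gammaQuot, gammaQuot]
  simp only [sub_eq_add_neg] at hA2 hB2 ⊢
  rw [hz _ h1, hz _ h2]
  generalize (B : ℂ) + ξ * Complex.I / 2 = p at *
  generalize (B : ℂ) + -(ξ * Complex.I / 2) = q at *
  generalize Complex.Gamma p = p' at *
  generalize Complex.Gamma q = q' at *
  field_simp

theorem sphereEigenvalue_nonneg {n : ℕ} (hn : 2 ≤ n) (m : ℕ) : 0 ≤ sphereEigenvalue n m := by
  have : (2 : ℝ) ≤ n := by exact_mod_cast hn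
  have h0 : (0 : ℝ) ≤ harmonicDegree n m := Nat.cast_nonneg _
  exact mul_nonneg h0 (by linarith)

theorem coeffA_sub_coeffB (n : ℕ) (γ : ℝ) (m : ℕ) : coeffA n γ m - coeffB n γ m = γ := by
  simp only [coeffA, coeffB]
  ring

theorem coeffB_pos (n : ℕ) {γ : ℝ} (hγ : γ < 1) (m : ℕ) : 0 < coeffB n γ m := by
  have := Real.sqrt_nonneg (((n : ℝ) / 2 - 1) ^ 2 + sphereEigenvalue n m)
  simp only [coeffB]
  linarith

/-- The Hardy constant is the value at zero for `B = (n - 2γ)/4`, and `coeffB` is at least this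
since sphere eigenvalues are nonnegative. -/
theorem hardyConst_le {n : ℕ} (hn : 2 ≤ n) {γ : ℝ} (hγ₀ : 0 < γ) (hγ₁ : γ < 1) (m : ℕ) :
    hardyConst n γ ≤ (2 : ℝ) ^ (2 * γ) *
      (Real.Gamma (coeffA n γ m) / Real.Gamma (coeffB n γ m)) ^ 2 := by
  have hn' : (2 : ℝ) ≤ n := by exact_mod_cast hn
  refine mul_le_mul_of_nonneg_left (Gamma_div_Gamma_sq_le (by linarith) ?_ (by linarith) ?_)
    (by positivity)
  · have h1 : (n : ℝ) / 2 - 1 ≤ √(((n : ℝ) / 2 - 1) ^ 2 + sphereEigenvalue n m) :=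
      Real.le_sqrt_of_sq_le (by linarith [sphereEigenvalue_nonneg hn m])
    simp only [coeffB]
    linarith
  · rw [coeffA_sub_coeffB]
    ring

theorem expansion_zero_eq (σ c : ℕ → ℝ) (h : ℝ → ℝ) (J : ℕ) (t : ℝ) :
    expansion σ (fun _ => 0) c h J t =
      ∑ j ∈ Finset.range (J + 1), c j * (∫ s, Real.exp (σ j * s) * h s) * Real.exp (-σ j * t) := by
  rw [Finset.sum_range_succ', add_comm, Finset.range_eq_Ico,
    Finset.sum_Ico_add' (fun j => c j * (∫ s, Real.exp (σ j * s) * h s) * Real.exp (-σ j * t)) 0 J 1]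
  simp only [expansion, momentCos, momentSin]
  simp [Finset.Ico_add_one_right_eq_Icc]

theorem mainTheorem3 (n : ℕ) (hn : 2 ≤ n) (γ : ℝ) (hγ₀ : 0 < γ) (hγ₁ : γ < 1)
    (κ : ℝ) (hκ₀ : 0 ≤ κ) (hκ₁ : κ < hardyConst n γ) (m : ℕ) :
    ∃ σ τ : ℕ → ℝ, IsPoleSequence n γ m κ σ τ ∧
    ∃ c c' : ℕ → ℝ,
      -- the function `𝓖 = green σ τ c c'` is the Green's function
      (∀ t : ℝ, t ≠ 0 → Summable (fun j : ℕ => greenTerm σ τ c c' (j + 1) t)) ∧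
      (∀ t : ℝ, t ≠ 0 →
        Tendsto (fun R : ℝ => (1 / (2 * π) : ℂ) * ∫ ξ in (-R)..R,
            Complex.exp (Complex.I * ξ * t) * (symbol n γ m (ξ : ℂ) - (κ : ℂ))⁻¹)
          atTop (𝓝 ((green σ τ c c' t : ℝ) : ℂ))) ∧
      (∀ t : ℝ, green σ τ c c' (-t) = green σ τ c c' t) ∧
      ContDiffOn ℝ ∞ (green σ τ c c') {0}ᶜ ∧
      ∀ (h : ℝ → ℝ) (δ δ₀ : ℝ), LocallyIntegrable h →
        -σ 0 < δ → -σ 0 < δ₀ →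
        h =O[atTop] (fun t : ℝ => Real.exp (-δ * t)) →
        h =O[atBot] (fun t : ℝ => Real.exp (δ₀ * t)) →
        -- the convolution is a particular solution
        (∀ᵐ t : ℝ, Integrable (fun s : ℝ => green σ τ c c' (t - s) * h s)) ∧
        (∀ t : ℝ, h =O[𝓝 t] (fun _ : ℝ => (1 : ℝ)) →
          Integrable (fun s : ℝ => green σ τ c c' (t - s) * h s)) ∧
        IsSolution n γ m κ (particular (green σ τ c c') h) h ∧
        -- its behaviour at `+∞`
        (∀ J : ℕ, σ J < δ →
          (∀ j : ℕ, j ≤ J → Integrable (fun s : ℝ => Real.exp (σ j * s) * h s)) ∧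
          (δ ≠ σ (J + 1) →
            (fun t : ℝ => particular (green σ τ c c') h t - expansion σ τ c h J t)
              =O[atTop] (fun t : ℝ => Real.exp (-(min δ (σ (J + 1))) * t))) ∧
          (δ = σ (J + 1) →
            (fun t : ℝ => particular (green σ τ c c') h t - expansion σ τ c h J t)
              =O[atTop] (fun t : ℝ => t * Real.exp (-δ * t)))) ∧
        -- its behaviour at `-∞`
        (δ₀ ≠ σ 0 →
          particular (green σ τ c c') h
            =O[atBot] (fun t : ℝ => Real.exp (-(min δ₀ (σ 0)) * |t|))) ∧
        (δ₀ = σ 0 →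
          particular (green σ τ c c') h
            =O[atBot] (fun t : ℝ => |t| * Real.exp (-δ₀ * |t|))) := by
  set A := coeffA n γ m with hA
  set B := coeffB n γ m with hB
  set q : ℝ := (2 : ℝ) ^ (2 * γ) with hq
  have hq0 : 0 < q := by positivity
  have hB0 : 0 < B := coeffB_pos n hγ₁ m
  have hAB : A - B = γ := coeffA_sub_coeffB n γ m
  have hκB : κ / q < (Real.Gamma A / Real.Gamma B) ^ 2 := by
    rw [div_lt_iff₀' hq0]
    exact hκ₁.trans_le (hardyConst_le hn hγ₀ hγ₁ m)
  obtain ⟨σ, d, hσm, hσ0, hd, hσt, hds, hσB, -, hpf, hpole⟩ :=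
    exists_partialFractions_gammaQuot hB0 (by linarith) (by linarith) (div_nonneg hκ₀ hq0.le) hκB
  -- Case `κ = 0` for the pair `(B + 1, A)`: its exponents are explicitly `2(A + j)`, which are
  -- compared below with `σ 0 ≤ 2B`.
  obtain ⟨σ', d', hσm', hσ0', hd', -, hds', -, hσA', hpf', -⟩ :=
    exists_partialFractions_gammaQuot (A := B + 1) (B := A) (κ := 0) (by linarith) (by linarith)
      (by linarith) le_rfl (by
        have h1 := Real.Gamma_pos_of_pos (show 0 < A by linarith)
        have h2 := Real.Gamma_pos_of_pos (show 0 < B + 1 by linarith)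
        positivity)
  have hsym : ∀ z : ℂ, symbol n γ m z - (κ : ℂ) = (q : ℂ) * (gammaQuot A B z - (κ / q : ℝ)) :=
    fun z => by
      have : (q : ℂ) ≠ 0 := Complex.ofReal_ne_zero.2 hq0.ne'
      rw [symbol_eq_gammaQuot, ← hA, ← hB, ← hq]
      push_cast
      field_simp
  have hinv : (fun z : ℂ => (symbol n γ m z - (κ : ℂ))⁻¹) =
      (fun _ => (q : ℂ)⁻¹) * fun z : ℂ => (gammaQuot A B z - (κ / q : ℝ))⁻¹ := by
    funext z
    rw [hsym, mul_inv, Pi.mul_apply]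
  have hS : ExpSeries σ (fun j => q⁻¹ * d j) :=
    ⟨hσm.monotone, hσ0, fun j => mul_nonneg (inv_nonneg.2 hq0.le) (hd j).le, by
      simpa only [mul_div_assoc] using hds.mul_left q⁻¹⟩
  have hS' : ExpSeries σ' (fun j => q * d' j) :=
    ⟨hσm'.monotone, hσ0', fun j => mul_nonneg hq0.le (hd' j).le, by
      simpa only [mul_div_assoc] using hds'.mul_left q⟩
  have hDinv : ∀ ξ : ℝ, (symbol n γ m ξ - (κ : ℂ))⁻¹ = (expSymbol σ (fun j => q⁻¹ * d j) ξ : ℂ) :=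
    fun ξ => by
      rw [hsym, mul_inv, (hpf ξ).2, ← Complex.ofReal_inv, ← Complex.ofReal_mul, ← tsum_mul_left]
      simp only [expSymbol, mul_assoc]
  have hD : ∀ ξ : ℝ, (expSymbol σ (fun j => q⁻¹ * d j) ξ : ℂ) * (symbol n γ m ξ - κ) = 1 :=
    fun ξ => by
      rw [← hDinv]
      refine inv_mul_cancel₀ ?_
      rw [hsym]
      refine mul_ne_zero (Complex.ofReal_ne_zero.2 hq0.ne') fun h0 => ?_
      have := congrArg Complex.re h0
      simp only [Complex.sub_re, Complex.ofReal_re, Complex.zero_re] at this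
      linarith [(hpf ξ).1]
  have hΘ : ∀ ξ : ℝ, symbol n γ m ξ =
      ((expSymbol σ' (fun j => q * d' j) ξ * (B ^ 2 + 4⁻¹ * ξ ^ 2) : ℝ) : ℂ) := fun ξ => by
    have h1 := (hpf' ξ).2
    rw [Complex.ofReal_zero, sub_zero] at h1
    rw [symbol_eq_gammaQuot, gammaQuot_eq_mul (by linarith) hB0, h1]
    simp only [expSymbol, mul_assoc, tsum_mul_left]
    push_cast
    ring
  have hσσ' : σ 0 ≤ σ' 0 := by
    rw [hσA' rfl 0]
    push_cast
    linarith
  -- All poles are imaginary and simple, so the frequencies and the sine coefficients are zero;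
  -- dividing by `q = 2^{2γ}` rescales the weights.
  refine ⟨σ, fun _ => 0, ⟨fun z => ?_, fun z => ?_, fun i j hij => ?_, hσm.monotone, hσ0,
    fun j hj => hσm hj, fun _ => le_rfl, rfl, ⟨0, fun _ _ => rfl, hσm.strictMonoOn _⟩, hσt⟩,
    fun j => q⁻¹ * d j, fun _ => 0, fun t ht => ?_, fun t ht => ?_, expGreen_neg _ _,
    hS.contDiffOn_expGreen, fun h δ δ₀ hl hδ hδ₀ hT hBt => ?_⟩
  · rw [hinv]
    exact (MeromorphicAt.const _ _).mul (meromorphicAt_inv_gammaQuot_sub A B (κ / q : ℝ) z)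
  · have : meromorphicOrderAt (fun _ : ℂ => (q : ℂ)⁻¹) z = 0 := by
      rw [meromorphicOrderAt_const, if_neg (inv_ne_zero (Complex.ofReal_ne_zero.2 hq0.ne'))]
    rw [hinv, meromorphicOrderAt_mul (MeromorphicAt.const _ _)
      (meromorphicAt_inv_gammaQuot_sub A B (κ / q : ℝ) z), this, zero_add, hpole]
    simp only [abs_eq_zero]
  · exact hσm.injective (Prod.ext_iff.1 hij).1
  · simp only [greenTerm_eq]
    exact (summable_nat_add_iff 1).2 (hS.summable_exp ht)
  · have h1 := (hS.tendsto_integral_green ht).const_mul (1 / (2 * π) : ℂ)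
    have hπ : (π : ℂ) ≠ 0 := Complex.ofReal_ne_zero.2 Real.pi_ne_zero
    rw [← mul_assoc, one_div_mul_cancel (by simp [hπ]), one_mul] at h1
    refine h1.congr fun R => ?_
    congr 1
    refine intervalIntegral.integral_congr fun ξ _ => ?_
    rw [hDinv, mul_comm, expSymbol]
  have hu : ExpBounded h δ δ₀ := ⟨hl, hT, hBt⟩
  obtain ⟨α, hα0, hα, hα1, hα2⟩ := exists_weight hσ0 hδ hδ₀
  have hui := hu.integrable_exp_neg_abs_mul hα1 hα2
  refine ⟨hS.ae_integrable_expGreen_mul hα0 hα hui, fun t ht =>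
    hS.integrable_mul_of_isBigO hα hα0 hl.aestronglyMeasurable hui ht,
    hS.isSolution_particular hS' hσσ' hΘ hD hl hα0 hα hui, fun J hJ => ⟨fun j hj => ?_, ?_⟩,
    hS.isBigO_particular_atBot hu hδ hδ₀⟩
  · have := hσm.monotone hj
    exact hu.integrable_exp_mul (by linarith) (by linarith [hσm.monotone (Nat.zero_le j)])
  · simp only [expansion_zero_eq]
    exact hS.isBigO_remainder hu hδ hδ₀ fun j hj =>
      (hσm.monotone (Nat.lt_succ_iff.1 hj)).trans_lt hJ
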